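/- Let $G$ be a compact Lie group with Lie algebra $\mathfrak g$, and let $\langle\cdot,\cdot\rangle$ be an invariant inner product on $\mathfrak g$. Let $f_{ijl}$ ($1\le i,j,l\le 7$) be the totally antisymmetric structure constants of the octonions, i.e. the coefficients of $e^{123}+e^{145}+e^{167}+e^{246}-e^{257}-e^{347}-e^{356}$. Let $1\le k\le\infty$ ($k=\infty$ meaning smooth), and let $\mathcal N$ be the space of $C^k$ maps $X=(X_0,\dots,X_7):[0,1]\to\mathfrak g\otimes\mathbb R^8$, with the $C^k$ topology, that satisfy the octonionic Nahm equations $$\frac{dX_i}{dt}+[X_0,X_i]+\frac12\sum_{j,l=1}^7 f_{ijl}[X_j,X_l]=0,\qquad i=1,\dots,7 .$$ Let $\mathcal G_0$ be the group of $C^{k+1}$ maps $g:[0,1]\to G$ with $g(0)=g(1)=1$, which acts on $\mathcal N$ by $X_0\mapsto gX_0g^{-1}-\frac{dg}{dt}g^{-1}$ and $X_i\mapsto gX_ig^{-1}$ for $i\ge1$. Let $\mathcal M=\mathcal N/\mathcal G_0$ be the moduli space, with the quotient topology. Then $\mathcal M$ is a smooth manifold (Hausdorff and second countable) of dimension $8\dim\mathfrak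 g$, with the quotient smooth structure: the projection $\pi:\mathcal N\to\mathcal M$ is smooth (it maps smooth families of solutions, with parameters in an open subset of a Banach space, to smooth maps into $\mathcal M$) and it has a smooth local section through every $X\in\mathcal N$. For every $X\in\mathcal N$ the differential of $\pi$ identifies the tangent space $T_{[X]}\mathcal M$ with the space $H_X$ of $C^k$ solutions $a=(a_0,\dots,a_7):[0,1]\to\mathfrak g\otimes\mathbb R^8$ of $$\frac{da_0}{dt}+\sum_{i=0}^7[X_i,a_i]=0,\qquad \frac{da_i}{dt}+[a_0,X_i]+[X_0,a_i]+\frac12\sum_{j,l=1}^7f_{ijl}\bigl([X_j,a_l]+[a_j,X_l]\bigr)=0\quad(1\le i\le7).$$ The $L^2$ metric, which under these identifications is $(a,b)\mapsto\int_0^1\sum_{i=0}^7\langle a_i,b_i\rangle\,dt$ on $H_X$, is a smooth Riemannian metric on $\mathcal M$, and it is complete: every Cauchy sequence for its Riemannian distance converges. -/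

import Mathlib

open Set Filter Topology MeasureTheory Bundle Manifold
open scoped ContDiff

noncomputable section

universe u v

namespace OctNahm

/-! ### Paths of class `C^k` on `[0,1]` -/

section Paths

variable {F : Type*} [NormedAddCommGroup F] [NormedSpace ℝ F]

/-- The `C^k` maps `[0,1] → F` (one-sided derivatives at the endpoints), as a subspace of the
continuous ones; `k = ⊤` means smooth. -/
def ckSubmodule (k : ℕ∞) (F : Type*) [NormedAddCommGroup F] [NormedSpace ℝ F] :
    Submodule ℝ C(unitInterval, F) where
  carrier := {f | ContDiffOn ℝ k (IccExtend zero_le_one f) (Icc 0 1)}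
  add_mem' {_ _} hf hg := ContDiffOn.add hf hg
  zero_mem' := contDiffOn_const (c := (0 : F))
  smul_mem' c _ hf := ContDiffOn.const_smul c hf

/-- The vector space of `C^k` paths `[0,1] → F`. This is a type synonym, because it does not carry
the topology of uniform convergence but the `C^k` topology defined below. -/
def CkPath (k : ℕ∞) (F : Type*) [NormedAddCommGroup F] [NormedSpace ℝ F] : Type _ :=
  ckSubmodule k F

namespace CkPath

variable {k : ℕ∞}

instance : AddCommGroup (CkPath k F) := inferInstanceAs (AddCommGroup (ckSubmodule k F))

instance : Module ℝ (CkPath k F) := inferInstanceAs (Module ℝ (ckSubmodule k F))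

/-- The path as a function on the real line, constant outside of `[0,1]`. -/
def ext (f : CkPath k F) : ℝ → F := IccExtend zero_le_one f.1

theorem contDiffOn_ext (f : CkPath k F) : ContDiffOn ℝ k f.ext (Icc 0 1) := f.2

theorem ext_add (f g : CkPath k F) : (f + g).ext = f.ext + g.ext := rfl

theorem ext_smul (c : ℝ) (f : CkPath k F) : (c • f).ext = c • f.ext := rfl

theorem ext_zero : (0 : CkPath k F).ext = 0 := rfl

/-- The derivative `df/dt` on `[0,1]`. -/
def dt (f : CkPath k F) (t : ℝ) : F := derivWithin f.ext (Icc 0 1) t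

theorem dt_add (hk : 1 ≤ k) (f g : CkPath k F) {t : ℝ} (ht : t ∈ Icc (0 : ℝ) 1) :
    (f + g).dt t = f.dt t + g.dt t := by
  have h : ∀ f : CkPath k F, DifferentiableWithinAt ℝ f.ext (Icc 0 1) t := fun f =>
    f.contDiffOn_ext.differentiableOn (by exact_mod_cast (one_pos.trans_le hk).ne') t ht
  unfold dt
  rw [ext_add, derivWithin_add (h f) (h g)]

theorem dt_smul (hk : 1 ≤ k) (c : ℝ) (f : CkPath k F) {t : ℝ} (ht : t ∈ Icc (0 : ℝ) 1) :
    (c • f).dt t = c • f.dt t := by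
  have h : DifferentiableWithinAt ℝ f.ext (Icc 0 1) t :=
    f.contDiffOn_ext.differentiableOn (by exact_mod_cast (one_pos.trans_le hk).ne') t ht
  unfold dt
  rw [ext_smul, derivWithin_const_smul c h]

/-- The `j`-th derivative, `j ≤ k`, as a continuous function on `[0,1]`. -/
def iterDeriv (j : ℕ) (hj : (j : ℕ∞) ≤ k) (f : CkPath k F) : C(unitInterval, F) where
  toFun t := iteratedDerivWithin j f.ext (Icc 0 1) t
  continuous_toFun := continuousOn_iff_continuous_domRestrict.1
    (f.contDiffOn_ext.continuousOn_iteratedDerivWithin (by exact_mod_cast hj)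
      (uniqueDiffOn_Icc zero_lt_one))

/-- The `C^k` topology: uniform convergence of all derivatives of order `≤ k`. -/
instance : TopologicalSpace (CkPath k F) :=
  ⨅ (j : ℕ) (hj : (j : ℕ∞) ≤ k), TopologicalSpace.induced (iterDeriv j hj) inferInstance

end CkPath

end Paths

/-! ### The Lie group, its Lie algebra and the octonionic Nahm equations

`G` is a Lie group modelled on `E`; its Lie algebra `T₁G` is, as a vector space, `E`. -/

variable {E : Type u} [NormedAddCommGroup E] [NormedSpace ℝ E]
variable (G : Type v) [TopologicalSpace G] [ChartedSpace E G] [Group G]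

/-- The Lie bracket of the Lie algebra of `G`. -/
def lie (x y : E) : E :=
  (fun a b : GroupLieAlgebra 𝓘(ℝ, E) G => (⁅a, b⁆ : GroupLieAlgebra 𝓘(ℝ, E) G)) x y

/-- The adjoint action `x ↦ g x g⁻¹` of `g` on the Lie algebra. -/
def Ad {G : Type v} [TopologicalSpace G] [ChartedSpace E G] [Group G] (g : G) (x : E) : E :=
  mfderiv 𝓘(ℝ, E) 𝓘(ℝ, E) (fun h : G => g * h * g⁻¹) 1 x

/-- `(dg/dt) g⁻¹` at time `t`, for a path `g` in `G` defined on `[0,1]`: the derivative at `s = t`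
of `g(s) g(t)⁻¹`. -/
def rightLogDeriv {G : Type v} [TopologicalSpace G] [ChartedSpace E G] [Group G]
    (g : ℝ → G) (t : ℝ) : E :=
  mfderivWithin 𝓘(ℝ, ℝ) 𝓘(ℝ, E) (fun s => g s * (g t)⁻¹) (Icc 0 1) t (1 : ℝ)

/-- The coefficients of the `3`-form `e^{abc}`. -/
def basicForm (a b c i j k : Fin 8) : ℤ :=
  if (i, j, k) = (a, b, c) ∨ (i, j, k) = (b, c, a) ∨ (i, j, k) = (c, a, b) then 1
  else if (i, j, k) = (b, a, c) ∨ (i, j, k) = (a, c, b) ∨ (i, j, k) = (c, b, a) then -1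
  else 0

/-- The structure constants `f_{ijk}` of the octonions: the coefficients of the associative `3`-form
`e^{123} + e^{145} + e^{167} + e^{246} - e^{257} - e^{347} - e^{356}`
(they vanish if one of the indices is `0`). -/
def octF (i j k : Fin 8) : ℤ :=
  basicForm 1 2 3 i j k + basicForm 1 4 5 i j k + basicForm 1 6 7 i j k + basicForm 2 4 6 i j k
    - basicForm 2 5 7 i j k - basicForm 3 4 7 i j k - basicForm 3 5 6 i j k

/-- `½ ∑_{j,k} f_{ijk} [x_j, y_k]`, the combination of the octonionic cross product with the Lie
bracket. -/
def cross (x y : Fin 8 → E) (i : Fin 8) : E :=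
  (1 / 2 : ℝ) • ∑ j, ∑ k, (octF i j k : ℝ) • lie G (x j) (y k)

/-- The octonionic Nahm equations on `[0,1]` for `X = (X₀, X₁, …, X₇)`. -/
def IsSolution {k : ℕ∞} (X : CkPath k (Fin 8 → E)) : Prop :=
  ∀ t ∈ Icc (0 : ℝ) 1, ∀ i : Fin 8, i ≠ 0 →
    X.dt t i + lie G (X.ext t 0) (X.ext t i) + cross G (X.ext t) (X.ext t) i = 0

variable (E) in
/-- The space of `C^k` solutions, with the `C^k` topology. -/
def Solution (k : ℕ∞) : Type u := {X : CkPath k (Fin 8 → E) // IsSolution G X}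

instance (k : ℕ∞) : TopologicalSpace (Solution E G k) :=
  inferInstanceAs (TopologicalSpace {X : CkPath k (Fin 8 → E) // IsSolution G X})

variable {G} in
/-- `X` and `Y` are related by a gauge transformation `g : [0,1] → G` of class `C^{k+1}` with
`g(0) = g(1) = 1`: `Y₀ = g X₀ g⁻¹ - (dg/dt) g⁻¹` and `Y_i = g X_i g⁻¹` for `i = 1, …, 7`. -/
def GaugeRel {k : ℕ∞} (X Y : Solution E G k) : Prop :=
  ∃ g : ℝ → G, ContMDiffOn 𝓘(ℝ, ℝ) 𝓘(ℝ, E) ((k + 1 : ℕ∞) : WithTop ℕ∞) g (Icc 0 1) ∧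
    g 0 = 1 ∧ g 1 = 1 ∧ ∀ t ∈ Icc (0 : ℝ) 1,
      Y.1.ext t 0 = Ad (g t) (X.1.ext t 0) - rightLogDeriv g t ∧
      ∀ i : Fin 8, i ≠ 0 → Y.1.ext t i = Ad (g t) (X.1.ext t i)

variable (E) in
/-- The moduli space: the quotient of the space of solutions by the gauge relation (which is an
equivalence relation), with the quotient topology. -/
def Moduli (k : ℕ∞) : Type u := Quot (GaugeRel (E := E) (G := G) (k := k))

instance (k : ℕ∞) : TopologicalSpace (Moduli E G k) :=
  inferInstanceAs (TopologicalSpace (Quot (GaugeRel (E := E) (G := G) (k := k))))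

variable {G} in
/-- The projection from solutions to the moduli space. -/
def proj {k : ℕ∞} (X : Solution E G k) : Moduli E G k := Quot.mk _ X

/-! ### The smooth structure of the moduli space -/

variable {G} in
/-- A family of solutions, parametrized by an open subset `U` of a normed space, is smooth if it is
smooth as a map into the space of `C^k` paths, i.e. if all its `t`-derivatives of order `≤ k` are
smooth maps from `U` to the Banach space of continuous paths. -/
def SmoothFamilyOn {k : ℕ∞} {P : Type*} [NormedAddCommGroup P] [NormedSpace ℝ P]
    (c : P → Solution E G k) (U : Set P) : Prop :=
  ∀ (j : ℕ) (hj : (j : ℕ∞) ≤ k), ContDiffOn ℝ ∞ (fun p => (c p).1.iterDeriv j hj) U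

variable (E) in
/-- The manifold structure on the moduli space is the quotient one: the projection from the space of
solutions is smooth and has a smooth local section through every solution.
(There is at most one manifold structure with this property.) -/
structure IsQuotientManifold (k : ℕ∞) (m : ℕ)
    [ChartedSpace (EuclideanSpace ℝ (Fin m)) (Moduli E G k)] : Prop where
  smooth_proj : ∀ (P : Type u) [NormedAddCommGroup P] [NormedSpace ℝ P] [CompleteSpace P]
    (U : Set P) (c : P → Solution E G k), IsOpen U → SmoothFamilyOn c U →
      ContMDiffOn 𝓘(ℝ, P) (𝓡 m) ∞ (fun p => proj (c p)) U
  exists_section : ∀ X : Solution E G k, ∃ U : Set (Moduli E G k), IsOpen U ∧ proj X ∈ U ∧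
    ∃ s : Moduli E G k → Solution E G k, s (proj X) = X ∧ (∀ q ∈ U, proj (s q) = q) ∧
      ∀ (j : ℕ) (hj : (j : ℕ∞) ≤ k),
        ContMDiffOn (𝓡 m) 𝓘(ℝ, C(unitInterval, Fin 8 → E)) ∞ (fun q => (s q).1.iterDeriv j hj) U

/-! ### The tangent spaces and the `L²` metric -/

section Tangent

variable [FiniteDimensional ℝ E] [LieGroup 𝓘(ℝ, E) ∞ G]

theorem lie_bilin :
    (∀ x y z : E, lie G (x + y) z = lie G x z + lie G y z) ∧
    (∀ x y z : E, lie G x (y + z) = lie G x y + lie G x z) ∧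
    (∀ (c : ℝ) (x y : E), lie G (c • x) y = c • lie G x y) ∧
    (∀ (c : ℝ) (x y : E), lie G x (c • y) = c • lie G x y) := by
  have := FiniteDimensional.complete ℝ E
  have : LieGroup 𝓘(ℝ, E) (minSmoothness ℝ 3) G :=
    LieGroup.of_le (n := ∞) (by
      simp only [minSmoothness_of_isRCLikeNormedField]
      exact WithTop.coe_le_coe.2 (le_top : (3 : ℕ∞) ≤ ⊤))
  exact ⟨add_lie (L := GroupLieAlgebra 𝓘(ℝ, E) G) (M := GroupLieAlgebra 𝓘(ℝ, E) G),
    lie_add (L := GroupLieAlgebra 𝓘(ℝ, E) G) (M := GroupLieAlgebra 𝓘(ℝ, E) G),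
    smul_lie (R := ℝ) (L := GroupLieAlgebra 𝓘(ℝ, E) G) (M := GroupLieAlgebra 𝓘(ℝ, E) G),
    lie_smul (R := ℝ) (L := GroupLieAlgebra 𝓘(ℝ, E) G) (M := GroupLieAlgebra 𝓘(ℝ, E) G)⟩

theorem cross_add_left (x y z : Fin 8 → E) (i : Fin 8) :
    cross G (x + y) z i = cross G x z i + cross G y z i := by
  simp only [cross, Pi.add_apply, (lie_bilin G).1, smul_add, Finset.sum_add_distrib]

theorem cross_add_right (x y z : Fin 8 → E) (i : Fin 8) :
    cross G x (y + z) i = cross G x y i + cross G x z i := by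
  simp only [cross, Pi.add_apply, (lie_bilin G).2.1, smul_add, Finset.sum_add_distrib]

theorem cross_smul_left (c : ℝ) (x y : Fin 8 → E) (i : Fin 8) :
    cross G (c • x) y i = c • cross G x y i := by
  simp only [cross, Pi.smul_apply, (lie_bilin G).2.2.1, Finset.smul_sum, smul_smul]
  refine Finset.sum_congr rfl fun _ _ => Finset.sum_congr rfl fun _ _ => ?_
  congr 1
  ring

theorem cross_smul_right (c : ℝ) (x y : Fin 8 → E) (i : Fin 8) :
    cross G x (c • y) i = c • cross G x y i := by
  simp only [cross, Pi.smul_apply, (lie_bilin G).2.2.2, Finset.smul_sum, smul_smul]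
  refine Finset.sum_congr rfl fun _ _ => Finset.sum_congr rfl fun _ _ => ?_
  congr 1
  ring

variable {G} in
/-- The horizontal tangent space at a solution `X`: the `C^k` paths `a = (a₀, …, a₇)` which solve the
linearized octonionic Nahm equations (for `i = 1, …, 7`) and which are `L²`-orthogonal to the gauge
orbit of `X`, i.e. `da₀/dt + ∑_{i=0}^7 [X_i, a_i] = 0`. -/
def horizontal {k : ℕ∞} (hk : 1 ≤ k) (X : Solution E G k) :
    Submodule ℝ (CkPath k (Fin 8 → E)) where
  carrier := {a | ∀ t ∈ Icc (0 : ℝ) 1,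
    a.dt t 0 + ∑ i, lie G (X.1.ext t i) (a.ext t i) = 0 ∧
    ∀ i : Fin 8, i ≠ 0 →
      a.dt t i + lie G (a.ext t 0) (X.1.ext t i) + lie G (X.1.ext t 0) (a.ext t i)
        + (cross G (X.1.ext t) (a.ext t) i + cross G (a.ext t) (X.1.ext t) i) = 0}
  add_mem' := by
    intro a b ha hb t ht
    obtain ⟨ha0, ha⟩ := ha t ht
    obtain ⟨hb0, hb⟩ := hb t ht
    simp only [CkPath.dt_add hk _ _ ht, CkPath.ext_add, Pi.add_apply, (lie_bilin G).1,
      (lie_bilin G).2.1, cross_add_left, cross_add_right, Finset.sum_add_distrib]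
    refine ⟨?_, fun i hi => ?_⟩
    · rw [← add_zero (0 : E)]
      nth_rewrite 1 [← ha0]
      rw [← hb0]
      abel
    · rw [← add_zero (0 : E)]
      nth_rewrite 1 [← ha i hi]
      rw [← hb i hi]
      abel
  zero_mem' := by
    intro t ht
    have h0 : (0 : CkPath k (Fin 8 → E)) = (0 : ℝ) • 0 := by simp
    rw [h0]
    simp only [CkPath.dt_smul hk _ _ ht, CkPath.ext_smul, Pi.smul_apply, (lie_bilin G).2.2.1,
      (lie_bilin G).2.2.2, cross_smul_left, cross_smul_right]
    simp
  smul_mem' := by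
    intro c a ha t ht
    obtain ⟨ha0, ha⟩ := ha t ht
    simp only [CkPath.dt_smul hk _ _ ht, CkPath.ext_smul, Pi.smul_apply, (lie_bilin G).2.2.1,
      (lie_bilin G).2.2.2, cross_smul_left, cross_smul_right, ← Finset.smul_sum, ← smul_add]
    exact ⟨by rw [ha0, smul_zero], fun i hi => by rw [ha i hi, smul_zero]⟩

end Tangent

/-- The `L²` inner product `∫₀¹ ∑_i ⟨a_i(t), b_i(t)⟩ dt` determined by an inner product `B` on the
Lie algebra. -/
def l2Inner {k : ℕ∞} (B : LinearMap.BilinForm ℝ E) (a b : CkPath k (Fin 8 → E)) : ℝ :=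
  ∫ t in (0 : ℝ)..1, ∑ i, B (a.ext t i) (b.ext t i)

variable {G} in
/-- `c` is a curve of solutions, smooth near time `0`, with `c(0) = X` and velocity `a` at time `0`
(in the space of `C^k` paths). -/
def IsCurveThrough {k : ℕ∞} (c : ℝ → Solution E G k) (X : Solution E G k)
    (a : CkPath k (Fin 8 → E)) : Prop :=
  c 0 = X ∧ (∃ ε > 0, SmoothFamilyOn c (Ioo (-ε) ε)) ∧
    ∀ (j : ℕ) (hj : (j : ℕ∞) ≤ k),
      HasDerivAt (fun τ => (c τ).1.iterDeriv j hj) (a.iterDeriv j hj) 0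

variable (E) in
/-- `g` is the `L²` metric of the moduli space. For every solution `X`, the differential of the
projection identifies the horizontal tangent space at `X` with the tangent space of the moduli space
at `[X]`, and `g` corresponds to the `L²` inner product of horizontal vectors. -/
def IsL2Metric [FiniteDimensional ℝ E] [LieGroup 𝓘(ℝ, E) ∞ G] {k : ℕ∞} (hk : 1 ≤ k) {m : ℕ}
    [ChartedSpace (EuclideanSpace ℝ (Fin m)) (Moduli E G k)] [IsManifold (𝓡 m) ∞ (Moduli E G k)]
    (B : LinearMap.BilinForm ℝ E)
    (g : ContMDiffRiemannianMetric (𝓡 m) ∞ (EuclideanSpace ℝ (Fin m))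
      (fun p : Moduli E G k => TangentSpace (𝓡 m) p)) : Prop :=
  ∀ X : Solution E G k, ∃ Θ : horizontal hk X ≃ₗ[ℝ] TangentSpace (𝓡 m) (proj X),
    (∀ a : horizontal hk X, ∃ c : ℝ → Solution E G k, IsCurveThrough c X a) ∧
    (∀ (a : horizontal hk X) (c : ℝ → Solution E G k), IsCurveThrough c X a →
      MDifferentiableAt 𝓘(ℝ, ℝ) (𝓡 m) (fun τ => proj (c τ)) 0 ∧
      mfderiv 𝓘(ℝ, ℝ) (𝓡 m) (fun τ => proj (c τ)) 0 (1 : ℝ) = Θ a) ∧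
    ∀ a b : horizontal hk X, g.inner (proj X) (Θ a) (Θ b) = l2Inner B a.1 b.1

/-- A Riemannian metric is complete: every Cauchy sequence for the Riemannian distance (the infimum
of the lengths of `C^1` curves) converges. -/
def IsCompleteMetric {m : ℕ} {M : Type*} [TopologicalSpace M]
    [ChartedSpace (EuclideanSpace ℝ (Fin m)) M] [IsManifold (𝓡 m) ∞ M]
    (g : ContMDiffRiemannianMetric (𝓡 m) ∞ (EuclideanSpace ℝ (Fin m))
      (fun p : M => TangentSpace (𝓡 m) p)) : Prop :=
  letI : RiemannianBundle (fun p : M => TangentSpace (𝓡 m) p) := ⟨g.toRiemannianMetric⟩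
  ∀ x : ℕ → M,
    (∀ ε > 0, ∃ N : ℕ, ∀ p ≥ N, ∀ q ≥ N, riemannianEDist (𝓡 m) (x p) (x q) < ε) →
    ∃ y : M, Tendsto (fun n => riemannianEDist (𝓡 m) (x n) y) atTop (𝓝 0)

end OctNahm

end

open Set Filter Topology MeasureTheory Bundle Manifold
open scoped ContDiff

noncomputable section

universe u v

set_option linter.unusedSectionVars false

namespace OctNahm

/-! ### Continuous paths in Banach spaces -/

section ContinuousPaths

variable {F : Type*} [NormedAddCommGroup F] [NormedSpace ℝ F]
variable {F₁ : Type*} [NormedAddCommGroup F₁] [NormedSpace ℝ F₁]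
variable {F₂ : Type*} [NormedAddCommGroup F₂] [NormedSpace ℝ F₂]

/-! The component `X₀` is arbitrary up to gauge except for its holonomy, and once `X₀` is fixed the
Nahm equations are an ordinary differential equation for `X₁, …, X₇`. So a gauge class is described
by a holonomy in `G` and the initial values `X_i(0)`, `i ≥ 1`, and the moduli space sits in `G × 𝔤⁷`
as the open set of data whose solution survives up to time `1`.

Precisely, let `h` be the path with `h(0) = 1` and `h' h⁻¹ = -X₀`; the holonomy is `h(1)`. A gauge
transformation `g` which is trivial at both ends replaces `h` by `g h`, hence keeps `h(1)` and the
`X_i(0)`. Conversely, if `X` and `Y` have the same data, then `g = h_Y h_X⁻¹` is trivial at both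
ends, carries `X₀` to `Y₀`, and carries `X` to a solution with the initial values of `Y`, which is
`Y` by uniqueness (`exists_gaugeRel`, `gaugeRel_iff`, `proj_eq_iff`).

Openness and smoothness come from writing the equations as `x + ∫ b(x, x) = datum`
(`quadVolterra_nahmB_iff`). The left side is an injective map of the Banach space of continuous
paths. Its derivative is `1` plus a Volterra operator, which is invertible because iterated Volterra
operators decay factorially; so the inverse function theorem gives an open range and a smooth
inverse (`isOpen_range_quadVolterra`, `contDiffAt_quadSolve`). Higher `t`-derivatives follow by
bootstrapping in the integral equation. Replacing `X₀` by `X₀ - Ad(h) ξ` multiplies the holonomy by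
`exp ξ` on the right; this, together with free initial values, gives a slice through every solution,
hence charts and smooth local sections (`Moduli.chart`, `Moduli.isQuotientManifold`).

The horizontal equations form a linear differential equation for all eight components, so horizontal
vectors are parametrized by `a(0)`, in dimension `8 dim 𝔤`, and depend smoothly on `X`. If the
differential of the projection kills a horizontal `a`, then `a` is an infinitesimal gauge
transformation: `a₀ = ξ' + [X₀, ξ]` and `a_i = [X_i, ξ]` with `ξ` vanishing at both ends.
Integration by parts shows that it is orthogonal to itself, so it vanishes
(`eq_zero_of_isHoriz_of_vertical`). Hence horizontal vectors are the tangent vectors of the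
quotient, and the `L²` product descends because the adjoint action along a gauge transformation
preserves it (`metricForm_eq_of_proj_eq`).

For completeness, consider the gauge invariant function `√(1 + ∑_{i ≥ 1} ‖X_i‖²)` with `L²` norms.
By Cauchy-Schwarz its derivative along `a` is at most `‖a‖`, so it is `1`-Lipschitz for the
Riemannian distance and bounded on Cauchy sequences (`Moduli.edist_energy_le`). Its sublevel sets
are compact (`Moduli.exists_le_nhds_of_energy_le`): the holonomies accumulate since `G` is compact,
representatives in a slice have bounded `X₀`, and the `L²` bound controls the integral of the
quadratic term, hence `X` uniformly (`exists_norm_le_of_l2Kill_le`). The image of a ball under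
`quadVolterra` is closed, so the limiting data still belong to a solution.

The only properties of the octonionic structure constants `f_{ijl}` that enter are their vanishing
for `j = 0` or `l = 0` and their antisymmetry in `j, l`. -/

instance : NormedAddCommGroup C(unitInterval, F →L[ℝ] F₁) :=
  ContinuousMap.instNormedAddCommGroup (E := F →L[ℝ] F₁)

instance : NormedSpace ℝ C(unitInterval, F →L[ℝ] F₁) :=
  ContinuousMap.normedSpace (E := F →L[ℝ] F₁)

instance : NormedRing (C(unitInterval, F) →L[ℝ] C(unitInterval, F)) :=
  ContinuousLinearMap.toNormedRing

instance : NormedAddCommGroup (C(unitInterval, F) →L[ℝ] C(unitInterval, F₁)) :=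
  ContinuousLinearMap.toNormedAddCommGroup

instance : NormedSpace ℝ (C(unitInterval, F) →L[ℝ] C(unitInterval, F₁)) :=
  ContinuousLinearMap.toNormedSpace

/-- The extension of a path to the real line, constant outside of `[0,1]`. -/
def pext (f : C(unitInterval, F)) : ℝ → F := IccExtend zero_le_one f

omit [NormedSpace ℝ F] in
theorem continuous_pext (f : C(unitInterval, F)) : Continuous (pext f) :=
  f.continuous.Icc_extend' 

omit [NormedSpace ℝ F] in
theorem pext_of_mem (f : C(unitInterval, F)) {t : ℝ} (ht : t ∈ Icc (0 : ℝ) 1) :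
    pext f t = f ⟨t, ht⟩ := IccExtend_of_mem _ _ ht

omit [NormedSpace ℝ F] in
@[simp] theorem pext_coe (f : C(unitInterval, F)) (t : unitInterval) : pext f t = f t :=
  pext_of_mem f t.2

omit [NormedSpace ℝ F] in
theorem norm_pext_le (f : C(unitInterval, F)) (t : ℝ) : ‖pext f t‖ ≤ ‖f‖ :=
  f.norm_coe_le_norm _

/-- The pointwise action of a bilinear map on paths. -/
def pointwise (B : F →L[ℝ] F₁ →L[ℝ] F₂) :
    C(unitInterval, F) →L[ℝ] C(unitInterval, F₁) →L[ℝ] C(unitInterval, F₂) :=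
  LinearMap.mkContinuous₂
    (LinearMap.mk₂ ℝ (fun f g => (⟨fun t => B (f t) (g t), by fun_prop⟩ : C(unitInterval, F₂)))
      (fun f g h => by ext t; simp) (fun c f h => by ext t; simp) (fun f g h => by ext t; simp)
      (fun c f h => by ext t; simp)) ‖B‖ (fun f g => by
        rw [ContinuousMap.norm_le _ (by positivity)]
        intro t
        refine (B.le_opNorm₂ _ _).trans ?_
        gcongr <;> exact ContinuousMap.norm_coe_le_norm _ _)

@[simp] theorem pointwise_apply (B : F →L[ℝ] F₁ →L[ℝ] F₂) (f : C(unitInterval, F))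
    (g : C(unitInterval, F₁)) (t : unitInterval) : pointwise B f g t = B (f t) (g t) := rfl

/-- The pointwise action of a path of linear maps on a path. -/
def pmul : C(unitInterval, F →L[ℝ] F₁) →L[ℝ] C(unitInterval, F) →L[ℝ] C(unitInterval, F₁) :=
  pointwise (ContinuousLinearMap.id ℝ (F →L[ℝ] F₁))

@[simp] theorem pmul_apply (L : C(unitInterval, F →L[ℝ] F₁)) (f : C(unitInterval, F))
    (t : unitInterval) : pmul L f t = L t (f t) := rfl

theorem pmul_neg (L : C(unitInterval, F →L[ℝ] F₁)) (f : C(unitInterval, F)) :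
    pmul (-L) f = -pmul L f := rfl

/-- The constant path. -/
def constPath : F →L[ℝ] C(unitInterval, F) :=
  LinearMap.mkContinuous
    { toFun := ContinuousMap.const _, map_add' := fun _ _ => rfl, map_smul' := fun _ _ => rfl } 1
    (fun x => by
      rw [ContinuousMap.norm_le _ (by positivity)]
      intro t
      rw [one_mul]
      exact le_rfl)

@[simp] theorem constPath_apply (x : F) (t : unitInterval) : constPath x t = x := rfl

/-- Postcomposition with a linear map. -/
def pmap (T : F →L[ℝ] F₁) : C(unitInterval, F) →L[ℝ] C(unitInterval, F₁) :=
  T.compLeftContinuous ℝ unitInterval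

@[simp] theorem pmap_apply (T : F →L[ℝ] F₁) (f : C(unitInterval, F)) (t : unitInterval) :
    pmap T f t = T (f t) := rfl

/-- The primitive of a path, vanishing at `0`. -/
def primitive [CompleteSpace F] : C(unitInterval, F) →L[ℝ] C(unitInterval, F) :=
  LinearMap.mkContinuous
    { toFun := fun f => ⟨fun t => ∫ s in (0 : ℝ)..t, pext f s,
        (intervalIntegral.continuous_primitive
          (fun a b => (continuous_pext f).intervalIntegrable a b) 0).comp continuous_subtype_val⟩
      map_add' := fun f g => by
        ext t
        exact intervalIntegral.integral_add ((continuous_pext f).intervalIntegrable _ _)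
          ((continuous_pext g).intervalIntegrable _ _)
      map_smul' := fun c f => by
        ext t
        exact intervalIntegral.integral_smul c (pext f) } 1 (fun f => by
    rw [ContinuousMap.norm_le _ (by positivity)]
    intro t
    refine (intervalIntegral.norm_integral_le_of_norm_le_const
      (fun s _ => norm_pext_le f s)).trans ?_
    rw [sub_zero, abs_of_nonneg t.2.1, one_mul]
    exact mul_le_of_le_one_right (norm_nonneg _) t.2.2)

theorem primitive_apply [CompleteSpace F] (f : C(unitInterval, F)) (t : unitInterval) :
    primitive f t = ∫ s in (0 : ℝ)..t, pext f s := rfl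

@[simp] theorem primitive_zero [CompleteSpace F] (f : C(unitInterval, F)) : primitive f 0 = 0 := by
  simp [primitive_apply]

theorem hasDerivWithinAt_primitive [CompleteSpace F] (f : C(unitInterval, F)) {t : ℝ}
    (ht : t ∈ Icc (0 : ℝ) 1) :
    HasDerivWithinAt (pext (primitive f)) (pext f t) (Icc 0 1) t := by
  have h := (intervalIntegral.integral_hasDerivAt_right
    ((continuous_pext f).intervalIntegrable 0 t)
    ((continuous_pext f).stronglyMeasurableAtFilter _ _) (continuous_pext f).continuousAt)
  refine h.hasDerivWithinAt.congr (fun s hs => ?_) ?_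
  · rw [pext_of_mem _ hs, primitive_apply]
  · rw [pext_of_mem _ ht, primitive_apply]

theorem eq_of_hasDerivWithinAt_eq {f g : ℝ → F} {f' : ℝ → F}
    (hf : ∀ t ∈ Icc (0 : ℝ) 1, HasDerivWithinAt f (f' t) (Icc 0 1) t)
    (hg : ∀ t ∈ Icc (0 : ℝ) 1, HasDerivWithinAt g (f' t) (Icc 0 1) t) (h0 : f 0 = g 0) :
    ∀ t ∈ Icc (0 : ℝ) 1, f t = g t := by
  have key : ∀ t ∈ Icc (0 : ℝ) 1, (f - g) t = (f - g) 0 := by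
    apply constant_of_has_deriv_right_zero
    · exact fun t ht => ((hf t ht).continuousWithinAt).sub ((hg t ht).continuousWithinAt)
    · intro t ht
      have h1 := (hf t ⟨ht.1, ht.2.le⟩).sub (hg t ⟨ht.1, ht.2.le⟩)
      rw [sub_self] at h1
      exact (h1.mono_of_mem_nhdsWithin (Icc_mem_nhdsGE_of_mem ht))
  intro t ht
  have := key t ht
  simp only [Pi.sub_apply, h0, sub_self] at this
  exact sub_eq_zero.1 this

/-- The fundamental theorem of calculus for paths. -/
theorem eq_const_add_primitive [CompleteSpace F] {f g : C(unitInterval, F)}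
    (h : ∀ t ∈ Icc (0 : ℝ) 1, HasDerivWithinAt (pext f) (pext g t) (Icc 0 1) t) :
    f = constPath (f 0) + primitive g := by
  ext t
  have := eq_of_hasDerivWithinAt_eq (g := pext (constPath (f 0) + primitive g)) h (fun t ht => by
    have h2 := (hasDerivWithinAt_primitive g ht).const_add (f 0)
    exact h2) (by
      rw [pext_of_mem _ (left_mem_Icc.2 zero_le_one), pext_of_mem _ (left_mem_Icc.2 zero_le_one)]
      change f 0 = f 0 + primitive g 0
      simp) t t.2
  simpa using this

/-- Together with `eq_const_add_primitive`, this makes differential equations on `[0,1]` with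
one-sided derivatives at the endpoints equivalent to identities in the Banach space of continuous
paths. -/
theorem hasDerivWithinAt_of_eq [CompleteSpace F] {f g : C(unitInterval, F)} {x : F}
    (h : f = constPath x + primitive g) {t : ℝ} (ht : t ∈ Icc (0 : ℝ) 1) :
    HasDerivWithinAt (pext f) (pext g t) (Icc 0 1) t := by
  subst h
  exact (hasDerivWithinAt_primitive g ht).const_add x

/-! ### Volterra operators -/

variable [CompleteSpace F]

/-- The Volterra operator `f ↦ ∫₀ᵗ L f`. -/
def volterra (L : C(unitInterval, F →L[ℝ] F)) : C(unitInterval, F) →L[ℝ] C(unitInterval, F) :=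
  primitive ∘L pmul L

theorem volterra_apply (L : C(unitInterval, F →L[ℝ] F)) (f : C(unitInterval, F)) :
    volterra L f = primitive (pmul L f) := rfl

theorem volterra_neg (L : C(unitInterval, F →L[ℝ] F)) : volterra (-L) = -volterra L := by
  refine ContinuousLinearMap.ext fun f => ?_
  rw [volterra_apply, pmul_neg, map_neg]
  rfl

/-- Each further integration of `t ^ n / n!` raises the power and the factorial by one. The
resulting factorial decay is the reason why no smallness of `L` is needed below. -/
theorem norm_volterra_pow_apply_le (L : C(unitInterval, F →L[ℝ] F)) (n : ℕ)
    (f : C(unitInterval, F)) (t : unitInterval) :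
    ‖(volterra L ^ n) f t‖ ≤ ‖L‖ ^ n * (t : ℝ) ^ n / n.factorial * ‖f‖ := by
  induction n generalizing t with
  | zero => simpa using f.norm_coe_le_norm t
  | succ n ih =>
    rw [pow_succ', mul_apply_eq_comp, volterra_apply, primitive_apply]
    have h1 : ∀ s ∈ Ioc (0 : ℝ) t, ‖pext (pmul L ((volterra L ^ n) f)) s‖ ≤
        (‖L‖ ^ (n + 1) / n.factorial * ‖f‖) * s ^ n := by
      intro s hs
      have hs' : s ∈ Icc (0 : ℝ) 1 := ⟨hs.1.le, hs.2.trans t.2.2⟩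
      rw [pext_of_mem _ hs', pmul_apply]
      refine ((L _).le_opNorm _).trans ?_
      refine (mul_le_mul (L.norm_coe_le_norm _) (ih ⟨s, hs'⟩) (norm_nonneg _)
        (norm_nonneg _)).trans (le_of_eq ?_)
      ring
    refine (intervalIntegral.norm_integral_le_of_norm_le t.2.1
      (Eventually.of_forall h1) (Continuous.intervalIntegrable (by fun_prop) _ _)).trans
      (le_of_eq ?_)
    rw [intervalIntegral.integral_const_mul, integral_pow, Nat.factorial_succ]
    have := Nat.cast_ne_zero (R := ℝ).2 (Nat.factorial_ne_zero n)
    push_cast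
    field_simp
    ring

theorem norm_volterra_pow_le (L : C(unitInterval, F →L[ℝ] F)) (n : ℕ) :
    ‖volterra L ^ n‖ ≤ ‖L‖ ^ n / n.factorial := by
  refine ContinuousLinearMap.opNorm_le_bound _ (by positivity) fun f => ?_
  rw [ContinuousMap.norm_le _ (by positivity)]
  intro t
  refine (norm_volterra_pow_apply_le L n f t).trans ?_
  have : (t : ℝ) ^ n ≤ 1 := pow_le_one₀ t.2.1 t.2.2
  gcongr
  exact mul_le_of_le_one_right (by positivity) this

/-- Some power `V ^ n` has norm less than `1`, so `1 - V ^ n` is a unit. It factors as `1 - V` times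
a geometric sum which commutes with it, so `1 - V` is a unit too. -/
theorem isUnit_one_sub_volterra (L : C(unitInterval, F →L[ℝ] F)) :
    IsUnit (1 - volterra L) := by
  obtain ⟨n, hn⟩ := ((FloorSemiring.tendsto_pow_div_factorial_atTop ‖L‖).eventually
    (gt_mem_nhds one_pos)).exists
  have h1 : IsUnit (1 - volterra L ^ n) :=
    isUnit_one_sub_of_norm_lt_one ((norm_volterra_pow_le L n).trans_lt hn)
  rw [← mul_neg_geom_sum] at h1
  refine ((Commute.isUnit_mul_iff ?_).1 h1).1
  rw [Commute, SemiconjBy, mul_neg_geom_sum, geom_sum_mul_neg]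

theorem isUnit_one_add_volterra (L : C(unitInterval, F →L[ℝ] F)) :
    IsUnit (1 + volterra L) := by
  have h := isUnit_one_sub_volterra (-L)
  rwa [volterra_neg, sub_neg_eq_add] at h

/-- `1 + volterra L` is bounded below, uniformly for bounded `L`. -/
theorem exists_norm_le_mul_norm_add_volterra (C : ℝ) :
    ∃ K : ℝ, ∀ L : C(unitInterval, F →L[ℝ] F), ‖L‖ ≤ C → ∀ z : C(unitInterval, F),
      ‖z‖ ≤ K * ‖z + volterra L z‖ := by
  obtain ⟨n, hn⟩ := ((FloorSemiring.tendsto_pow_div_factorial_atTop C).eventually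
    (gt_mem_nhds (show (0 : ℝ) < 1 / 2 by norm_num))).exists
  -- With `V = volterra (-L)` one has `z = ∑_{i < n} V ^ i (z - V z) + V ^ n z`. The last term has
  -- norm at most `‖z‖ / 2`; absorbing it in the left side produces the factor `2`.
  refine ⟨2 * ∑ i ∈ Finset.range n, C ^ i / i.factorial, fun L hL z => ?_⟩
  set V := volterra (-L) with hV
  have hVL : volterra L z = - V z := by
    rw [hV, volterra_neg, neg_apply, neg_neg]
  have hb : ∀ i, ‖V ^ i‖ ≤ C ^ i / i.factorial := fun i => by
    refine (norm_volterra_pow_le (-L) i).trans ?_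
    rw [norm_neg]
    gcongr
  have hz : z = (∑ i ∈ Finset.range n, V ^ i) (z + volterra L z) + (V ^ n) z := by
    have := congrArg (fun T : C(unitInterval, F) →L[ℝ] C(unitInterval, F) => T z)
      (geom_sum_mul_neg V n)
    simp only [mul_apply_eq_comp, sub_apply,
      one_apply_eq_self] at this
    rw [hVL, ← sub_eq_add_neg, this, sub_add_cancel]
  have h1 : ‖(∑ i ∈ Finset.range n, V ^ i) (z + volterra L z)‖ ≤
      (∑ i ∈ Finset.range n, C ^ i / i.factorial) * ‖z + volterra L z‖ := by
    refine (ContinuousLinearMap.le_opNorm _ _).trans ?_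
    gcongr
    exact (norm_sum_le _ _).trans (Finset.sum_le_sum fun i _ => hb i)
  have h2 : ‖(V ^ n) z‖ ≤ 1 / 2 * ‖z‖ := by
    refine (ContinuousLinearMap.le_opNorm _ _).trans ?_
    gcongr
    exact (hb n).trans hn.le
  have h3 : ‖z‖ ≤ ‖(∑ i ∈ Finset.range n, V ^ i) (z + volterra L z)‖ + ‖(V ^ n) z‖ := by
    nth_rewrite 1 [hz]
    exact norm_add_le _ _
  linarith

theorem eq_zero_of_add_volterra_eq_zero {L : C(unitInterval, F →L[ℝ] F)} {z : C(unitInterval, F)}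
    (h : z + volterra L z = 0) : z = 0 := by
  obtain ⟨K, hK⟩ := exists_norm_le_mul_norm_add_volterra (F := F) ‖L‖
  have := hK L le_rfl z
  rw [h, norm_zero, mul_zero] at this
  exact norm_le_zero_iff.1 this

/-- Uniqueness for linear differential equations. -/
theorem eqOn_of_linear_ode {L : C(unitInterval, F →L[ℝ] F)} {f g : ℝ → F} {r : ℝ → F}
    (hf : ∀ t ∈ Icc (0 : ℝ) 1, HasDerivWithinAt f (pext L t (f t) + r t) (Icc 0 1) t)
    (hg : ∀ t ∈ Icc (0 : ℝ) 1, HasDerivWithinAt g (pext L t (g t) + r t) (Icc 0 1) t)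
    (h0 : f 0 = g 0) : ∀ t ∈ Icc (0 : ℝ) 1, f t = g t := by
  have hc : ContinuousOn (f - g) (Icc 0 1) := fun t ht =>
    (hf t ht).continuousWithinAt.sub (hg t ht).continuousWithinAt
  set z : C(unitInterval, F) := ⟨(Icc (0 : ℝ) 1).domRestrict (f - g),
    continuousOn_iff_continuous_domRestrict.1 hc⟩ with hz
  have hzt : ∀ t ∈ Icc (0 : ℝ) 1, pext z t = f t - g t := fun t ht => pext_of_mem z ht
  have h1 : z = constPath (z 0) + primitive (pmul L z) := by
    refine eq_const_add_primitive fun t ht => ?_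
    have h2 := (hf t ht).sub (hg t ht)
    rw [add_sub_add_right_eq_sub, ← map_sub] at h2
    refine (h2.congr (fun s hs => hzt s hs) (hzt t ht)).congr_deriv ?_
    rw [pext_of_mem _ ht, pext_of_mem _ ht, pmul_apply]
    rfl
  have h3 : z 0 = 0 := by
    change f 0 - g 0 = 0
    rw [h0, sub_self]
  have h4 : z = 0 := by
    refine eq_zero_of_add_volterra_eq_zero (L := -L) ?_
    rw [volterra_neg]
    rw [h3, map_zero, zero_add] at h1
    change z + -primitive (pmul L z) = 0
    rw [← h1, add_neg_cancel]
  intro t ht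
  have := hzt t ht
  rw [h4, pext_of_mem _ ht] at this
  exact (sub_eq_zero.1 this.symm)

/-! ### The quadratic Volterra equation -/

/-- The map `X ↦ X + ∫₀ᵗ b(X, X)`. -/
def quadVolterra (b : F →L[ℝ] F →L[ℝ] F) (X : C(unitInterval, F)) : C(unitInterval, F) :=
  X + primitive (pointwise b X X)

/-- The linearization of `x ↦ b(x, x)` along a path. -/
def linPath (b : F →L[ℝ] F →L[ℝ] F) : C(unitInterval, F) →L[ℝ] C(unitInterval, F →L[ℝ] F) :=
  pmap (b + b.flip)

theorem hasStrictFDerivAt_quadVolterra (b : F →L[ℝ] F →L[ℝ] F) (X : C(unitInterval, F)) :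
    HasStrictFDerivAt (quadVolterra b) (1 + volterra (linPath b X)) X := by
  have h1 := ((pointwise b).isBoundedBilinearMap.hasStrictFDerivAt (X, X)).comp
    (f := fun X => (X, X)) X ((hasStrictFDerivAt_id X).prodMk (hasStrictFDerivAt_id X))
  exact (hasStrictFDerivAt_id X).add ((primitive (F := F)).hasStrictFDerivAt.comp X h1)

theorem contDiff_quadVolterra (b : F →L[ℝ] F →L[ℝ] F) {n : WithTop ℕ∞} :
    ContDiff ℝ n (quadVolterra b) :=
  contDiff_id.add ((primitive (F := F)).contDiff.comp
    ((pointwise b).isBoundedBilinearMap.contDiff.comp (contDiff_id.prodMk contDiff_id)))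

/-- Since `b(X, X) - b(Y, Y) = b(X, X - Y) + b(X - Y, Y)`, the difference of two values is exactly
`1` plus a linear Volterra operator applied to `X - Y`. Both global injectivity and the estimate
behind `isClosed_quadVolterra_image` come from this. -/
theorem quadVolterra_sub (b : F →L[ℝ] F →L[ℝ] F) (X Y : C(unitInterval, F)) :
    quadVolterra b X - quadVolterra b Y =
      (X - Y) + volterra (pmap b X + pmap b.flip Y) (X - Y) := by
  have : pointwise b X X - pointwise b Y Y = pmul (pmap b X + pmap b.flip Y) (X - Y) := by
    ext t
    change b (X t) (X t) - b (Y t) (Y t) = b (X t) (X t - Y t) + b (X t - Y t) (Y t)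
    rw [map_sub, map_sub, sub_apply]
    abel
  rw [volterra_apply, ← this, map_sub, quadVolterra, quadVolterra]
  abel

theorem quadVolterra_injective (b : F →L[ℝ] F →L[ℝ] F) : Function.Injective (quadVolterra b) := by
  intro X Y h
  rw [← sub_eq_zero, quadVolterra_sub] at h
  exact sub_eq_zero.1 (eq_zero_of_add_volterra_eq_zero h)

/-- The derivative of `quadVolterra` as an equivalence. -/
def quadVolterraDeriv (b : F →L[ℝ] F →L[ℝ] F) (X : C(unitInterval, F)) :
    C(unitInterval, F) ≃L[ℝ] C(unitInterval, F) :=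
  ContinuousLinearEquiv.unitsEquiv ℝ _ (isUnit_one_add_volterra (linPath b X)).unit

theorem hasStrictFDerivAt_quadVolterra_equiv (b : F →L[ℝ] F →L[ℝ] F) (X : C(unitInterval, F)) :
    HasStrictFDerivAt (quadVolterra b)
      (quadVolterraDeriv b X : C(unitInterval, F) →L[ℝ] C(unitInterval, F)) X :=
  hasStrictFDerivAt_quadVolterra b X

/-- Solutions of a quadratic equation can blow up before time `1`, so surjectivity cannot be
expected. Openness holds because the derivative is invertible at every point. -/
theorem isOpen_range_quadVolterra (b : F →L[ℝ] F →L[ℝ] F) : IsOpen (range (quadVolterra b)) :=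
  (isOpenMap_of_hasStrictFDerivAt_equiv (hasStrictFDerivAt_quadVolterra_equiv b)).isOpen_range

/-- The solution map of the quadratic Volterra equation. -/
def quadSolve (b : F →L[ℝ] F →L[ℝ] F) : C(unitInterval, F) → C(unitInterval, F) :=
  Function.invFun (quadVolterra b)

theorem quadSolve_quadVolterra (b : F →L[ℝ] F →L[ℝ] F) (X : C(unitInterval, F)) :
    quadSolve b (quadVolterra b X) = X :=
  Function.leftInverse_invFun (quadVolterra_injective b) X

theorem quadVolterra_quadSolve (b : F →L[ℝ] F →L[ℝ] F) {d : C(unitInterval, F)}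
    (hd : d ∈ range (quadVolterra b)) : quadVolterra b (quadSolve b d) = d :=
  Function.invFun_eq hd

/-- Global injectivity forces the set-theoretic inverse to agree with the local inverse of the
inverse function theorem, from which it inherits its smoothness and its derivative. -/
theorem quadSolve_eventuallyEq (b : F →L[ℝ] F →L[ℝ] F) (X : C(unitInterval, F)) :
    quadSolve b =ᶠ[𝓝 (quadVolterra b X)]
      (hasStrictFDerivAt_quadVolterra_equiv b X).localInverse _ _ _ := by
  filter_upwards [(hasStrictFDerivAt_quadVolterra_equiv b X).eventually_right_inverse] with d hd
  rw [← quadSolve_quadVolterra b (HasStrictFDerivAt.localInverse _ _ _ _ d), hd]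

theorem contDiffAt_quadSolve (b : F →L[ℝ] F →L[ℝ] F) (X : C(unitInterval, F)) {n : WithTop ℕ∞}
    (hn : n ≠ 0) : ContDiffAt ℝ n (quadSolve b) (quadVolterra b X) :=
  ((contDiff_quadVolterra b).contDiffAt.to_localInverse
    (hasStrictFDerivAt_quadVolterra_equiv b X).hasFDerivAt hn).congr_of_eventuallyEq
    (quadSolve_eventuallyEq b X)

theorem hasFDerivAt_quadSolve (b : F →L[ℝ] F →L[ℝ] F) (X : C(unitInterval, F)) :
    HasFDerivAt (quadSolve b) ((quadVolterraDeriv b X).symm :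
      C(unitInterval, F) →L[ℝ] C(unitInterval, F)) (quadVolterra b X) :=
  (hasStrictFDerivAt_quadVolterra_equiv b X).to_localInverse.hasFDerivAt.congr_of_eventuallyEq
    (quadSolve_eventuallyEq b X)

end ContinuousPaths

/-! ### Superposition operators -/

section Superposition

variable {E : Type u} [NormedAddCommGroup E] [NormedSpace ℝ E]

/-- The mean value inequality is applied at each time separately. It is uniform in time because `u ↦
f' ∘ u` is continuous for the uniform norm. -/
theorem hasFDerivAt_postcomp {F : Type*} [NormedAddCommGroup F] [NormedSpace ℝ F] {f : C(E, F)}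
    {f' : C(E, E →L[ℝ] F)} (h : ∀ x, HasFDerivAt f (f' x) x) (u : C(unitInterval, E)) :
    HasFDerivAt (fun u : C(unitInterval, E) => f.comp u) (pmul (f'.comp u)) u := by
  rw [hasFDerivAt_iff_isLittleO, Asymptotics.isLittleO_iff]
  intro c hc
  have hcont : ContinuousAt (fun u : C(unitInterval, E) => f'.comp u) u :=
    (ContinuousMap.continuous_postcomp f').continuousAt
  obtain ⟨δ, hδ, hball⟩ := Metric.continuousAt_iff.1 hcont c hc
  filter_upwards [Metric.ball_mem_nhds u hδ] with v hv
  rw [ContinuousMap.norm_le _ (by positivity)]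
  intro t
  have hd : ∀ y ∈ Metric.ball (u t) δ, ‖f' y - f' (u t)‖ ≤ c := by
    intro y hy
    -- Shifting the whole path `u` by the constant `y - u t` produces a nearby path which passes
    -- through `y` at time `t`; this turns continuity on paths into a pointwise bound.
    have h1 : dist (u + constPath (y - u t)) u < δ := by
      rw [dist_eq_norm, add_sub_cancel_left]
      refine (ContinuousMap.norm_lt_iff _ hδ).2 fun s => ?_
      rwa [constPath_apply, ← dist_eq_norm]
    have h2 := (ContinuousMap.norm_coe_le_norm _ t).trans ((dist_eq_norm _ _).symm.trans_lt (hball h1)).le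
    simpa using h2
  have := (convex_ball (u t) δ).norm_image_sub_le_of_norm_hasFDerivWithin_le'
    (fun x _ => (h x).hasFDerivWithinAt) hd (Metric.mem_ball_self hδ)
    (y := v t) ((ContinuousMap.dist_apply_le_dist t).trans_lt hv)
  refine this.trans ?_
  gcongr
  exact ContinuousMap.norm_coe_le_norm (v - u) t

/-- The derivative at `u` is pointwise multiplication by `f' ∘ u`, again a superposition operator,
so one inducts on the order of differentiability. The target varies in the induction since `f'`
takes values in linear maps. -/
theorem contDiff_postcomp {F : Type u} [NormedAddCommGroup F] [NormedSpace ℝ F] (f : C(E, F))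
    (hf : ContDiff ℝ ∞ f) : ContDiff ℝ ∞ (fun u : C(unitInterval, E) => f.comp u) := by
  rw [contDiff_infty]
  intro n
  induction n generalizing F with
  | zero => exact contDiff_zero.2 (ContinuousMap.continuous_postcomp f)
  | succ n ih =>
    have hf' : ContDiff ℝ ∞ (fderiv ℝ f) := hf.fderiv_right (by simp)
    let f' : C(E, E →L[ℝ] F) := ⟨fderiv ℝ f, hf'.continuous⟩
    refine contDiff_succ_iff_hasFDerivAt.2 ⟨fun u => pmul (f'.comp u), ?_, fun u => ?_⟩
    · have h1 : ContDiff ℝ n (fun u : C(unitInterval, E) => f'.comp u) := ih f' hf'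
      have h2 : ContDiff ℝ n (pmul (F := E) (F₁ := F)) := (pmul (F := E) (F₁ := F)).contDiff
      exact h2.comp h1
    · exact hasFDerivAt_postcomp
        (fun x => (hf.differentiable (by simp) x).hasFDerivAt) u

end Superposition

/-! ### Smooth families of `C^j` paths -/

section SmoothFamilies

variable {F : Type*} [NormedAddCommGroup F] [NormedSpace ℝ F]
variable {F₁ : Type*} [NormedAddCommGroup F₁] [NormedSpace ℝ F₁]
variable {F₂ : Type*} [NormedAddCommGroup F₂] [NormedSpace ℝ F₂]
variable {P : Type*} [NormedAddCommGroup P] [NormedSpace ℝ P] {U : Set P}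

/-- `f` is a smooth map from `U` to the space of `C^j` paths. -/
def SmoothInto : ℕ → Set P → (P → C(unitInterval, F)) → Prop
  | 0, U, f => ContDiffOn ℝ ∞ f U
  | j + 1, U, f => ContDiffOn ℝ ∞ f U ∧ ∃ f' : P → C(unitInterval, F), SmoothInto j U f' ∧
      ∀ p ∈ U, ∀ t ∈ Icc (0 : ℝ) 1, HasDerivWithinAt (pext (f p)) (pext (f' p) t) (Icc 0 1) t

namespace SmoothInto

theorem contDiffOn {j : ℕ} {f : P → C(unitInterval, F)} (h : SmoothInto j U f) :
    ContDiffOn ℝ ∞ f U := by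
  cases j with
  | zero => exact h
  | succ j => exact h.1

theorem of_succ {j : ℕ} {f : P → C(unitInterval, F)} (h : SmoothInto (j + 1) U f) :
    SmoothInto j U f := by
  induction j generalizing f with
  | zero => exact h.1
  | succ j ih =>
    obtain ⟨h0, f', hf', hd⟩ := h
    exact ⟨h0, f', ih hf', hd⟩

theorem congr {j : ℕ} {f g : P → C(unitInterval, F)} (h : SmoothInto j U f)
    (hfg : ∀ p ∈ U, g p = f p) : SmoothInto j U g := by
  cases j with
  | zero => exact ContDiffOn.congr h hfg
  | succ j =>
    obtain ⟨h0, f', hf', hd⟩ := h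
    exact ⟨h0.congr hfg, f', hf', fun p hp t ht => by rw [hfg p hp]; exact hd p hp t ht⟩

theorem add {j : ℕ} {f g : P → C(unitInterval, F)} (hf : SmoothInto j U f)
    (hg : SmoothInto j U g) : SmoothInto j U (fun p => f p + g p) := by
  induction j generalizing f g with
  | zero => exact ContDiffOn.add hf hg
  | succ j ih =>
    obtain ⟨h0, f', hf', hd⟩ := hf
    obtain ⟨h1, g', hg', hd1⟩ := hg
    exact ⟨h0.add h1, _, ih hf' hg', fun p hp t ht => (hd p hp t ht).add (hd1 p hp t ht)⟩

theorem map {j : ℕ} {f : P → C(unitInterval, F)} (hf : SmoothInto j U f) (T : F →L[ℝ] F₁) :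
    SmoothInto j U (fun p => pmap T (f p)) := by
  induction j generalizing f with
  | zero => exact (pmap T).contDiff.comp_contDiffOn hf
  | succ j ih =>
    obtain ⟨h0, f', hf', hd⟩ := hf
    exact ⟨(pmap T).contDiff.comp_contDiffOn h0, _, ih hf', fun p hp t ht =>
      T.hasFDerivAt.comp_hasDerivWithinAt t (hd p hp t ht)⟩

theorem neg {j : ℕ} {f : P → C(unitInterval, F)} (hf : SmoothInto j U f) :
    SmoothInto j U (fun p => -f p) :=
  (hf.map (-ContinuousLinearMap.id ℝ F)).congr fun _ _ => rfl

theorem sub {j : ℕ} {f g : P → C(unitInterval, F)} (hf : SmoothInto j U f)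
    (hg : SmoothInto j U g) : SmoothInto j U (fun p => f p - g p) :=
  (hf.add hg.neg).congr fun _ _ => sub_eq_add_neg _ _

theorem bilinear {j : ℕ} {f : P → C(unitInterval, F)} {g : P → C(unitInterval, F₁)}
    (hf : SmoothInto j U f) (hg : SmoothInto j U g) (B : F →L[ℝ] F₁ →L[ℝ] F₂) :
    SmoothInto j U (fun p => pointwise B (f p) (g p)) := by
  have key : ∀ {f : P → C(unitInterval, F)} {g : P → C(unitInterval, F₁)},
      ContDiffOn ℝ ∞ f U → ContDiffOn ℝ ∞ g U →
      ContDiffOn ℝ ∞ (fun p => pointwise B (f p) (g p)) U := fun hf hg =>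
    (pointwise B).isBoundedBilinearMap.contDiff.comp_contDiffOn (hf.prodMk hg)
  induction j generalizing f g with
  | zero => exact key hf hg
  | succ j ih =>
    have hf2 := hf.of_succ
    have hg2 := hg.of_succ
    obtain ⟨h0, f', hf', hd⟩ := hf
    obtain ⟨h1, g', hg', hd1⟩ := hg
    refine ⟨key h0 h1, _, (ih hf2 hg').add (ih hf' hg2), fun p hp t ht => ?_⟩
    exact B.hasDerivWithinAt_of_bilinear (hd p hp t ht) (hd1 p hp t ht)

theorem const {j : ℕ} {x : P → F} (hx : ContDiffOn ℝ ∞ x U) :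
    SmoothInto j U (fun p => constPath (x p)) := by
  induction j generalizing x with
  | zero => exact (constPath (F := F)).contDiff.comp_contDiffOn hx
  | succ j ih =>
    refine ⟨(constPath (F := F)).contDiff.comp_contDiffOn hx, _, ih (x := fun _ => 0)
      contDiffOn_const, fun p hp t ht => ?_⟩
    exact hasDerivWithinAt_const t (Icc 0 1) (x p)

theorem primitive [CompleteSpace F] {j : ℕ} {f : P → C(unitInterval, F)} (hf : SmoothInto j U f) :
    SmoothInto (j + 1) U (fun p => primitive (f p)) :=
  ⟨(OctNahm.primitive (F := F)).contDiff.comp_contDiffOn hf.contDiffOn, f, hf,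
    fun p _ _ ht => hasDerivWithinAt_primitive (f p) ht⟩

/-- Bootstrapping: in `X = d - ∫ b(X, X)` the integral has one more `t`-derivative than `X`, so
smooth dependence in the uniform norm improves step by step up to the regularity of `d`. -/
theorem of_quadVolterra [CompleteSpace F] {b : F →L[ℝ] F →L[ℝ] F} {j : ℕ}
    {X d : P → C(unitInterval, F)} (hX : ContDiffOn ℝ ∞ X U) (hd : SmoothInto j U d)
    (h : ∀ p ∈ U, quadVolterra b (X p) = d p) : SmoothInto j U X := by
  induction j with
  | zero => exact hX
  | succ j ih =>
    have h1 := ih hd.of_succ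
    exact (hd.sub (h1.bilinear h1 b).primitive).congr fun p hp => by
      rw [← h p hp, quadVolterra, add_sub_cancel_right]

/-- The same bootstrapping in the linear case; the solution gains one derivative over the
coefficient `L`. -/
theorem of_volterra [CompleteSpace F] {j : ℕ} {L : P → C(unitInterval, F →L[ℝ] F)}
    {a d : P → C(unitInterval, F)} (ha : ContDiffOn ℝ ∞ a U) (hL : SmoothInto j U L)
    (hd : SmoothInto (j + 1) U d)
    (h : ∀ p ∈ U, a p + volterra (L p) (a p) = d p) : SmoothInto (j + 1) U a := by
  have step : ∀ i, SmoothInto i U L → SmoothInto (i + 1) U d → SmoothInto i U a →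
      SmoothInto (i + 1) U a := fun i hL hd ha =>
    (hd.sub (hL.bilinear ha (ContinuousLinearMap.id ℝ _)).primitive).congr fun p hp => by
      rw [← h p hp]
      exact (add_sub_cancel_right _ _).symm
  induction j with
  | zero => exact step 0 hL hd ha
  | succ j ih => exact step _ hL hd (ih hL.of_succ hd.of_succ)

theorem exists_iteratedDerivWithin {j : ℕ} {f : P → C(unitInterval, F)} (h : SmoothInto j U f) :
    ∃ g : P → C(unitInterval, F), ContDiffOn ℝ ∞ g U ∧ ∀ p ∈ U,
      ContDiffOn ℝ j (pext (f p)) (Icc 0 1) ∧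
      ∀ t ∈ Icc (0 : ℝ) 1, iteratedDerivWithin j (pext (f p)) (Icc 0 1) t = pext (g p) t := by
  induction j generalizing f with
  | zero =>
    exact ⟨f, h, fun p _ => ⟨contDiffOn_zero.2 (continuous_pext _).continuousOn,
      fun t _ => by rw [iteratedDerivWithin_zero]⟩⟩
  | succ j ih =>
    obtain ⟨h0, f', hf', hd⟩ := h
    obtain ⟨g, hg, hgf⟩ := ih hf'
    refine ⟨g, hg, fun p hp => ?_⟩
    have hde : EqOn (derivWithin (pext (f p)) (Icc 0 1)) (pext (f' p)) (Icc 0 1) := fun t ht =>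
      (hd p hp t ht).derivWithin (uniqueDiffOn_Icc zero_lt_one t ht)
    refine ⟨?_, fun t ht => ?_⟩
    · push_cast
      refine (contDiffOn_succ_iff_derivWithin (uniqueDiffOn_Icc zero_lt_one)).2
        ⟨fun t ht => (hd p hp t ht).differentiableWithinAt, fun h => ?_,
          (hgf p hp).1.congr hde⟩
      exact absurd h (by simp)
    · rw [iteratedDerivWithin_succ', iteratedDerivWithin_congr hde ht]
      exact (hgf p hp).2 t ht

end SmoothInto

/-! ### Paths of class `C^k` -/

namespace CkPath

variable {k : ℕ∞}

theorem ext_eq_pext (f : CkPath k F) : f.ext = pext f.1 := rfl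

theorem iterDeriv_zero (f : CkPath k F) (h : ((0 : ℕ) : ℕ∞) ≤ k) : f.iterDeriv 0 h = f.1 := by
  ext t
  change iteratedDerivWithin 0 f.ext (Icc 0 1) t = f.1 t
  rw [iteratedDerivWithin_zero, ext_eq_pext, pext_coe]

theorem pext_iterDeriv (f : CkPath k F) {j : ℕ} (hj : (j : ℕ∞) ≤ k) {t : ℝ}
    (ht : t ∈ Icc (0 : ℝ) 1) :
    pext (f.iterDeriv j hj) t = iteratedDerivWithin j f.ext (Icc 0 1) t := by
  rw [pext_of_mem _ ht]
  rfl

theorem hasDerivWithinAt_iterDeriv (f : CkPath k F) {j : ℕ} (hj : ((j + 1 : ℕ) : ℕ∞) ≤ k)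
    (hj' : (j : ℕ∞) ≤ k) {t : ℝ} (ht : t ∈ Icc (0 : ℝ) 1) :
    HasDerivWithinAt (pext (f.iterDeriv j hj')) (pext (f.iterDeriv (j + 1) hj) t)
      (Icc 0 1) t := by
  have h1 : DifferentiableOn ℝ (iteratedDerivWithin j f.ext (Icc 0 1)) (Icc 0 1) := by
    refine f.contDiffOn_ext.differentiableOn_iteratedDerivWithin ?_
      (uniqueDiffOn_Icc zero_lt_one)
    have : (j : ℕ∞) < k := lt_of_lt_of_le (by exact_mod_cast Nat.lt_succ_self j) hj
    exact_mod_cast this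
  have h2 := (h1 t ht).hasDerivWithinAt
  rw [pext_iterDeriv f hj ht, iteratedDerivWithin_succ]
  exact h2.congr (fun s hs => pext_iterDeriv f hj' hs) (pext_iterDeriv f hj' ht)

theorem hasDerivWithinAt_ext (hk : 1 ≤ k) (f : CkPath k F) {t : ℝ} (ht : t ∈ Icc (0 : ℝ) 1) :
    HasDerivWithinAt f.ext (f.dt t) (Icc 0 1) t :=
  (f.contDiffOn_ext.differentiableOn (by exact_mod_cast (one_pos.trans_le hk).ne') t
    ht).hasDerivWithinAt

theorem dt_eq_of_hasDerivWithinAt (f : CkPath k F) {t : ℝ} (ht : t ∈ Icc (0 : ℝ) 1) {x : F}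
    (h : HasDerivWithinAt f.ext x (Icc 0 1) t) : f.dt t = x :=
  h.derivWithin (uniqueDiffOn_Icc zero_lt_one t ht)

theorem smoothInto_of_iterDeriv {c : P → CkPath k F}
    (hc : ∀ (j : ℕ) (hj : (j : ℕ∞) ≤ k), ContDiffOn ℝ ∞ (fun p => (c p).iterDeriv j hj) U)
    {j : ℕ} (hj : (j : ℕ∞) ≤ k) : SmoothInto j U (fun p => (c p).1) := by
  have key : ∀ n i : ℕ, ∀ (hi : ((i + n : ℕ) : ℕ∞) ≤ k) (hi' : (i : ℕ∞) ≤ k),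
      SmoothInto n U (fun p => (c p).iterDeriv i hi') := by
    intro n
    induction n with
    | zero => exact fun i _ hi' => hc i hi'
    | succ n ih =>
      intro i hi hi'
      have hi1 : ((i + 1 : ℕ) : ℕ∞) ≤ k := le_trans (by exact_mod_cast (by omega)) hi
      refine ⟨hc i hi', _, ih (i + 1) (le_trans (by exact_mod_cast (by omega)) hi) hi1,
        fun p _ t ht => (c p).hasDerivWithinAt_iterDeriv hi1 hi' ht⟩
  exact (key j 0 (by rwa [zero_add]) (by simp)).congr fun p _ => ((c p).iterDeriv_zero _).symm

theorem smoothInto_const (f : CkPath k F) {j : ℕ} (hj : (j : ℕ∞) ≤ k) :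
    SmoothInto j U (fun _ : P => f.1) :=
  smoothInto_of_iterDeriv (c := fun _ => f) (fun _ _ => contDiffOn_const) hj

theorem contDiffOn_iterDeriv {c : P → CkPath k F} {j : ℕ} (hj : (j : ℕ∞) ≤ k)
    (h : SmoothInto j U (fun p => (c p).1)) : ContDiffOn ℝ ∞ (fun p => (c p).iterDeriv j hj) U := by
  obtain ⟨g, hg, hgc⟩ := h.exists_iteratedDerivWithin
  refine hg.congr fun p hp => ?_
  ext t
  exact ((hgc p hp).2 t t.2).trans (pext_coe _ _)

theorem mem_ckSubmodule {f : P → C(unitInterval, F)}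
    (h : ∀ j : ℕ, (j : ℕ∞) ≤ k → SmoothInto j U f) {p : P} (hp : p ∈ U) :
    f p ∈ ckSubmodule k F := by
  change ContDiffOn ℝ k (pext (f p)) (Icc 0 1)
  refine contDiffOn_iff_forall_nat_le.2 fun m hm => ?_
  obtain ⟨g, hg, hgc⟩ := (h m (by exact_mod_cast hm)).exists_iteratedDerivWithin
  exact (hgc p hp).1

theorem continuous_val : Continuous (fun f : CkPath k F => f.1) := by
  have : Continuous (fun f : CkPath k F => f.iterDeriv 0 (by simp)) := by
    refine continuous_iff_le_induced.2 ?_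
    exact iInf₂_le (0 : ℕ) (by simp)
  exact this.congr fun f => f.iterDeriv_zero _

theorem continuousOn_of_iterDeriv {T : Type*} [TopologicalSpace T] {s : Set T} {c : T → CkPath k F}
    (h : ∀ (j : ℕ) (hj : (j : ℕ∞) ≤ k), ContinuousOn (fun p => (c p).iterDeriv j hj) s) :
    ContinuousOn c s := by
  rw [continuousOn_iff_continuous_domRestrict]
  refine continuous_iInf_rng.2 fun j => continuous_iInf_rng.2 fun hj => continuous_induced_rng.2 ?_
  exact continuousOn_iff_continuous_domRestrict.1 (h j hj)

/-- For a smooth curve of paths the velocity need only be known in the uniform norm. Differentiating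
`f⁽ʲ⁾ = f⁽ʲ⁾(0) + ∫ f⁽ʲ⁺¹⁾` in the parameter shows that the parameter derivative of the `(j+1)`-st
`t`-derivative is the `t`-derivative of the previous one. -/
theorem hasDerivAt_iterDeriv [CompleteSpace F] {c : ℝ → CkPath k F} {a : CkPath k F} {s : Set ℝ}
    (hs : s ∈ 𝓝 (0 : ℝ))
    (hc : ∀ (j : ℕ) (hj : (j : ℕ∞) ≤ k), ContDiffOn ℝ ∞ (fun p => (c p).iterDeriv j hj) s)
    (ha : HasDerivAt (fun τ => (c τ).1) a.1 0) (j : ℕ) (hj : (j : ℕ∞) ≤ k) :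
    HasDerivAt (fun τ => (c τ).iterDeriv j hj) (a.iterDeriv j hj) 0 := by
  induction j with
  | zero => simpa only [iterDeriv_zero] using ha
  | succ j ih =>
    have hj' : (j : ℕ∞) ≤ k := le_trans (by exact_mod_cast Nat.le_succ j) hj
    have h1 := ih hj'
    have h2 := (((hc (j + 1) hj).contDiffAt hs).differentiableAt (by simp)).hasDerivAt
    set b := deriv (fun p => (c p).iterDeriv (j + 1) hj) 0
    have h3 : ∀ f : CkPath k F, f.iterDeriv j hj' =
        constPath (f.iterDeriv j hj' 0) + primitive (f.iterDeriv (j + 1) hj) := fun f =>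
      eq_const_add_primitive fun t ht => f.hasDerivWithinAt_iterDeriv hj hj' ht
    have h4 : HasDerivAt (fun τ => (c τ).iterDeriv j hj')
        (constPath (a.iterDeriv j hj' 0) + primitive b) 0 := by
      have h5 : HasDerivAt (fun τ => (c τ).iterDeriv j hj' 0) (a.iterDeriv j hj' 0) 0 :=
        (ContinuousMap.evalCLM ℝ (M := F)
          (0 : unitInterval)).hasFDerivAt.comp_hasDerivAt 0 h1
      exact (((constPath (F := F)).hasFDerivAt.comp_hasDerivAt 0 h5).add
        ((primitive (F := F)).hasFDerivAt.comp_hasDerivAt 0 h2)).congr_of_eventuallyEq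
        (Eventually.of_forall fun τ => h3 (c τ))
    have h6 := h1.unique h4
    have h7 : a.iterDeriv (j + 1) hj = b := by
      ext t
      have h8 := hasDerivWithinAt_of_eq h6 t.2
      have h9 := (uniqueDiffOn_Icc zero_lt_one t t.2).eq_deriv _ h8
        (a.hasDerivWithinAt_iterDeriv hj hj' t.2)
      simpa using h9.symm
    rw [h7]
    exact h2

end CkPath

end SmoothFamilies

/-! ### The Lie group in the chart at the identity -/

section LieGroupChart

open VectorField

variable {E : Type u} [NormedAddCommGroup E] [NormedSpace ℝ E]
variable (G : Type v) [TopologicalSpace G] [ChartedSpace E G] [Group G]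

/-- The chart of `G` at the identity. -/
def oneChart : OpenPartialHomeomorph G E := chartAt E (1 : G)

/-- The coordinates of the identity. -/
def oneCoord : E := oneChart (E := E) G 1

omit [NormedSpace ℝ E] in
theorem one_mem_source : (1 : G) ∈ (oneChart (E := E) G).source := mem_chart_source E 1

omit [NormedSpace ℝ E] in
theorem oneCoord_mem_target : oneCoord (E := E) G ∈ (oneChart (E := E) G).target :=
  (oneChart G).map_source (one_mem_source G)

omit [NormedSpace ℝ E] in
@[simp] theorem oneChart_symm_oneCoord : (oneChart (E := E) G).symm (oneCoord G) = 1 :=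
  (oneChart G).left_inv (one_mem_source G)

omit [NormedSpace ℝ E] in
@[simp] theorem oneChart_one : (oneChart (E := E) G) 1 = oneCoord G := rfl

variable [LieGroup 𝓘(ℝ, E) ∞ G]

section Smooth

variable {V : Type*} [NormedAddCommGroup V] [NormedSpace ℝ V]

variable {G} in
theorem contDiffAt_oneChart_comp {n : WithTop ℕ∞} (hn : n ≤ ∞) {f : V → G} {p : V}
    (hf : ContMDiffAt 𝓘(ℝ, V) 𝓘(ℝ, E) n f p) (hp : f p ∈ (oneChart (E := E) G).source) :
    ContDiffAt ℝ n (fun q => oneChart (E := E) G (f q)) p := by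
  have h1 : ContMDiffAt 𝓘(ℝ, E) 𝓘(ℝ, E) n (oneChart (E := E) G) (f p) :=
    (contMDiffAt_of_mem_maximalAtlas (n := ∞) (IsManifold.chart_mem_maximalAtlas (1 : G)) hp).of_le hn
  exact (h1.comp p hf).contDiffAt

theorem contMDiffAt_oneChart_symm {x : E} (hx : x ∈ (oneChart (E := E) G).target) :
    ContMDiffAt 𝓘(ℝ, E) 𝓘(ℝ, E) ∞ (oneChart (E := E) G).symm x :=
  contMDiffAt_symm_of_mem_maximalAtlas (IsManifold.chart_mem_maximalAtlas (1 : G)) hx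

end Smooth

/-- The multiplication in the chart at the identity. -/
def mulCoord (p : E × E) : E :=
  oneChart (E := E) G ((oneChart (E := E) G).symm p.1 * (oneChart (E := E) G).symm p.2)

theorem contDiffAt_mulCoord {x y : E} (hx : x ∈ (oneChart (E := E) G).target)
    (hy : y ∈ (oneChart (E := E) G).target)
    (hxy : (oneChart (E := E) G).symm x * (oneChart (E := E) G).symm y ∈
      (oneChart (E := E) G).source) : ContDiffAt ℝ ∞ (mulCoord (E := E) G) (x, y) := by
  refine contDiffAt_oneChart_comp le_rfl (ContMDiffAt.mul (I := 𝓘(ℝ, E)) ?_ ?_) hxy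
  · exact (contMDiffAt_oneChart_symm G hx).comp (x, y) contDiffAt_fst.contMDiffAt
  · exact (contMDiffAt_oneChart_symm G hy).comp (x, y) contDiffAt_snd.contMDiffAt

section Bridge

omit [LieGroup 𝓘(ℝ, E) ∞ G]

variable {G}

/-- The tangent space at `1` is identified with `E` through the preferred chart at `1`, so manifold
derivatives of maps fixing `1` are ordinary derivatives in `oneChart`. -/
theorem hasFDerivAt_of_hasMFDerivAt_one {f : G → G} (hf : f 1 = 1) {T : E →L[ℝ] E}
    (h : HasMFDerivAt 𝓘(ℝ, E) 𝓘(ℝ, E) f 1 T) :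
    HasFDerivAt (fun x => oneChart (E := E) G (f ((oneChart (E := E) G).symm x))) T
      (oneCoord G) := by
  have h3 : HasFDerivWithinAt (writtenInExtChartAt 𝓘(ℝ, E) 𝓘(ℝ, E) 1 f) T (range 𝓘(ℝ, E))
      (oneCoord G) := h.2
  simp only [writtenInExtChartAt, hf, modelWithCornersSelf_coe, range_id, hasFDerivWithinAt_univ]
    at h3
  exact h3

theorem hasFDerivAt_of_hasMFDerivAt_one' {f : G → E} {T : E →L[ℝ] E}
    (h : HasMFDerivAt 𝓘(ℝ, E) 𝓘(ℝ, E) f 1 T) :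
    HasFDerivAt (fun x => f ((oneChart (E := E) G).symm x)) T (oneCoord G) := by
  have h3 : HasFDerivWithinAt (writtenInExtChartAt 𝓘(ℝ, E) 𝓘(ℝ, E) 1 f) T (range 𝓘(ℝ, E))
      (oneCoord G) := h.2
  simp only [writtenInExtChartAt, modelWithCornersSelf_coe, range_id, hasFDerivWithinAt_univ,
    extChartAt_model_space_eq_id] at h3
  exact h3

theorem inverse_apply_of_eq_id {T : E →L[ℝ] E} (hT : T = ContinuousLinearMap.id ℝ E) (x : E) :
    T.inverse x = x := by
  rw [hT, ContinuousLinearMap.inverse_id]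
  rfl

end Bridge

/-- Conjugation in the chart at the identity. -/
def conjCoord (g : G) (x : E) : E :=
  oneChart (E := E) G (g * (oneChart (E := E) G).symm x * g⁻¹)

variable {G} in
theorem contDiffAt_conjCoord (g : G) : ContDiffAt ℝ ∞ (conjCoord (E := E) G g) (oneCoord G) := by
  have h1 := contMDiffAt_oneChart_symm G (oneCoord_mem_target (E := E) G)
  refine contDiffAt_oneChart_comp le_rfl (ContMDiffAt.mul (I := 𝓘(ℝ, E))
    (ContMDiffAt.mul (I := 𝓘(ℝ, E)) contMDiffAt_const h1) contMDiffAt_const) ?_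
  simpa using one_mem_source (E := E) G

/-- The adjoint action as a continuous linear map. -/
def AdL {G : Type v} [TopologicalSpace G] [ChartedSpace E G] [Group G] (g : G) : E →L[ℝ] E :=
  fderiv ℝ (conjCoord (E := E) G g) (oneCoord G)

omit [NormedSpace ℝ E] [LieGroup 𝓘(ℝ, E) ∞ G] in
theorem conjCoord_oneCoord (g : G) : conjCoord (E := E) G g (oneCoord G) = oneCoord G := by
  simp [conjCoord]

variable {G} in
theorem hasFDerivAt_conjCoord (g : G) :
    HasFDerivAt (conjCoord (E := E) G g) (AdL g) (oneCoord G) :=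
  ((contDiffAt_conjCoord g).differentiableAt (by simp)).hasFDerivAt

variable {G} in
theorem Ad_eq_AdL (g : G) (x : E) : Ad g x = AdL g x := by
  have h1 : MDifferentiableAt 𝓘(ℝ, E) 𝓘(ℝ, E) (fun h : G => g * h * g⁻¹) 1 :=
    (ContMDiff.mul (I := 𝓘(ℝ, E)) (n := ∞) (ContMDiff.mul (I := 𝓘(ℝ, E)) contMDiff_const
      contMDiff_id) contMDiff_const).mdifferentiable (by simp) 1
  have h2 : g * 1 * g⁻¹ = 1 := by simp
  have h3 : ∀ T : E →L[ℝ] E, HasMFDerivAt 𝓘(ℝ, E) 𝓘(ℝ, E) (fun h : G => g * h * g⁻¹) 1 T →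
      T x = AdL g x := fun T hT => by
    rw [(hasFDerivAt_of_hasMFDerivAt_one h2 hT).unique (hasFDerivAt_conjCoord g)]
  exact h3 _ h1.hasMFDerivAt

omit [LieGroup 𝓘(ℝ, E) ∞ G] in
variable {G} in
theorem AdL_one : AdL (1 : G) = ContinuousLinearMap.id ℝ E := by
  have h1 : conjCoord (E := E) G 1 =ᶠ[𝓝 (oneCoord G)] id := by
    filter_upwards [(oneChart (E := E) G).open_target.mem_nhds (oneCoord_mem_target G)] with x hx
    simp [conjCoord, (oneChart (E := E) G).right_inv hx]
  exact ((hasFDerivAt_id _).congr_of_eventuallyEq h1).fderiv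

omit [NormedSpace ℝ E] [LieGroup 𝓘(ℝ, E) ∞ G] in
theorem continuousAt_oneChart_symm :
    ContinuousAt (oneChart (E := E) G).symm (oneCoord G) :=
  (oneChart (E := E) G).continuousAt_symm (oneCoord_mem_target G)

omit [NormedSpace ℝ E] [LieGroup 𝓘(ℝ, E) ∞ G] in
variable {G} in
theorem eventually_mem_source {T : Type*} {l : Filter T} {f : T → G} (hf : Tendsto f l (𝓝 1)) :
    ∀ᶠ x in l, f x ∈ (oneChart (E := E) G).source :=
  hf.eventually ((oneChart (E := E) G).open_source.mem_nhds (one_mem_source G))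

variable {G} in
theorem eventually_conj_mem_source (g : G) : ∀ᶠ x in 𝓝 (oneCoord (E := E) G),
    g * (oneChart (E := E) G).symm x * g⁻¹ ∈ (oneChart (E := E) G).source := by
  have : IsTopologicalGroup G := topologicalGroup_of_lieGroup 𝓘(ℝ, E) ∞
  refine eventually_mem_source ?_
  have h1 : Tendsto (oneChart (E := E) G).symm (𝓝 (oneCoord G)) (𝓝 1) := by
    simpa [ContinuousAt] using continuousAt_oneChart_symm (E := E) G
  have := (h1.const_mul g).mul_const g⁻¹
  simpa using this

variable {G} in
theorem AdL_mul (g h : G) : (AdL (g * h) : E →L[ℝ] E) = AdL g ∘L AdL h := by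
  have h1 : conjCoord (E := E) G (g * h) =ᶠ[𝓝 (oneCoord G)] conjCoord G g ∘ conjCoord G h := by
    filter_upwards [eventually_conj_mem_source h] with x hx
    simp only [conjCoord, Function.comp_apply, (oneChart (E := E) G).left_inv hx]
    simp [mul_assoc]
  have h2 : HasFDerivAt (conjCoord (E := E) G g) (AdL g) (conjCoord G h (oneCoord G)) := by
    rw [conjCoord_oneCoord]
    exact hasFDerivAt_conjCoord g
  exact ((h2.comp _ (hasFDerivAt_conjCoord h)).congr_of_eventuallyEq h1).fderiv

variable {G} in
theorem AdL_inv_apply_AdL (g : G) (x : E) : AdL g⁻¹ (AdL g x) = x := by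
  rw [← ContinuousLinearMap.comp_apply, ← AdL_mul, inv_mul_cancel, AdL_one]
  rfl

variable {G} in
theorem AdL_apply_AdL_inv (g : G) (x : E) : AdL g (AdL g⁻¹ x) = x := by
  rw [← ContinuousLinearMap.comp_apply, ← AdL_mul, mul_inv_cancel, AdL_one]
  rfl

/-! ### Invariant vector fields in the chart -/

/-- The derivative of left translation, in the chart. -/
def leftField (x : E) : E →L[ℝ] E :=
  fderiv ℝ (mulCoord (E := E) G) (x, oneCoord G) ∘L ContinuousLinearMap.inr ℝ E E

/-- The derivative of right translation, in the chart. -/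
def rightField (x : E) : E →L[ℝ] E :=
  fderiv ℝ (mulCoord (E := E) G) (oneCoord G, x) ∘L ContinuousLinearMap.inl ℝ E E

variable {G}

theorem contDiffAt_mulCoord_left {x : E} (hx : x ∈ (oneChart (E := E) G).target) :
    ContDiffAt ℝ ∞ (mulCoord (E := E) G) (x, oneCoord G) :=
  contDiffAt_mulCoord G hx (oneCoord_mem_target G) (by
    simpa using (oneChart (E := E) G).map_target hx)

theorem contDiffAt_mulCoord_right {x : E} (hx : x ∈ (oneChart (E := E) G).target) :
    ContDiffAt ℝ ∞ (mulCoord (E := E) G) (oneCoord G, x) :=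
  contDiffAt_mulCoord G (oneCoord_mem_target G) hx (by
    simpa using (oneChart (E := E) G).map_target hx)

theorem contDiffAt_rightField {x : E} (hx : x ∈ (oneChart (E := E) G).target) :
    ContDiffAt ℝ ∞ (rightField (E := E) G) x :=
  (((contDiffAt_mulCoord_right hx).fderiv_right (m := ∞) (by simp)).comp x
    (contDiffAt_const.prodMk contDiffAt_id)).clm_comp contDiffAt_const

theorem contDiffAt_leftField {x : E} (hx : x ∈ (oneChart (E := E) G).target) :
    ContDiffAt ℝ ∞ (leftField (E := E) G) x :=
  (((contDiffAt_mulCoord_left hx).fderiv_right (m := ∞) (by simp)).comp x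
    (contDiffAt_id.prodMk contDiffAt_const)).clm_comp contDiffAt_const

theorem hasFDerivAt_mulCoord_left {x : E} (hx : x ∈ (oneChart (E := E) G).target) :
    HasFDerivAt (fun y => mulCoord G (x, y)) (leftField (E := E) G x) (oneCoord G) :=
  ((contDiffAt_mulCoord_left hx).differentiableAt (by simp)).hasFDerivAt.comp (oneCoord (E := E) G)
    (hasFDerivAt_prodMk_right x (oneCoord (E := E) G))

theorem hasFDerivAt_mulCoord_right {x : E} (hx : x ∈ (oneChart (E := E) G).target) :
    HasFDerivAt (fun y => mulCoord G (y, x)) (rightField (E := E) G x) (oneCoord G) :=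
  HasFDerivAt.comp (f := fun y => (y, x)) (oneCoord (E := E) G)
    ((contDiffAt_mulCoord_right hx).differentiableAt (by simp)).hasFDerivAt
    (hasFDerivAt_prodMk_left (oneCoord (E := E) G) x)

theorem leftField_oneCoord : leftField (E := E) G (oneCoord G) = ContinuousLinearMap.id ℝ E := by
  refine (hasFDerivAt_mulCoord_left (oneCoord_mem_target G)).unique
    ((hasFDerivAt_id _).congr_of_eventuallyEq ?_)
  filter_upwards [(oneChart (E := E) G).open_target.mem_nhds (oneCoord_mem_target G)] with x hx
  simp [mulCoord, (oneChart (E := E) G).right_inv hx]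

theorem rightField_oneCoord : rightField (E := E) G (oneCoord G) = ContinuousLinearMap.id ℝ E := by
  refine (hasFDerivAt_mulCoord_right (oneCoord_mem_target G)).unique
    ((hasFDerivAt_id _).congr_of_eventuallyEq ?_)
  filter_upwards [(oneChart (E := E) G).open_target.mem_nhds (oneCoord_mem_target G)] with x hx
  simp [mulCoord, (oneChart (E := E) G).right_inv hx]

/-- `g x = (g x g⁻¹) g`. -/
theorem leftField_eq {x : E} (hx : x ∈ (oneChart (E := E) G).target) :
    leftField (E := E) G x = rightField G x ∘L AdL ((oneChart (E := E) G).symm x) := by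
  set g := (oneChart (E := E) G).symm x with hg
  have h1 : HasFDerivAt (fun y => mulCoord (E := E) G (y, x)) (rightField (E := E) G x)
      (conjCoord G g (oneCoord G)) := by
    rw [conjCoord_oneCoord]
    exact hasFDerivAt_mulCoord_right hx
  refine (hasFDerivAt_mulCoord_left hx).unique
    ((h1.comp _ (hasFDerivAt_conjCoord g)).congr_of_eventuallyEq ?_)
  filter_upwards [eventually_conj_mem_source g] with y hy
  simp only [mulCoord, conjCoord, Function.comp_apply, (oneChart (E := E) G).left_inv hy, ← hg]
  simp

/-- The second derivative of the multiplication at the identity. -/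
def mulHess (G : Type v) [TopologicalSpace G] [ChartedSpace E G] [Group G] :
    E × E →L[ℝ] E × E →L[ℝ] E :=
  fderiv ℝ (fderiv ℝ (mulCoord (E := E) G)) (oneCoord G, oneCoord G)

theorem hasFDerivAt_fderiv_mulCoord :
    HasFDerivAt (fderiv ℝ (mulCoord (E := E) G)) (mulHess (E := E) G)
      (oneCoord G, oneCoord G) :=
  (((contDiffAt_mulCoord_left (oneCoord_mem_target G)).fderiv_right (m := ∞)
    (by simp)).differentiableAt (by simp)).hasFDerivAt

theorem fderiv_leftField (a y : E) :
    fderiv ℝ (leftField (E := E) G) (oneCoord G) a y = mulHess G (a, 0) (0, y) := by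
  have h1 := (hasFDerivAt_fderiv_mulCoord (E := E) (G := G)).comp (f := fun y => (y, oneCoord G))
    (oneCoord G) (hasFDerivAt_prodMk_left (oneCoord (E := E) G) (oneCoord (E := E) G))
  have h2 := h1.clm_comp (hasFDerivAt_const (ContinuousLinearMap.inr ℝ E E) (oneCoord (E := E) G))
  have h3 : HasFDerivAt (leftField (E := E) G) _ (oneCoord G) := h2
  rw [h3.fderiv]
  simp

theorem fderiv_rightField (a y : E) :
    fderiv ℝ (rightField (E := E) G) (oneCoord G) a y = mulHess G (0, a) (y, 0) := by
  have h1 := (hasFDerivAt_fderiv_mulCoord (E := E) (G := G)).comp (oneCoord G)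
    (hasFDerivAt_prodMk_right (oneCoord (E := E) G) (oneCoord (E := E) G))
  have h2 := h1.clm_comp (hasFDerivAt_const (ContinuousLinearMap.inl ℝ E E) (oneCoord (E := E) G))
  have h3 : HasFDerivAt (rightField (E := E) G) _ (oneCoord G) := h2
  rw [h3.fderiv]
  simp

theorem mulHess_symm (p q : E × E) : mulHess (E := E) G p q = mulHess G q p :=
  ((contDiffAt_mulCoord_left (oneCoord_mem_target G)).isSymmSndFDerivAt
    (by simpa using (by exact_mod_cast le_top : ((2 : ℕ∞) : WithTop ℕ∞) ≤ ∞))) p q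

/-- `u ↦ Ad(u)` in the chart. -/
theorem contDiffAt_AdL_oneChart_symm :
    ContDiffAt ℝ ∞ (fun x => (AdL ((oneChart (E := E) G).symm x) : E →L[ℝ] E)) (oneCoord G) := by
  have h1 := contMDiffAt_oneChart_symm G (oneCoord_mem_target (E := E) G)
  have h2 : ContDiffAt ℝ ∞ (fun p : E × E => conjCoord (E := E) G ((oneChart (E := E) G).symm p.1)
      p.2) (oneCoord G, oneCoord G) := by
    have h3 : ContMDiffAt 𝓘(ℝ, E × E) 𝓘(ℝ, E) ∞ (fun p : E × E => (oneChart (E := E) G).symm p.1)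
      (oneCoord G, oneCoord G) := h1.comp (oneCoord (E := E) G, oneCoord (E := E) G)
        contDiffAt_fst.contMDiffAt
    have h4 : ContMDiffAt 𝓘(ℝ, E × E) 𝓘(ℝ, E) ∞ (fun p : E × E => (oneChart (E := E) G).symm p.2)
      (oneCoord G, oneCoord G) := h1.comp (oneCoord (E := E) G, oneCoord (E := E) G)
        contDiffAt_snd.contMDiffAt
    refine contDiffAt_oneChart_comp le_rfl ((h3.mul h4).mul h3.inv) ?_
    simpa using one_mem_source (E := E) G
  exact h2.fderiv (f := fun x y => conjCoord (E := E) G ((oneChart (E := E) G).symm x) y)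
    (g := fun _ => oneCoord (E := E) G) contDiffAt_const (by simp)

/-- Differentiate `leftField = rightField ∘ Ad` at the identity, where all three maps are the
identity: the derivative of `Ad` is the difference of the derivatives of the two fields, and these
are mixed second derivatives of the multiplication. Symmetry of second derivatives puts them in the
stated form. -/
theorem fderiv_AdL (a y : E) :
    fderiv ℝ (fun x => (AdL ((oneChart (E := E) G).symm x) : E →L[ℝ] E)) (oneCoord G) a y =
      mulHess G (a, 0) (0, y) - mulHess G (y, 0) (0, a) := by
  have hR := ((contDiffAt_rightField (oneCoord_mem_target (E := E) G)).differentiableAt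
    (by simp)).hasFDerivAt
  have hK := ((contDiffAt_AdL_oneChart_symm (E := E) (G := G)).differentiableAt
    (by simp)).hasFDerivAt
  have h1 := hR.clm_comp hK
  have h2 : leftField (E := E) G =ᶠ[𝓝 (oneCoord G)] fun x => rightField G x ∘L
      AdL ((oneChart (E := E) G).symm x) := by
    filter_upwards [(oneChart (E := E) G).open_target.mem_nhds (oneCoord_mem_target G)] with x hx
    exact leftField_eq hx
  have h3 := congrArg (fun T => T a y) (h1.congr_of_eventuallyEq h2).fderiv
  simp only [fderiv_leftField, add_apply, ContinuousLinearMap.comp_apply,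
    ContinuousLinearMap.compL_apply, ContinuousLinearMap.flip_apply, oneChart_symm_oneCoord,
    AdL_one, rightField_oneCoord, ContinuousLinearMap.id_apply, fderiv_rightField] at h3
  rw [h3, mulHess_symm (y, 0) (0, a)]
  abel

/-- Pulling back along the inverse chart means applying the derivative of the chart. The chain rule
through `h ↦ g h` then gives the derivative of left translation in coordinates. -/
theorem mfderiv_mul_left_oneChart {x : E} (hx : x ∈ (oneChart (E := E) G).target) (a : E) :
    mpullbackWithin 𝓘(ℝ, E) 𝓘(ℝ, E) (extChartAt 𝓘(ℝ, E) (1 : G)).symm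
      (mulInvariantVectorField (I := 𝓘(ℝ, E)) (G := G) a) (range 𝓘(ℝ, E)) x =
      leftField (E := E) G x a := by
  set g := (oneChart (E := E) G).symm x with hg
  have hx' : x ∈ (extChartAt 𝓘(ℝ, E) (1 : G)).target := by
    rw [extChartAt_target]
    simpa [oneChart] using hx
  have h1 := ContinuousLinearMap.inverse_eq
    (mfderivWithin_extChartAt_symm_comp_mfderiv_extChartAt hx')
    (mfderiv_extChartAt_comp_mfderivWithin_extChartAt_symm hx')
  rw [mpullbackWithin_apply, h1]
  have h2 : HasMFDerivAt 𝓘(ℝ, E) 𝓘(ℝ, E) (fun h : G => g * h) 1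
      (mfderiv 𝓘(ℝ, E) 𝓘(ℝ, E) (fun h : G => g * h) 1) :=
    ((contMDiff_mul_left (I := 𝓘(ℝ, E)) (n := ∞)).mdifferentiable (by simp) 1).hasMFDerivAt
  have hgs : g * 1 ∈ (oneChart (E := E) G).source := by
    rw [mul_one]
    exact (oneChart (E := E) G).map_target hx
  have h3 : HasMFDerivAt 𝓘(ℝ, E) 𝓘(ℝ, E) (extChartAt 𝓘(ℝ, E) (1 : G)) (g * 1)
      (mfderiv 𝓘(ℝ, E) 𝓘(ℝ, E) (extChartAt 𝓘(ℝ, E) (1 : G)) (g * 1)) :=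
    (mdifferentiableAt_extChartAt hgs).hasMFDerivAt
  have h4 : HasFDerivAt (fun y => mulCoord G (x, y)) _ (oneCoord G) :=
    hasFDerivAt_of_hasMFDerivAt_one' (h3.comp (1 : G) h2)
  have h5 := congrArg (fun T : E →L[ℝ] E => T a) (h4.unique (hasFDerivAt_mulCoord_left hx))
  have h7 : mfderiv 𝓘(ℝ, E) 𝓘(ℝ, E) (extChartAt 𝓘(ℝ, E) (1 : G)) (g * 1) =
    mfderiv 𝓘(ℝ, E) 𝓘(ℝ, E) (extChartAt 𝓘(ℝ, E) (1 : G)) g := by rw [mul_one]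
  rw [← h5]
  exact congrArg (fun T : E →L[ℝ] E => T (mfderiv 𝓘(ℝ, E) 𝓘(ℝ, E) (fun h : G => g * h) 1 a)) h7.symm

/-- The Lie bracket in terms of the multiplication in the chart at the identity. -/
theorem lie_eq_mulHess [CompleteSpace E] (a y : E) :
    lie G a y = mulHess G (a, 0) (0, y) - mulHess G (y, 0) (0, a) := by
  have h0 : ∀ a : E, mpullbackWithin 𝓘(ℝ, E) 𝓘(ℝ, E) (extChartAt 𝓘(ℝ, E) (1 : G)).symm
      (mulInvariantVectorField (I := 𝓘(ℝ, E)) (G := G) a) (range 𝓘(ℝ, E)) =ᶠ[𝓝 (oneCoord G)]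
        fun x => leftField (E := E) G x a := fun a => by
    filter_upwards [(oneChart (E := E) G).open_target.mem_nhds (oneCoord_mem_target G)] with x hx
    exact mfderiv_mul_left_oneChart hx a
  have hid : ∀ T : E →L[ℝ] E, T = ContinuousLinearMap.id ℝ E → ∀ v w : E, v = w →
      T.inverse v = w := fun T hT v w h => (inverse_apply_of_eq_id hT v).trans h
  -- The bracket of invariant fields on `G` is computed in the chart at `1` and transported back by
  -- the inverse of the derivative of this chart, which is the identity at `1`.
  have h1 : lie G a y = lieBracketWithin ℝ
      (mpullbackWithin 𝓘(ℝ, E) 𝓘(ℝ, E) (extChartAt 𝓘(ℝ, E) (1 : G)).symm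
        (mulInvariantVectorField (I := 𝓘(ℝ, E)) (G := G) a) (range 𝓘(ℝ, E)))
      (mpullbackWithin 𝓘(ℝ, E) 𝓘(ℝ, E) (extChartAt 𝓘(ℝ, E) (1 : G)).symm
        (mulInvariantVectorField (I := 𝓘(ℝ, E)) (G := G) y) (range 𝓘(ℝ, E)))
      ((extChartAt 𝓘(ℝ, E) (1 : G)).symm ⁻¹' univ ∩ range 𝓘(ℝ, E))
      (extChartAt 𝓘(ℝ, E) (1 : G) 1) :=
    (mlieBracketWithin_apply (I := 𝓘(ℝ, E)) (s := univ) (x₀ := (1 : G))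
      (V := mulInvariantVectorField a) (W := mulInvariantVectorField y)).trans
      (hid _ mfderiv_extChartAt_self _ _ rfl)
  have h2 : ∀ V W : E → E, V =ᶠ[𝓝 (oneCoord G)] (fun x => leftField (E := E) G x a) →
      W =ᶠ[𝓝 (oneCoord G)] (fun x => leftField (E := E) G x y) →
      lieBracketWithin ℝ V W ((extChartAt 𝓘(ℝ, E) (1 : G)).symm ⁻¹' univ ∩ range 𝓘(ℝ, E))
        (oneCoord G) = mulHess G (a, 0) (0, y) - mulHess G (y, 0) (0, a) := by
    intro V W hV hW
    have hL := ((contDiffAt_leftField (oneCoord_mem_target (E := E) G)).differentiableAt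
      (by simp)).hasFDerivAt
    have h3 : ∀ b : E, HasFDerivAt (fun x => leftField (E := E) G x b)
        ((fderiv ℝ (leftField (E := E) G) (oneCoord G)).flip b) (oneCoord G) := fun b => by
      have := hL.clm_apply (hasFDerivAt_const b (oneCoord (E := E) G))
      simpa using this
    rw [preimage_univ, univ_inter, modelWithCornersSelf_coe, range_id, lieBracketWithin_univ,
      lieBracket_eq]
    change fderiv ℝ W (oneCoord G) (V (oneCoord G)) -
      fderiv ℝ V (oneCoord G) (W (oneCoord G)) = _
    rw [((h3 a).congr_of_eventuallyEq hV).fderiv,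
      ((h3 y).congr_of_eventuallyEq hW).fderiv, hV.eq_of_nhds, hW.eq_of_nhds, leftField_oneCoord]
    simp only [ContinuousLinearMap.flip_apply, ContinuousLinearMap.id_apply, fderiv_leftField]
  exact h1.trans (h2 _ _ (h0 a) (h0 y))

end LieGroupChart

/-! ### Logarithmic derivatives of paths in the group -/

section LogDerivative

variable {E : Type u} [NormedAddCommGroup E] [NormedSpace ℝ E]
variable {G : Type v} [TopologicalSpace G] [ChartedSpace E G] [Group G]

/-- `c` passes through `1` at time `t`, with velocity `a`. -/
def HasUnitVel (c : ℝ → G) (a : E) (s : Set ℝ) (t : ℝ) : Prop :=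
  c t = 1 ∧ ContinuousWithinAt c s t ∧ HasDerivWithinAt (fun τ => oneChart (E := E) G (c τ)) a s t

/-- The right logarithmic derivative of `g` at `t` is `a`. -/
def HasRLD (g : ℝ → G) (a : E) (s : Set ℝ) (t : ℝ) : Prop :=
  HasUnitVel (fun τ => g τ * (g t)⁻¹) a s t

variable (G) in
/-- The derivative of the adjoint action at the identity. -/
def lieL : E →L[ℝ] E →L[ℝ] E :=
  fderiv ℝ (fun x => (AdL ((oneChart (E := E) G).symm x) : E →L[ℝ] E)) (oneCoord G)

section Basic

variable {c c' : ℝ → G} {a a' : E} {s : Set ℝ} {t : ℝ}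

theorem HasUnitVel.eventually_mem (h : HasUnitVel c a s t) :
    ∀ᶠ τ in 𝓝[s] t, c τ ∈ (oneChart (E := E) G).source :=
  eventually_mem_source (by simpa [ContinuousWithinAt, h.1] using h.2.1)

theorem HasUnitVel.oneChart_apply (h : HasUnitVel c a s t) :
    oneChart (E := E) G (c t) = oneCoord G := by rw [h.1]; rfl

theorem HasUnitVel.congr (h : HasUnitVel c a s t) (hc : ∀ᶠ τ in 𝓝[s] t, c' τ = c τ)
    (ht : c' t = c t) : HasUnitVel c' a s t :=
  ⟨ht.trans h.1, h.2.1.congr_of_eventuallyEq hc ht,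
    h.2.2.congr_of_eventuallyEq (hc.mono fun τ hτ => by simp only [hτ]) (by simp only [ht])⟩

variable [LieGroup 𝓘(ℝ, E) ∞ G]

theorem lieL_apply [CompleteSpace E] (a y : E) : lieL G a y = lie G a y := by
  rw [lieL, fderiv_AdL, lie_eq_mulHess]

theorem hasFDerivAt_mulCoord_one : HasFDerivAt (mulCoord (E := E) G)
    (ContinuousLinearMap.fst ℝ E E + ContinuousLinearMap.snd ℝ E E) (oneCoord G, oneCoord G) := by
  have h1 := ((contDiffAt_mulCoord_left (oneCoord_mem_target (E := E) G)).differentiableAt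
    (by simp)).hasFDerivAt
  refine h1.congr_fderiv ?_
  have h2 := leftField_oneCoord (E := E) (G := G)
  have h3 := rightField_oneCoord (E := E) (G := G)
  rw [leftField] at h2
  rw [rightField] at h3
  ext x
  · simpa using congrArg (fun T : E →L[ℝ] E => T x) h3
  · simpa using congrArg (fun T : E →L[ℝ] E => T x) h2

theorem HasUnitVel.mul (h : HasUnitVel c a s t) (h' : HasUnitVel c' a' s t) :
    HasUnitVel (fun τ => c τ * c' τ) (a + a') s t := by
  have : IsTopologicalGroup G := topologicalGroup_of_lieGroup 𝓘(ℝ, E) ∞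
  refine ⟨by simp only [h.1, h'.1, mul_one], h.2.1.mul h'.2.1, ?_⟩
  have h1 : HasFDerivAt (mulCoord (E := E) G) (ContinuousLinearMap.fst ℝ E E +
      ContinuousLinearMap.snd ℝ E E) (oneChart (E := E) G (c t), oneChart (E := E) G (c' t)) := by
    rw [h.oneChart_apply, h'.oneChart_apply]
    exact hasFDerivAt_mulCoord_one
  have h2 := h1.comp_hasDerivWithinAt t (h.2.2.prodMk h'.2.2)
  refine h2.congr_of_eventuallyEq ?_ ?_
  · filter_upwards [h.eventually_mem, h'.eventually_mem] with τ hτ hτ'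
    simp [mulCoord, (oneChart (E := E) G).left_inv hτ, (oneChart (E := E) G).left_inv hτ']
  · simp [mulCoord, h.1, h'.1]

theorem HasUnitVel.conj (h : HasUnitVel c a s t) (g : G) :
    HasUnitVel (fun τ => g * c τ * g⁻¹) (AdL g a) s t := by
  have : IsTopologicalGroup G := topologicalGroup_of_lieGroup 𝓘(ℝ, E) ∞
  refine ⟨by simp [h.1], (h.2.1.const_mul g).mul_const _, ?_⟩
  have h1 : HasFDerivAt (conjCoord (E := E) G g) (AdL g) (oneChart (E := E) G (c t)) := by
    rw [h.oneChart_apply]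
    exact hasFDerivAt_conjCoord g
  refine (h1.comp_hasDerivWithinAt t h.2.2).congr_of_eventuallyEq ?_ ?_
  · filter_upwards [h.eventually_mem] with τ hτ
    simp [conjCoord, (oneChart (E := E) G).left_inv hτ]
  · simp [conjCoord, h.1]

/-- Differentiate `x x⁻¹ = 1` in the chart: since multiplication has derivative `fst + snd` at the
identity, the derivative `T` of the inversion satisfies `id + T = 0`. -/
theorem hasFDerivAt_invCoord : HasFDerivAt
    (fun x => oneChart (E := E) G ((oneChart (E := E) G).symm x)⁻¹)
    (-ContinuousLinearMap.id ℝ E) (oneCoord G) := by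
  have hm := contMDiffAt_oneChart_symm G (oneCoord_mem_target (E := E) G)
  have h1 : ContDiffAt ℝ ∞ (fun x => oneChart (E := E) G ((oneChart (E := E) G).symm x)⁻¹)
      (oneCoord G) :=
    contDiffAt_oneChart_comp le_rfl hm.inv (by simpa using one_mem_source (E := E) G)
  have h2 := (h1.differentiableAt (by simp)).hasFDerivAt
  set T := fderiv ℝ (fun x => oneChart (E := E) G ((oneChart (E := E) G).symm x)⁻¹) (oneCoord G)
  have h3 : HasFDerivAt (mulCoord (E := E) G) (ContinuousLinearMap.fst ℝ E E +
      ContinuousLinearMap.snd ℝ E E) (oneCoord (E := E) G,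
        oneChart (E := E) G ((oneChart (E := E) G).symm (oneCoord G))⁻¹) := by
    simpa using hasFDerivAt_mulCoord_one (E := E) (G := G)
  have h4 := h3.comp (f := fun x => (x, oneChart (E := E) G ((oneChart (E := E) G).symm x)⁻¹))
    (oneCoord (E := E) G) ((hasFDerivAt_id (oneCoord (E := E) G)).prodMk h2)
  have h5 : (fun _ : E => oneCoord (E := E) G) =ᶠ[𝓝 (oneCoord (E := E) G)] mulCoord (E := E) G ∘
      (fun x => (x, oneChart (E := E) G ((oneChart (E := E) G).symm x)⁻¹)) := by
    have : Tendsto (fun x => ((oneChart (E := E) G).symm x)⁻¹) (𝓝 (oneCoord (E := E) G))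
        (𝓝 1) := by simpa [ContinuousAt] using hm.inv.continuousAt
    filter_upwards [eventually_mem_source (E := E) this] with x hx
    simp [mulCoord, (oneChart (E := E) G).left_inv hx]
  have h6 := (hasFDerivAt_const (oneCoord (E := E) G) (oneCoord (E := E) G)).unique
    (h4.congr_of_eventuallyEq h5)
  have h7 : T = -ContinuousLinearMap.id ℝ E := by
    ext x
    have := congrArg (fun S : E →L[ℝ] E => S x) h6
    simp only [zero_apply, ContinuousLinearMap.comp_apply, ContinuousLinearMap.prod_apply,
      ContinuousLinearMap.id_apply, add_apply, ContinuousLinearMap.coe_fst',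
      ContinuousLinearMap.coe_snd'] at this
    simpa using (neg_eq_of_add_eq_zero_right this.symm).symm
  rwa [h7] at h2

theorem HasUnitVel.inv (h : HasUnitVel c a s t) : HasUnitVel (fun τ => (c τ)⁻¹) (-a) s t := by
  have : IsTopologicalGroup G := topologicalGroup_of_lieGroup 𝓘(ℝ, E) ∞
  refine ⟨by simp [h.1], h.2.1.inv, ?_⟩
  have h1 := hasFDerivAt_invCoord (E := E) (G := G)
  rw [← h.oneChart_apply] at h1
  refine (h1.comp_hasDerivWithinAt t h.2.2).congr_of_eventuallyEq ?_ ?_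
  · filter_upwards [h.eventually_mem] with τ hτ
    simp [(oneChart (E := E) G).left_inv hτ]
  · simp [h.1]

theorem HasUnitVel.hasDerivWithinAt_AdL (h : HasUnitVel c a s t) :
    HasDerivWithinAt (fun τ => (AdL (c τ) : E →L[ℝ] E)) (lieL G a) s t := by
  have h1 := ((contDiffAt_AdL_oneChart_symm (E := E) (G := G)).differentiableAt
    (by simp)).hasFDerivAt
  rw [← h.oneChart_apply] at h1
  have h2 := h1.comp_hasDerivWithinAt t h.2.2
  rw [h.oneChart_apply] at h2
  refine h2.congr_of_eventuallyEq ?_ ?_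
  · filter_upwards [h.eventually_mem] with τ hτ
    simp [(oneChart (E := E) G).left_inv hτ]
  · simp [h.1]

/-- The velocity of a translate of a path through `1`. -/
theorem HasUnitVel.hasDerivWithinAt_mul_const (h : HasUnitVel c a s t) {g : G}
    (hg : g ∈ (oneChart (E := E) G).source) :
    HasDerivWithinAt (fun τ => oneChart (E := E) G (c τ * g))
      (rightField G (oneChart (E := E) G g) a) s t := by
  have h1 := hasFDerivAt_mulCoord_right ((oneChart (E := E) G).map_source hg)
  rw [← h.oneChart_apply] at h1
  refine (h1.comp_hasDerivWithinAt t h.2.2).congr_of_eventuallyEq ?_ ?_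
  · filter_upwards [h.eventually_mem] with τ hτ
    simp [mulCoord, (oneChart (E := E) G).left_inv hτ, (oneChart (E := E) G).left_inv hg]
  · simp [mulCoord, h.1, (oneChart (E := E) G).left_inv hg]

end Basic

section RLD

variable [LieGroup 𝓘(ℝ, E) ∞ G] {g h : ℝ → G} {a b : E} {s : Set ℝ} {t : ℝ}

/-- With `g, h` at time `τ` and `g₀, h₀` at time `t`, one has `(g h)(g₀ h₀)⁻¹ = (g g₀⁻¹) · g₀ (h
h₀⁻¹) g₀⁻¹`, a product of two paths through `1`, whose velocities add. -/
theorem HasRLD.mul (hg : HasRLD g a s t) (hh : HasRLD h b s t) :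
    HasRLD (fun τ => g τ * h τ) (a + AdL (g t) b) s t := by
  refine (HasUnitVel.mul hg (HasUnitVel.conj hh (g t))).congr (Eventually.of_forall fun τ => ?_) ?_
  all_goals simp [mul_assoc]

theorem HasRLD.inv (hg : HasRLD g a s t) :
    HasRLD (fun τ => (g τ)⁻¹) (-AdL (g t)⁻¹ a) s t := by
  have h1 := (HasUnitVel.inv hg).conj (g t)⁻¹
  rw [map_neg] at h1
  exact h1.congr (Eventually.of_forall fun τ => by simp) (by simp)

omit [LieGroup 𝓘(ℝ, E) ∞ G] in
theorem HasRLD.mul_const (hg : HasRLD g a s t) (x : G) : HasRLD (fun τ => g τ * x) a s t :=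
  HasUnitVel.congr hg (Eventually.of_forall fun τ => by simp) (by simp)

theorem HasRLD.continuousWithinAt (hg : HasRLD g a s t) : ContinuousWithinAt g s t := by
  have : IsTopologicalGroup G := topologicalGroup_of_lieGroup 𝓘(ℝ, E) ∞
  have := hg.2.1.mul_const (g t)
  simpa using this

omit [LieGroup 𝓘(ℝ, E) ∞ G] in
theorem HasRLD.unique (hg : HasRLD g a s t) (hg' : HasRLD g b s t) (hs : UniqueDiffWithinAt ℝ s t) :
    a = b := hs.eq_deriv _ hg.2.2 hg'.2.2

theorem HasRLD.hasDerivWithinAt_AdL (hg : HasRLD g a s t) :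
    HasDerivWithinAt (fun τ => (AdL (g τ) : E →L[ℝ] E)) (lieL G a ∘L AdL (g t)) s t := by
  have h1 := (HasUnitVel.hasDerivWithinAt_AdL hg).clm_comp
    (hasDerivWithinAt_const t s (AdL (g t) : E →L[ℝ] E))
  simp only [← AdL_mul] at h1
  simpa using h1

theorem HasRLD.hasDerivWithinAt_oneChart (hg : HasRLD g a s t)
    (hgt : g t ∈ (oneChart (E := E) G).source) :
    HasDerivWithinAt (fun τ => oneChart (E := E) G (g τ))
      (rightField G (oneChart (E := E) G (g t)) a) s t := by
  simpa using HasUnitVel.hasDerivWithinAt_mul_const hg hgt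

/-- Right translation by `g⁻¹` undoes right translation by `g`, so in the chart its derivative at `w
t` is a left inverse of `rightField G (w t)` and recovers `a`. -/
theorem hasRLD_of_hasDerivWithinAt {w : ℝ → E} (hwt : w t ∈ (oneChart (E := E) G).target)
    (hw : HasDerivWithinAt w (rightField G (w t) a) s t) :
    HasRLD (fun τ => (oneChart (E := E) G).symm (w τ)) a s t := by
  have : IsTopologicalGroup G := topologicalGroup_of_lieGroup 𝓘(ℝ, E) ∞
  set x := w t with hx
  set g := (oneChart (E := E) G).symm x with hg
  have hm := contMDiffAt_oneChart_symm G hwt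
  have h1 : ContDiffAt ℝ ∞ (fun y => oneChart (E := E) G ((oneChart (E := E) G).symm y * g⁻¹)) x :=
    contDiffAt_oneChart_comp le_rfl (hm.mul contMDiffAt_const) (by
      simpa [hg] using one_mem_source (E := E) G)
  have h2 := (h1.differentiableAt (by simp)).hasFDerivAt
  set T := fderiv ℝ (fun y => oneChart (E := E) G ((oneChart (E := E) G).symm y * g⁻¹)) x
  have h3 : mulCoord G (oneCoord G, x) = x := by
    simp [mulCoord, (oneChart (E := E) G).right_inv hwt]
  have h2' := h2
  rw [← h3] at h2'
  have h4 := h2'.comp (f := fun y => mulCoord G (y, x)) (oneCoord G)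
    (hasFDerivAt_mulCoord_right hwt)
  have h5 : (fun y : E => y) =ᶠ[𝓝 (oneCoord (E := E) G)]
      (fun y => oneChart (E := E) G ((oneChart (E := E) G).symm y * g⁻¹)) ∘
        fun y => mulCoord G (y, x) := by
    have ht : Tendsto (fun y => (oneChart (E := E) G).symm y * g) (𝓝 (oneCoord (E := E) G))
        (𝓝 g) := by
      have := (continuousAt_oneChart_symm (E := E) G).mul_const g
      simpa [ContinuousAt] using this
    filter_upwards [ht.eventually ((oneChart (E := E) G).open_source.mem_nhds
      ((oneChart (E := E) G).map_target hwt)), (oneChart (E := E) G).open_target.mem_nhds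
      (oneCoord_mem_target G)] with y hy hy'
    simp [mulCoord, ← hg, (oneChart (E := E) G).left_inv hy, (oneChart (E := E) G).right_inv hy']
  have h6 := (hasFDerivAt_id _).unique (h4.congr_of_eventuallyEq h5)
  refine ⟨by simp, ?_, ?_⟩
  · exact ((hm.continuousAt.comp_continuousWithinAt hw.continuousWithinAt).mul_const _)
  · refine (h2.comp_hasDerivWithinAt t hw).congr_deriv ?_
    rw [← ContinuousLinearMap.comp_apply, ← h6]
    rfl

/-- A path with vanishing logarithmic derivative is constant. -/
theorem eq_of_hasRLD_zero [T2Space G] {w : ℝ → G}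
    (hw : ∀ t ∈ Icc (0 : ℝ) 1, HasRLD w (0 : E) (Icc 0 1) t) : ∀ t ∈ Icc (0 : ℝ) 1, w t = w 0 := by
  have : IsTopologicalGroup G := topologicalGroup_of_lieGroup 𝓘(ℝ, E) ∞
  have hc : ContinuousOn w (Icc 0 1) := fun t ht => (hw t ht).continuousWithinAt
  have hclosed : IsClosed ({t | w t = w 0} ∩ Icc (0 : ℝ) 1) := by
    have := hc.preimage_isClosed_of_isClosed isClosed_Icc (isClosed_singleton (x := w 0))
    rwa [inter_comm] at this
  -- The set where `w = w 0` is closed; it remains to extend it to the right of each of its points.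
  -- There `w τ (w x)⁻¹` lies in the chart at `1` for a short time and has derivative zero in
  -- coordinates.
  refine hclosed.Icc_subset_of_forall_mem_nhdsWithin (by simp) fun x hx => ?_
  have hxI : x ∈ Icc (0 : ℝ) 1 := ⟨hx.2.1, hx.2.2.le⟩
  have h1 : ∀ᶠ τ in 𝓝[Icc (0 : ℝ) 1] x, w τ * (w x)⁻¹ ∈ (oneChart (E := E) G).source :=
    HasUnitVel.eventually_mem (hw x hxI)
  have h2 : ∀ᶠ τ in 𝓝[≥] x, w τ * (w x)⁻¹ ∈ (oneChart (E := E) G).source :=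
    h1.filter_mono (nhdsWithin_le_of_mem (Icc_mem_nhdsGE_of_mem hx.2))
  obtain ⟨y, hy, hxy⟩ := mem_nhdsGE_iff_exists_Icc_subset.1 h2
  have hsub : Icc x y ∩ Icc (0 : ℝ) 1 ∈ 𝓝[≥] x :=
    inter_mem (Icc_mem_nhdsGE hy) (Icc_mem_nhdsGE_of_mem hx.2)
  obtain ⟨z, hz, hxz⟩ := mem_nhdsGE_iff_exists_Icc_subset.1 hsub
  have hd : ∀ τ ∈ Icc x z, HasDerivWithinAt (fun τ => oneChart (E := E) G (w τ * (w x)⁻¹)) 0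
      (Icc 0 1) τ := fun τ hτ => by
    have := ((hw τ (hxz hτ).2).mul_const (w x)⁻¹).hasDerivWithinAt_oneChart (hxy (hxz hτ).1)
    simpa using this
  have hconst := constant_of_has_deriv_right_zero
    (fun τ hτ => (hd τ hτ).continuousWithinAt.mono (fun σ hσ => (hxz hσ).2))
    (fun τ hτ => (hd τ ⟨hτ.1, hτ.2.le⟩).mono_of_mem_nhdsWithin (Icc_mem_nhdsGE_of_mem
      ⟨(hxz ⟨hτ.1, hτ.2.le⟩).2.1, hτ.2.trans_le (hxz ⟨hz.le, le_rfl⟩).2.2⟩))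
  refine mem_of_superset (mem_of_superset (Icc_mem_nhdsGT hz) fun τ hτ => ?_) Subset.rfl
  have h3 := (oneChart (E := E) G).injOn (hxy (hxz hτ).1) (hxy (hxz ⟨le_rfl, hz.le⟩).1)
    (hconst τ hτ)
  exact (mul_right_cancel h3).trans hx.1

/-- A path in the group is determined by its logarithmic derivative and its initial value. -/
theorem eqOn_of_hasRLD [T2Space G] {g h : ℝ → G} {A : ℝ → E}
    (hg : ∀ t ∈ Icc (0 : ℝ) 1, HasRLD g (A t) (Icc 0 1) t)
    (hh : ∀ t ∈ Icc (0 : ℝ) 1, HasRLD h (A t) (Icc 0 1) t) (h0 : g 0 = h 0) :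
    ∀ t ∈ Icc (0 : ℝ) 1, g t = h t := by
  intro t ht
  -- The logarithmic derivative of `g⁻¹ h` is `-Ad(g⁻¹) A + Ad(g⁻¹) A = 0`.
  have := eq_of_hasRLD_zero (E := E) (w := fun τ => (g τ)⁻¹ * h τ) (fun t ht => by
    simpa using (hg t ht).inv.mul (hh t ht)) t ht
  simp only [h0, inv_mul_cancel] at this
  exact (inv_mul_eq_one.1 this)

/-- After right translation by `g(x)⁻¹` the path lies near `x` in the chart at `1` and solves `w' =
rightField(w) A`, so its regularity can be raised step by step up to one more than that of `A`. -/
theorem contMDiffOn_of_hasRLD {g : ℝ → G} {A : ℝ → E} {n : ℕ} (hA : ContDiffOn ℝ n A (Icc 0 1))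
    (hg : ∀ t ∈ Icc (0 : ℝ) 1, HasRLD g (A t) (Icc 0 1) t) :
    ContMDiffOn 𝓘(ℝ, ℝ) 𝓘(ℝ, E) ((n + 1 : ℕ) : WithTop ℕ∞) g (Icc 0 1) := by
  intro x hx
  obtain ⟨V, hV, hxV, hVs⟩ := eventually_nhdsWithin_iff.1 (HasUnitVel.eventually_mem (hg x hx))
    |> fun h => (eventually_nhds_iff.1 h) |> fun ⟨V, h1, h2, h3⟩ => (⟨V, h2, h3, h1⟩ :
      ∃ V : Set ℝ, IsOpen V ∧ x ∈ V ∧ ∀ y ∈ V, y ∈ Icc (0 : ℝ) 1 →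
        g y * (g x)⁻¹ ∈ (oneChart (E := E) G).source)
  set J := Icc (0 : ℝ) 1 ∩ V with hJ
  have hJu : UniqueDiffOn ℝ J := (uniqueDiffOn_Icc zero_lt_one).inter hV
  set w : ℝ → E := fun τ => oneChart (E := E) G (g τ * (g x)⁻¹) with hw
  have hmem : ∀ τ ∈ J, w τ ∈ (oneChart (E := E) G).target := fun τ hτ =>
    (oneChart (E := E) G).map_source (hVs τ hτ.2 hτ.1)
  have hd : ∀ τ ∈ J, HasDerivWithinAt w (rightField G (w τ) (A τ)) J τ := fun τ hτ =>
    (((hg τ hτ.1).mul_const (g x)⁻¹).hasDerivWithinAt_oneChart (hVs τ hτ.2 hτ.1)).mono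
      inter_subset_left
  have hw' : ∀ m : ℕ, m ≤ n + 1 → ContDiffOn ℝ m w J := by
    intro m
    induction m with
    | zero => exact fun _ => contDiffOn_zero.2 fun τ hτ => (hd τ hτ).continuousWithinAt
    | succ m ih =>
      intro hm
      push_cast
      refine (contDiffOn_succ_iff_derivWithin hJu).2
        ⟨fun τ hτ => (hd τ hτ).differentiableWithinAt, fun h => absurd h (by simp), ?_⟩
      have h1 : ContDiffOn ℝ m (fun τ => rightField (E := E) G (w τ) (A τ)) J := by
        refine ContDiffOn.clm_apply (fun τ hτ => ?_)
          ((hA.of_le (by exact_mod_cast Nat.le_of_succ_le_succ hm)).mono inter_subset_left)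
        exact ((contDiffAt_rightField (hmem τ hτ)).of_le
          (by exact_mod_cast le_top)).comp_contDiffWithinAt τ (ih (by omega) τ hτ)
      exact h1.congr fun τ hτ => (hd τ hτ).derivWithin (hJu τ hτ)
  have hxJ : x ∈ J := ⟨hx, hxV⟩
  have h2 : ContMDiffWithinAt 𝓘(ℝ, ℝ) 𝓘(ℝ, E) ((n + 1 : ℕ) : WithTop ℕ∞)
      (fun τ => (oneChart (E := E) G).symm (w τ) * g x) J x := by
    refine ContMDiffWithinAt.mul (I := 𝓘(ℝ, E)) ?_ contMDiffWithinAt_const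
    exact ((contMDiffAt_oneChart_symm G (hmem x hxJ)).of_le
      (by exact_mod_cast le_top)).comp_contMDiffWithinAt x
        (hw' (n + 1) le_rfl x hxJ).contMDiffWithinAt
  have h3 : ContMDiffWithinAt 𝓘(ℝ, ℝ) 𝓘(ℝ, E) ((n + 1 : ℕ) : WithTop ℕ∞) g J x :=
    h2.congr (fun τ hτ => by
      simp [hw, (oneChart (E := E) G).left_inv (hVs τ hτ.2 hτ.1)])
      (by simp [hw])
  exact (contMDiffWithinAt_inter (hV.mem_nhds hxV)).1 h3

end RLD

theorem hasUnitVel_of_hasMFDerivWithinAt {f : ℝ → G} {s : Set ℝ} {t : ℝ} (hf : f t = 1)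
    {T : ℝ →L[ℝ] E} (h : HasMFDerivWithinAt 𝓘(ℝ, ℝ) 𝓘(ℝ, E) f s t T) :
    HasUnitVel f (T 1) s t := by
  refine ⟨hf, h.1, ?_⟩
  have h3 : HasFDerivWithinAt (writtenInExtChartAt 𝓘(ℝ, ℝ) 𝓘(ℝ, E) t f) T
    ((extChartAt 𝓘(ℝ, ℝ) t).symm ⁻¹' s ∩ range 𝓘(ℝ, ℝ)) (extChartAt 𝓘(ℝ, ℝ) t t) := h.2
  simp only [writtenInExtChartAt, hf, modelWithCornersSelf_coe, range_id,
    extChartAt_model_space_eq_id, PartialEquiv.refl_symm, PartialEquiv.refl_coe, preimage_id,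
    inter_univ, Function.comp_id, id] at h3
  exact h3.hasDerivWithinAt

theorem hasRLD_rightLogDeriv [LieGroup 𝓘(ℝ, E) ∞ G] {g : ℝ → G} {n : WithTop ℕ∞} (hn : n ≠ 0)
    (hn' : n ≤ ∞)
    (hg : ContMDiffOn 𝓘(ℝ, ℝ) 𝓘(ℝ, E) n g (Icc 0 1)) {t : ℝ} (ht : t ∈ Icc (0 : ℝ) 1) :
    HasRLD g (rightLogDeriv g t : E) (Icc 0 1) t := by
  have : LieGroup 𝓘(ℝ, E) n G := LieGroup.of_le hn'
  have h1 : MDifferentiableWithinAt 𝓘(ℝ, ℝ) 𝓘(ℝ, E) (fun s => g s * (g t)⁻¹) (Icc 0 1) t :=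
    ((hg t ht).mul (I := 𝓘(ℝ, E)) contMDiffWithinAt_const).mdifferentiableWithinAt hn
  exact hasUnitVel_of_hasMFDerivWithinAt (f := fun s => g s * (g t)⁻¹) (by simp)
    h1.hasMFDerivWithinAt

end LogDerivative

/-! ### Development of paths in the Lie algebra -/

section Development

/-- `contDiff_postcomp` requires a function which is smooth on the whole space, whereas `rightField`
is controlled only on the target of the chart; a bump function mediates. -/
theorem exists_contDiff_eventuallyEq {E F : Type*} [NormedAddCommGroup E] [NormedSpace ℝ E]
    [FiniteDimensional ℝ E] [NormedAddCommGroup F] [NormedSpace ℝ F] {f : E → F} {O : Set E}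
    (hO : IsOpen O) (hf : ∀ x ∈ O, ContDiffAt ℝ ∞ f x) {e : E} (he : e ∈ O) :
    ∃ g : E → F, ContDiff ℝ ∞ g ∧ g =ᶠ[𝓝 e] f := by
  obtain ⟨R, hR, hRO⟩ := Metric.nhds_basis_closedBall.mem_iff.1 (hO.mem_nhds he)
  let b : ContDiffBump e := ⟨R / 2, R, by positivity, by linarith⟩
  refine ⟨fun x => b x • f x, contDiff_iff_contDiffAt.2 fun x => ?_, ?_⟩
  · by_cases hx : x ∈ Metric.closedBall e R
    · exact b.contDiff.contDiffAt.smul (hf x (hRO hx))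
    · have h1 : (fun x => b x • f x) =ᶠ[𝓝 x] fun _ => 0 := by
        filter_upwards [Metric.isClosed_closedBall.isOpen_compl.mem_nhds hx] with y hy
        have : b y = 0 := b.zero_of_le_dist (by
          simpa using (not_le.1 (fun h => hy (Metric.mem_closedBall.2 h))).le)
        rw [this, zero_smul]
      exact contDiffAt_const.congr_of_eventuallyEq h1
  · filter_upwards [b.eventuallyEq_one] with y hy
    simp [hy]

variable {E : Type u} [NormedAddCommGroup E] [NormedSpace ℝ E] [FiniteDimensional ℝ E]
variable {G : Type v} [TopologicalSpace G] [ChartedSpace E G] [Group G] [LieGroup 𝓘(ℝ, E) ∞ G]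

/-- The shear `(u, A) ↦ (u - ∫ A, A)`. -/
def shearEquiv (E : Type u) [NormedAddCommGroup E] [NormedSpace ℝ E] [CompleteSpace E] :
    (C(unitInterval, E) × C(unitInterval, E)) ≃L[ℝ] (C(unitInterval, E) × C(unitInterval, E)) :=
  ContinuousLinearEquiv.equivOfInverse
    ((ContinuousLinearMap.fst ℝ C(unitInterval, E) C(unitInterval, E) -
      primitive ∘L ContinuousLinearMap.snd ℝ C(unitInterval, E) C(unitInterval, E)).prod
      (ContinuousLinearMap.snd ℝ C(unitInterval, E) C(unitInterval, E)))
    ((ContinuousLinearMap.fst ℝ C(unitInterval, E) C(unitInterval, E) +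
      primitive ∘L ContinuousLinearMap.snd ℝ C(unitInterval, E) C(unitInterval, E)).prod
      (ContinuousLinearMap.snd ℝ C(unitInterval, E) C(unitInterval, E)))
    (fun _ => Prod.ext (sub_add_cancel _ _) rfl) (fun _ => Prod.ext (add_sub_cancel_right _ _) rfl)

variable (E G) in
/-- The solution of `u' = rightField(u) A` in the chart, for small `A`. -/
theorem exists_development_chart : ∃ S : C(unitInterval, E) → C(unitInterval, E),
    ContDiffAt ℝ ∞ S 0 ∧ HasFDerivAt S (haveI := FiniteDimensional.complete ℝ E; primitive) 0 ∧
    S 0 = constPath (oneCoord G) ∧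
    ∀ᶠ A in 𝓝 (0 : C(unitInterval, E)), (∀ t, S A t ∈ (oneChart (E := E) G).target) ∧
      S A 0 = oneCoord G ∧ ∀ t ∈ Icc (0 : ℝ) 1, HasDerivWithinAt (pext (S A))
        (rightField G (pext (S A) t) (pext A t)) (Icc 0 1) t := by
  have := FiniteDimensional.complete ℝ E
  obtain ⟨M, hM, hMe⟩ := exists_contDiff_eventuallyEq (oneChart (E := E) G).open_target
    (fun x hx => contDiffAt_rightField hx) (oneCoord_mem_target (E := E) G)
  let e : E := oneCoord G
  let Mc : C(E, E →L[ℝ] E) := ⟨M, hM.continuous⟩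
  let N : C(unitInterval, E) → C(unitInterval, E →L[ℝ] E) := fun u => Mc.comp u
  have hN : ContDiff ℝ ∞ N := contDiff_postcomp Mc hM
  let Q : C(unitInterval, E) × C(unitInterval, E) → C(unitInterval, E) :=
    fun p => pmul (N p.1) p.2
  have hpm := (pmul (F := E) (F₁ := E)).isBoundedBilinearMap
  have hQ : ContDiff ℝ ∞ Q :=
    hpm.contDiff.comp ((hN.comp contDiff_fst).prodMk contDiff_snd)
  -- `Ψ(u, A) = (0, A)` says that `u = e + ∫ M(u) A`. Keeping `A` as second component makes the
  -- inverse function theorem deliver the implicit solution `u = S(A)`; the derivative at `(e, 0)`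
  -- is the shear.
  let Ψ : C(unitInterval, E) × C(unitInterval, E) → C(unitInterval, E) × C(unitInterval, E) :=
    fun p => (p.1 - constPath e - primitive (Q p), p.2)
  have hΨ : ContDiff ℝ ∞ Ψ :=
    ((contDiff_fst.sub contDiff_const).sub ((primitive (F := E)).contDiff.comp hQ)).prodMk
      contDiff_snd
  have hNe : N (constPath e) = constPath (ContinuousLinearMap.id ℝ E) := by
    refine ContinuousMap.ext fun t => ?_
    change M e = _
    rw [hMe.eq_of_nhds, rightField_oneCoord]
    rfl
  -- `Q` is linear in `A` and the base point has `A = 0`, so the derivative in `u` drops out; in the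
  -- direction of `A` it is multiplication by `M(e) = id`.
  have hQd : HasFDerivAt Q (ContinuousLinearMap.snd ℝ _ _) (constPath e, 0) := by
    have h1 : HasFDerivAt N (fderiv ℝ N (constPath e)) (constPath e) :=
      (hN.differentiable (by simp) _).hasFDerivAt
    have h2 : HasFDerivAt (fun p : C(unitInterval, E) × C(unitInterval, E) => (N p.1, p.2))
        ((fderiv ℝ N (constPath e) ∘L ContinuousLinearMap.fst ℝ _ _).prod
          (ContinuousLinearMap.snd ℝ _ _)) (constPath e, 0) :=
      (HasFDerivAt.comp (f := Prod.fst) (constPath e, (0 : C(unitInterval, E))) h1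
        hasFDerivAt_fst).prodMk hasFDerivAt_snd
    have h3 := (hpm.hasFDerivAt (N (constPath e), (0 : C(unitInterval, E)))).comp
      (constPath e, (0 : C(unitInterval, E))) h2
    refine h3.congr_fderiv ?_
    refine ContinuousLinearMap.ext fun p => ?_
    change pmul (N (constPath e)) p.2 + pmul (fderiv ℝ N (constPath e) p.1) 0 = p.2
    rw [hNe, map_zero, add_zero]
    rfl
  have hΨd : HasFDerivAt Ψ (shearEquiv E : _ →L[ℝ] _) (constPath e, 0) := by
    have h1 : HasFDerivAt Ψ _ (constPath e, 0) := ((hasFDerivAt_fst.sub_const (constPath e)).sub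
      ((primitive (F := E)).hasFDerivAt.comp _ hQd)).prodMk hasFDerivAt_snd
    exact h1
  have hΨs : HasStrictFDerivAt Ψ (shearEquiv E : _ →L[ℝ] _) (constPath e, 0) :=
    hΨ.contDiffAt.hasStrictFDerivAt' hΨd (by simp)
  have hΨ0 : Ψ (constPath e, 0) = (0, 0) := by
    have : Q (constPath e, 0) = 0 := map_zero (pmul (N (constPath e)))
    simp [Ψ, this]
  let H := hΨs.localInverse Ψ (shearEquiv E) (constPath e, 0)
  have hH : ContDiffAt ℝ ∞ H (0, 0) := by
    rw [← hΨ0]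
    exact hΨ.contDiffAt.to_localInverse hΨd (by simp)
  have hHd : HasFDerivAt H ((shearEquiv E).symm : _ →L[ℝ] _) (0, 0) := by
    rw [← hΨ0]
    exact hΨs.to_localInverse.hasFDerivAt
  have hH0 : H (0, 0) = (constPath e, 0) := by
    rw [← hΨ0]
    exact hΨs.localInverse_apply_image
  have hHr : ∀ᶠ y in 𝓝 (0, 0), Ψ (H y) = y := by
    rw [← hΨ0]
    exact hΨs.eventually_right_inverse
  have hin : ContinuousAt (fun A : C(unitInterval, E) => ((0 : C(unitInterval, E)), A)) 0 := by
    fun_prop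
  let S : C(unitInterval, E) → C(unitInterval, E) := fun A => (H (0, A)).1
  have hS : ContDiffAt ℝ ∞ S 0 :=
    contDiffAt_fst.comp (0 : C(unitInterval, E))
      (hH.comp (0 : C(unitInterval, E)) (contDiffAt_const.prodMk contDiffAt_id))
  have hS0 : S 0 = constPath e := by simp only [S, hH0]
  refine ⟨S, hS, ?_, hS0, ?_⟩
  · have h1 := (hasFDerivAt_fst (p := H (0, 0))).comp (0 : C(unitInterval, E))
      (hHd.comp (0 : C(unitInterval, E)) (hasFDerivAt_prodMk_right (0 : C(unitInterval, E)) 0))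
    refine h1.congr_fderiv ?_
    refine ContinuousLinearMap.ext fun A => ?_
    change (0 : C(unitInterval, E)) + primitive A = primitive A
    rw [zero_add]
  -- For small `A` the path `S A` stays where the cut-off field `M` agrees with `rightField` and
  -- inside the target of the chart.
  · obtain ⟨ε, hε, hεM⟩ := Metric.eventually_nhds_iff.1
      (hMe.and ((oneChart (E := E) G).open_target.mem_nhds (oneCoord_mem_target (E := E) G)))
    have h1 : ∀ᶠ A in 𝓝 (0 : C(unitInterval, E)), dist (S A) (constPath e) < ε := by
      have := Metric.continuousAt_iff'.1 hS.continuousAt ε hε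
      rwa [hS0] at this
    filter_upwards [h1, hin.eventually hHr] with A hA hA'
    have h2 : ∀ t, dist (S A t) e < ε := fun t =>
      (ContinuousMap.dist_apply_le_dist (f := S A) (g := constPath e) t).trans_lt hA
    have h3 : (H (0, A)).2 = A := congrArg Prod.snd hA'
    have h4 : S A - constPath e - primitive (Q (H (0, A))) = 0 := congrArg Prod.fst hA'
    have h5 : Q (H (0, A)) = pmul (N (S A)) A := by
      change pmul (N (S A)) (H (0, A)).2 = _
      rw [h3]
    rw [h5, sub_sub, sub_eq_zero] at h4
    refine ⟨fun t => (hεM (h2 t)).2, ?_, fun t ht => ?_⟩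
    · rw [h4]
      change e + primitive (pmul (N (S A)) A) 0 = e
      rw [primitive_zero, add_zero]
    · refine (hasDerivWithinAt_of_eq h4 ht).congr_deriv ?_
      rw [pext_of_mem _ ht, pext_of_mem _ ht, pext_of_mem _ ht, pmul_apply]
      change M (S A ⟨t, ht⟩) _ = _
      rw [(hεM (h2 _)).1]

/-- `h` is the path in the group with `h(0) = 1` and `h' h⁻¹ = A`. -/
def IsDev (A : C(unitInterval, E)) (h : ℝ → G) : Prop :=
  h 0 = 1 ∧ ∀ t ∈ Icc (0 : ℝ) 1, HasRLD h (pext A t) (Icc 0 1) t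

theorem isDev_of_chart {A w : C(unitInterval, E)} (hw : ∀ t, w t ∈ (oneChart (E := E) G).target)
    (h0 : w 0 = oneCoord G) (h : ∀ t ∈ Icc (0 : ℝ) 1, HasDerivWithinAt (pext w)
        (rightField G (pext w t) (pext A t)) (Icc 0 1) t) :
    IsDev A (fun t => (oneChart (E := E) G).symm (pext w t)) := by
  refine ⟨?_, fun t ht => hasRLD_of_hasDerivWithinAt ?_ (h t ht)⟩
  · have : pext w 0 = oneCoord G := (pext_of_mem w (left_mem_Icc.2 zero_le_one)).trans h0
    simp [this]
  · rw [pext_of_mem _ ht]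
    exact hw _

namespace IsDev

variable {A A' : C(unitInterval, E)} {h h' : ℝ → G}

omit [FiniteDimensional ℝ E] in
theorem eqOn [T2Space G] (hh : IsDev A h) (hh' : IsDev A h') : ∀ t ∈ Icc (0 : ℝ) 1, h t = h' t :=
  eqOn_of_hasRLD hh.2 hh'.2 (hh.1.trans hh'.1.symm)

omit [FiniteDimensional ℝ E] in
theorem hasDerivWithinAt (hh : IsDev A h) {t : ℝ} (ht : t ∈ Icc (0 : ℝ) 1) :
    HasDerivWithinAt (fun t => (AdL (h t) : E →L[ℝ] E)) (lieL G (pext A t) ∘L AdL (h t))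
      (Icc 0 1) t := (hh.2 t ht).hasDerivWithinAt_AdL

omit [FiniteDimensional ℝ E] in
theorem hasDerivWithinAt_inv (hh : IsDev A h) {t : ℝ} (ht : t ∈ Icc (0 : ℝ) 1) :
    HasDerivWithinAt (fun t => (AdL (h t)⁻¹ : E →L[ℝ] E))
      (lieL G (-AdL (h t)⁻¹ (pext A t)) ∘L AdL (h t)⁻¹) (Icc 0 1) t :=
  (hh.2 t ht).inv.hasDerivWithinAt_AdL

/-- The path `Ad(h(t))`. -/
def adPath (hh : IsDev A h) : C(unitInterval, E →L[ℝ] E) where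
  toFun t := AdL (h t)
  continuous_toFun := continuousOn_iff_continuous_domRestrict.1 (fun _ ht =>
    (hh.hasDerivWithinAt ht).continuousWithinAt)

/-- The path `Ad(h(t)⁻¹)`. -/
def adInvPath (hh : IsDev A h) : C(unitInterval, E →L[ℝ] E) where
  toFun t := AdL (h t)⁻¹
  continuous_toFun := continuousOn_iff_continuous_domRestrict.1 (fun _ ht =>
    (hh.hasDerivWithinAt_inv ht).continuousWithinAt)

omit [FiniteDimensional ℝ E] in
theorem mul (hh : IsDev A h) (hh' : IsDev A' h') :
    IsDev (A + pmul hh.adPath A') (fun t => h t * h' t) := by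
  refine ⟨by simp only [hh.1, hh'.1, mul_one], fun t ht => ?_⟩
  have := (hh.2 t ht).mul (hh'.2 t ht)
  simp only [pext_of_mem _ ht] at this ⊢
  exact this

end IsDev

variable (E G) in
omit [FiniteDimensional ℝ E] in
theorem isDev_zero : IsDev (0 : C(unitInterval, E)) (fun _ : ℝ => (1 : G)) := by
  refine ⟨rfl, fun t ht => ⟨by simp, continuousWithinAt_const, ?_⟩⟩
  simpa [pext_of_mem _ ht] using hasDerivWithinAt_const t (Icc 0 1) (oneChart (E := E) G (1 * 1⁻¹))

/-- An invariant inner product on the Lie algebra. -/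
structure IsInvariantInner (G : Type v) [TopologicalSpace G] [ChartedSpace E G] [Group G]
    (B : LinearMap.BilinForm ℝ E) : Prop where
  symm : ∀ x y : E, B x y = B y x
  pos : ∀ x : E, x ≠ 0 → 0 < B x x
  inv : ∀ x y z : E, B (lie G x y) z = B x (lie G y z)

/-- A bilinear form as a continuous bilinear map. -/
def bilinL (B : LinearMap.BilinForm ℝ E) : E →L[ℝ] E →L[ℝ] ℝ :=
  LinearMap.toContinuousLinearMap (LinearMap.toContinuousLinearMap.toLinearMap ∘ₗ B)

omit [FiniteDimensional ℝ E] in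
theorem bilinL_apply [FiniteDimensional ℝ E] (B : LinearMap.BilinForm ℝ E) (x y : E) :
    bilinL B x y = B x y := rfl

theorem lieL_neg_swap (x y : E) : lieL G x y = -lieL G y x := by
  rw [lieL, fderiv_AdL, fderiv_AdL, neg_sub]

variable (G) in
theorem lie_eq_lieL (x y : E) : lie G x y = lieL G x y := by
  have := FiniteDimensional.complete ℝ E
  rw [lieL_apply]

theorem lieL_jacobi (x y z : E) :
    lieL G x (lieL G y z) = lieL G (lieL G x y) z + lieL G y (lieL G x z) := by
  have := FiniteDimensional.complete ℝ E
  have : LieGroup 𝓘(ℝ, E) (minSmoothness ℝ 3) G :=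
    LieGroup.of_le (n := ∞) (by
      simp only [minSmoothness_of_isRCLikeNormedField]
      exact WithTop.coe_le_coe.2 (le_top : (3 : ℕ∞) ≤ ⊤))
  simp only [← lie_eq_lieL]
  have key : ∀ a b c : GroupLieAlgebra 𝓘(ℝ, E) G, ⁅a, ⁅b, c⁆⁆ = ⁅⁅a, b⁆, c⁆ + ⁅b, ⁅a, c⁆⁆ :=
    fun a b c => leibniz_lie a b c
  exact key x y z

namespace IsInvariantInner

variable {B : LinearMap.BilinForm ℝ E}

theorem inv' (hB : IsInvariantInner G B) (x y z : E) :
    B (lieL G x y) z = -B y (lieL G x z) := by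
  rw [lieL_neg_swap, map_neg, LinearMap.neg_apply, ← lie_eq_lieL, hB.inv, lie_eq_lieL]

theorem nonneg (hB : IsInvariantInner G B) (x : E) : 0 ≤ B x x := by
  by_cases hx : x = 0
  · simp [hx]
  · exact (hB.pos x hx).le

theorem exists_le (hB : IsInvariantInner G B) :
    ∃ m : ℝ, 0 < m ∧ ∀ x : E, m * ‖x‖ ^ 2 ≤ B x x := by
  have hcont : Continuous fun x : E => B x x := by
    have : Continuous fun x : E => bilinL B x x := by fun_prop
    exact this
  have : ProperSpace E := FiniteDimensional.proper_real E
  rcases (Metric.sphere (0 : E) 1).eq_empty_or_nonempty with h | h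
  · refine ⟨1, one_pos, fun x => ?_⟩
    by_cases hx : x = 0
    · simp [hx]
    · exfalso
      have : ‖x‖⁻¹ • x ∈ Metric.sphere (0 : E) 1 := by
        simp [norm_smul, hx]
      rw [h] at this
      exact this
  · obtain ⟨y, hy, hmin⟩ := (isCompact_sphere (0 : E) 1).exists_isMinOn h hcont.continuousOn
    have hy0 : y ≠ 0 := by
      rintro rfl
      simp at hy
    refine ⟨B y y, hB.pos y hy0, fun x => ?_⟩
    by_cases hx : x = 0
    · simp [hx]
    · have h1 : ‖x‖⁻¹ • x ∈ Metric.sphere (0 : E) 1 := by simp [norm_smul, hx]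
      have h2 : B y y ≤ B (‖x‖⁻¹ • x) (‖x‖⁻¹ • x) := hmin h1
      have h3 : 0 < ‖x‖ := norm_pos_iff.2 hx
      simp only [map_smul, LinearMap.smul_apply, smul_eq_mul] at h2
      calc B y y * ‖x‖ ^ 2 ≤ ‖x‖⁻¹ * (‖x‖⁻¹ * B x x) * ‖x‖ ^ 2 := by gcongr
        _ = B x x := by field_simp

/-- `B` is comparable with the square of the norm, so its isometries have uniformly bounded operator
norm. This makes the step size in `exists_isDev` uniform. -/
theorem exists_norm_le (hB : IsInvariantInner G B) : ∃ C : ℝ, 0 < C ∧ ∀ T : E →L[ℝ] E,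
    (∀ x, B (T x) (T x) = B x x) → ∀ x, ‖T x‖ ≤ C * ‖x‖ := by
  obtain ⟨m, hm, h⟩ := hB.exists_le
  refine ⟨Real.sqrt ((‖bilinL B‖ + 1) / m), by positivity, fun T hT x => ?_⟩
  have h1 : m * ‖T x‖ ^ 2 ≤ (‖bilinL B‖ + 1) * ‖x‖ ^ 2 := by
    refine (h (T x)).trans ?_
    rw [hT x, ← bilinL_apply]
    refine (le_abs_self _).trans (((bilinL B).le_opNorm₂ x x).trans ?_)
    nlinarith [sq_nonneg ‖x‖]
  refine abs_le_of_sq_le_sq' ?_ (by positivity) |>.2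
  rw [mul_pow, Real.sq_sqrt (by positivity), div_mul_eq_mul_div, le_div_iff₀ hm]
  linarith

end IsInvariantInner

namespace IsDev

variable {A A' : C(unitInterval, E)} {h h' : ℝ → G} {B : LinearMap.BilinForm ℝ E}

/-- The derivative in time is `B([A, ·], ·) + B(·, [A, ·]) = 0`. Invariance of `B` is assumed only
infinitesimally, so it is integrated along paths starting at `1`; this suffices, since gauge
transformations start at `1`. -/
theorem bilin_AdL (hh : IsDev A h) (hB : IsInvariantInner G B) {t : ℝ} (ht : t ∈ Icc (0 : ℝ) 1)
    (x y : E) : B (AdL (h t) x) (AdL (h t) y) = B x y := by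
  have key : ∀ t ∈ Icc (0 : ℝ) 1, HasDerivWithinAt
      (fun t => bilinL B (AdL (h t) x) (AdL (h t) y)) 0 (Icc 0 1) t := fun t ht => by
    have hd : ∀ x : E, HasDerivWithinAt (fun t => AdL (h t) x)
        (lieL G (pext A t) (AdL (h t) x)) (Icc 0 1) t := fun x => by
      simpa using (hh.hasDerivWithinAt ht).clm_apply (hasDerivWithinAt_const t (Icc 0 1) x)
    refine ((bilinL B).hasDerivWithinAt_of_bilinear (hd x) (hd y)).congr_deriv ?_
    rw [bilinL_apply, bilinL_apply, hB.inv', add_neg_cancel]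
  have h1 := eq_of_hasDerivWithinAt_eq (f' := fun _ => 0) (g := fun _ => B x y) key
    (fun t _ => hasDerivWithinAt_const t _ _)
    (by simp only [hh.1, AdL_one]; rfl) t ht
  exact h1

/-- By the Jacobi identity both sides solve the linear equation `v' = [A, v]`, and they agree at
time `0`. -/
theorem AdL_lieL (hh : IsDev A h) {t : ℝ} (ht : t ∈ Icc (0 : ℝ) 1) (x y : E) :
    AdL (h t) (lieL G x y) = lieL G (AdL (h t) x) (AdL (h t) y) := by
  have := FiniteDimensional.complete ℝ E
  have hd : ∀ t ∈ Icc (0 : ℝ) 1, ∀ x : E, HasDerivWithinAt (fun t => AdL (h t) x)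
      (lieL G (pext A t) (AdL (h t) x)) (Icc 0 1) t := fun t ht x => by
    simpa using (hh.hasDerivWithinAt ht).clm_apply (hasDerivWithinAt_const t (Icc 0 1) x)
  refine eqOn_of_linear_ode (L := pmap (lieL G) A) (r := fun _ => 0)
    (f := fun t => AdL (h t) (lieL G x y)) (g := fun t => lieL G (AdL (h t) x) (AdL (h t) y))
    (fun t ht => ?_) (fun t ht => ?_) ?_ t ht
  · refine (hd t ht _).congr_deriv ?_
    rw [add_zero, pext_of_mem _ ht, pext_of_mem _ ht]
    rfl
  · refine ((lieL G).hasDerivWithinAt_of_bilinear (hd t ht x) (hd t ht y)).congr_deriv ?_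
    rw [add_zero, pext_of_mem _ ht, pext_of_mem _ ht, pmap_apply,
      lieL_jacobi (A ⟨t, ht⟩) (AdL (h t) x) (AdL (h t) y), add_comm]
  · simp only [hh.1, AdL_one]
    rfl

theorem bilin_AdL_inv (hh : IsDev A h) (hB : IsInvariantInner G B) {t : ℝ}
    (ht : t ∈ Icc (0 : ℝ) 1) (x y : E) : B (AdL (h t)⁻¹ x) (AdL (h t)⁻¹ y) = B x y := by
  rw [← hh.bilin_AdL hB ht, AdL_apply_AdL_inv, AdL_apply_AdL_inv]

theorem pmul_adPath_adInvPath (hh : IsDev A h) (f : C(unitInterval, E)) :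
    pmul hh.adPath (pmul hh.adInvPath f) = f := by
  ext t
  exact AdL_apply_AdL_inv _ _

theorem pmul_adInvPath_adPath (hh : IsDev A h) (f : C(unitInterval, E)) :
    pmul hh.adInvPath (pmul hh.adPath f) = f := by
  ext t
  exact AdL_inv_apply_AdL _ _

end IsDev

/-! ### Global existence of developments and smoothness of the endpoint map. -/

theorem exists_isDev_of_norm_lt (E : Type u) [NormedAddCommGroup E] [NormedSpace ℝ E]
    [FiniteDimensional ℝ E] (G : Type v) [TopologicalSpace G] [ChartedSpace E G] [Group G]
    [LieGroup 𝓘(ℝ, E) ∞ G] :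
    ∃ δ > 0, ∀ A : C(unitInterval, E), ‖A‖ < δ → ∃ h : ℝ → G, IsDev A h := by
  obtain ⟨S, -, -, -, hS⟩ := exists_development_chart E G
  obtain ⟨δ, hδ, h⟩ := Metric.eventually_nhds_iff.1 hS
  refine ⟨δ, hδ, fun A hA => ?_⟩
  obtain ⟨h1, h2, h3⟩ := h (y := A) (by rwa [dist_zero_right])
  exact ⟨_, isDev_of_chart h1 h2 h3⟩

/-- If `h` develops `A'` and `w` develops `Ad(h)⁻¹(A'' - A')`, then `h w` develops `A''`. Since
`Ad(h)` is an isometry of `B`, the size of an admissible step does not depend on `A'`, so `A` is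
reached along the segment from `0` in finitely many steps. -/
theorem exists_isDev {B : LinearMap.BilinForm ℝ E} (hB : IsInvariantInner G B)
    (A : C(unitInterval, E)) : ∃ h : ℝ → G, IsDev A h := by
  obtain ⟨δ, hδ, hsmall⟩ := exists_isDev_of_norm_lt E G
  obtain ⟨C, hC, hCT⟩ := hB.exists_norm_le
  have step : ∀ A' A'' : C(unitInterval, E), ‖A'' - A'‖ < δ / C → (∃ h : ℝ → G, IsDev A' h) →
      ∃ h : ℝ → G, IsDev A'' h := by
    rintro A' A'' hA ⟨h, hh⟩
    obtain ⟨w, hw⟩ := hsmall (pmul hh.adInvPath (A'' - A')) (by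
      rw [ContinuousMap.norm_lt_iff _ hδ]
      intro t
      refine (hCT _ (fun x => hh.bilin_AdL_inv hB t.2 x x) _).trans_lt ?_
      rw [lt_div_iff₀ hC] at hA
      refine lt_of_le_of_lt ?_ hA
      rw [mul_comm]
      gcongr
      exact ContinuousMap.norm_coe_le_norm _ t)
    have := hh.mul hw
    rw [hh.pmul_adPath_adInvPath, add_sub_cancel] at this
    exact ⟨_, this⟩
  -- This number of steps makes each increment `A / n` shorter than the admissible length `δ / C`.
  obtain ⟨n, hn⟩ := exists_nat_gt (‖A‖ / (δ / C))
  have hn0 : (0 : ℝ) < n := lt_of_le_of_lt (by positivity) hn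
  have key : ∀ i : ℕ, ∃ h : ℝ → G, IsDev (((i : ℝ) / n) • A) h := by
    intro i
    induction i with
    | zero => exact ⟨_, by simpa using isDev_zero E G⟩
    | succ i ih =>
      refine step _ _ ?_ ih
      rw [← sub_smul, norm_smul, ← sub_div]
      push_cast
      rw [add_sub_cancel_left, Real.norm_of_nonneg (by positivity), one_div, inv_mul_eq_div,
        div_lt_iff₀ hn0]
      rwa [div_lt_iff₀ (by positivity), mul_comm] at hn
  have h1 := key n
  rwa [div_self hn0.ne', one_smul] at h1

variable (G) in
/-- The path `h` in `G` with `h(0) = 1` and `h' h⁻¹ = A`. -/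
def dev (A : C(unitInterval, E)) : ℝ → G :=
  open scoped Classical in if h : ∃ h : ℝ → G, IsDev A h then h.choose else fun _ => 1

theorem isDev_dev {B : LinearMap.BilinForm ℝ E} (hB : IsInvariantInner G B)
    (A : C(unitInterval, E)) : IsDev A (dev G A) := by
  have h := exists_isDev hB A
  rw [dev, dif_pos h]
  exact h.choose_spec

variable (G) in
/-- The endpoint of the development of a path. -/
def hol (A : C(unitInterval, E)) : G := dev G A 1

theorem hol_eq [T2Space G] {B : LinearMap.BilinForm ℝ E} (hB : IsInvariantInner G B)
    {A : C(unitInterval, E)} {h : ℝ → G} (hh : IsDev A h) : hol G A = h 1 :=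
  (isDev_dev hB A).eqOn hh 1 (right_mem_Icc.2 zero_le_one)

theorem hol_zero [T2Space G] {B : LinearMap.BilinForm ℝ E} (hB : IsInvariantInner G B) :
    hol G (0 : C(unitInterval, E)) = 1 := hol_eq hB (isDev_zero E G)

/-- The endpoint map near a path. -/
theorem hol_eq_mul [T2Space G] {B : LinearMap.BilinForm ℝ E} (hB : IsInvariantInner G B)
    {A : C(unitInterval, E)} {h : ℝ → G} (hh : IsDev A h) (A' : C(unitInterval, E)) :
    hol G A' = h 1 * hol G (pmul hh.adInvPath (A' - A)) := by
  have h1 := hh.mul (isDev_dev hB (pmul hh.adInvPath (A' - A)))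
  rw [hh.pmul_adPath_adInvPath, add_sub_cancel] at h1
  exact hol_eq hB h1

variable (E) in
/-- The value at time `1`. -/
def evalOne : C(unitInterval, E) →L[ℝ] E := ContinuousMap.evalCLM ℝ (M := E) (1 : unitInterval)

theorem hol_zero_chart [T2Space G] {B : LinearMap.BilinForm ℝ E} (hB : IsInvariantInner G B) :
    ∃ S : C(unitInterval, E) → E, ContDiffAt ℝ ∞ S 0 ∧
      HasFDerivAt S (haveI := FiniteDimensional.complete ℝ E; evalOne E ∘L primitive) 0 ∧
      S 0 = oneCoord G ∧ ∀ᶠ A in 𝓝 (0 : C(unitInterval, E)),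
        S A ∈ (oneChart (E := E) G).target ∧ hol G A = (oneChart (E := E) G).symm (S A) := by
  have := FiniteDimensional.complete ℝ E
  obtain ⟨S, h1, h2, h3, h4⟩ := exists_development_chart E G
  refine ⟨fun A => S A 1, (evalOne E).contDiff.contDiffAt.comp _ h1,
    (evalOne E).hasFDerivAt.comp _ h2, by simp only [h3]; rfl, ?_⟩
  filter_upwards [h4] with A hA
  refine ⟨hA.1 1, ?_⟩
  rw [hol_eq hB (isDev_of_chart hA.1 hA.2.1 hA.2.2), pext_of_mem _ (right_mem_Icc.2 zero_le_one)]
  rfl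

/-- If `h` develops `A`, then the endpoint of `A'` is `h(1)` times the endpoint of `Ad(h)⁻¹(A' -
A)`, which reduces the claim to smoothness at `0`. -/
theorem contMDiff_hol [T2Space G] {B : LinearMap.BilinForm ℝ E} (hB : IsInvariantInner G B) :
    ContMDiff 𝓘(ℝ, C(unitInterval, E)) 𝓘(ℝ, E) ∞ (hol G : C(unitInterval, E) → G) := by
  intro A
  obtain ⟨S, h1, -, h3, h4⟩ := hol_zero_chart hB
  have hh := isDev_dev hB A
  let f : C(unitInterval, E) → C(unitInterval, E) := fun A' => pmul hh.adInvPath (A' - A)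
  have hf : ContDiff ℝ ∞ f := (pmul hh.adInvPath).contDiff.comp (contDiff_id.sub contDiff_const)
  have hf0 : f A = 0 := by
    change pmul hh.adInvPath (A - A) = 0
    rw [sub_self, map_zero]
  have h5 : ContDiffAt ℝ ∞ (S ∘ f) A := by
    refine ContDiffAt.comp A ?_ hf.contDiffAt
    rwa [hf0]
  have h6 : (S ∘ f) A ∈ (oneChart (E := E) G).target := by
    simp only [Function.comp_apply, hf0, h3]
    exact oneCoord_mem_target G
  have h7 : ContMDiffAt 𝓘(ℝ, C(unitInterval, E)) 𝓘(ℝ, E) ∞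
      (fun A' => dev G A 1 * (oneChart (E := E) G).symm ((S ∘ f) A')) A :=
    ContMDiffAt.mul (I := 𝓘(ℝ, E)) contMDiffAt_const
      ((contMDiffAt_oneChart_symm G h6).comp A h5.contMDiffAt)
  refine h7.congr_of_eventuallyEq ?_
  have h8 : ∀ᶠ A' in 𝓝 A, f A' ∈ {A' | hol G A' = (oneChart (E := E) G).symm (S A')} := by
    have : Tendsto f (𝓝 A) (𝓝 0) := by
      have := hf.continuous.continuousAt (x := A)
      rwa [ContinuousAt, hf0] at this
    exact this.eventually (h4.mono fun _ h => h.2)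
  filter_upwards [h8] with A' hA'
  rw [hol_eq_mul hB hh A']
  exact congrArg _ hA'

end Development

/-! ### Logarithmic coordinates -/

section LogChart

variable {E : Type u} [NormedAddCommGroup E] [NormedSpace ℝ E] [FiniteDimensional ℝ E]
  [CompleteSpace E]
variable {G : Type v} [TopologicalSpace G] [ChartedSpace E G] [Group G] [LieGroup 𝓘(ℝ, E) ∞ G]

/-- `L` is a local inverse of the exponential map. -/
structure IsLog (L : OpenPartialHomeomorph G E) : Prop where
  one_mem : (1 : G) ∈ L.source
  map_one : L 1 = 0
  symm_eq : ∀ ξ ∈ L.target, L.symm ξ = hol G (constPath ξ)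
  contMDiffOn : ContMDiffOn 𝓘(ℝ, E) 𝓘(ℝ, E) ∞ L L.source
  hasFDerivAt : HasFDerivAt (fun A => L (hol G A)) (evalOne E ∘L primitive) 0

theorem evalOne_primitive_constPath (ξ : E) : evalOne E (primitive (constPath ξ)) = ξ := by
  change primitive (constPath ξ) 1 = ξ
  rw [primitive_apply]
  have : pext (constPath ξ) = fun _ => ξ := rfl
  rw [this, intervalIntegral.integral_const]
  simp

/-- The endpoint of a constant path is the exponential map. The derivative of the endpoint map at
`0` is `A ↦ ∫₀¹ A`, so that of the exponential is the identity, and the inverse function theorem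
applies. -/
theorem exists_isLog [T2Space G] {B : LinearMap.BilinForm ℝ E} (hB : IsInvariantInner G B) :
    ∃ L : OpenPartialHomeomorph G E, IsLog L := by
  obtain ⟨S, hS, hSd, hS0, hSe⟩ := hol_zero_chart hB
  let c := oneChart (E := E) G
  let f : E → E := fun ξ => c (hol G (constPath ξ))
  have hhol : ContMDiff 𝓘(ℝ, E) 𝓘(ℝ, E) ∞ (fun ξ : E => hol G (constPath ξ)) :=
    (contMDiff_hol hB).comp (constPath (F := E)).contDiff.contMDiff
  have hcS : ∀ᶠ A in 𝓝 (0 : C(unitInterval, E)), c (hol G A) = S A :=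
    hSe.mono fun A hA => by rw [hA.2]; exact c.right_inv hA.1
  have hfS : f =ᶠ[𝓝 0] fun ξ => S (constPath ξ) := by
    have : Tendsto (constPath : E → C(unitInterval, E)) (𝓝 0) (𝓝 0) := by
      have := (constPath (F := E)).continuous.tendsto 0
      rwa [map_zero] at this
    exact this.eventually hcS
  let W : Set E := {ξ | hol G (constPath ξ) ∈ c.source}
  have hW : IsOpen W := c.open_source.preimage hhol.continuous
  have hfW : ∀ ξ ∈ W, ContDiffAt ℝ ∞ f ξ := fun ξ hξ =>
    contDiffAt_oneChart_comp le_rfl (hhol ξ) hξ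
  have h0W : (0 : E) ∈ W := by
    change hol G (constPath (0 : E)) ∈ c.source
    rw [map_zero, hol_zero hB]
    exact one_mem_source G
  have hf0 : f 0 = oneCoord G := by
    change c (hol G (constPath (0 : E))) = _
    rw [map_zero, hol_zero hB]
    rfl
  have hfd : HasFDerivAt f ((ContinuousLinearEquiv.refl ℝ E : E ≃L[ℝ] E) : E →L[ℝ] E) 0 := by
    have h1 : HasFDerivAt S (evalOne E ∘L primitive) (constPath (0 : E)) := by
      rwa [map_zero]
    refine ((h1.comp (0 : E) (constPath (F := E)).hasFDerivAt).congr_of_eventuallyEq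
      hfS).congr_fderiv ?_
    refine ContinuousLinearMap.ext fun ξ => evalOne_primitive_constPath ξ
  let e := (hfW 0 h0W).toOpenPartialHomeomorph f hfd (by simp)
  have he : (e : E → E) = f := rfl
  -- Restricting to points with invertible derivative makes the inverse smooth on its whole domain,
  -- not just near the image of `0`.
  let O : Set E := {ξ ∈ W | fderiv ℝ f ξ ∈ range ((↑) : (E ≃L[ℝ] E) → E →L[ℝ] E)}
  have hO : IsOpen O := by
    have h1 : ContinuousOn (fderiv ℝ f) W := fun ξ hξ =>
      (((hfW ξ hξ).fderiv_right (m := ∞) (by simp)).continuousAt).continuousWithinAt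
    exact h1.isOpen_inter_preimage hW ContinuousLinearEquiv.isOpen
  have h0O : (0 : E) ∈ O := ⟨h0W, by rw [hfd.fderiv]; exact ⟨_, rfl⟩⟩
  let e' := e.restrOpen O hO
  have he' : e'.source ⊆ O := fun ξ hξ => hξ.2
  have he's : ∀ a ∈ e'.target, ContDiffAt ℝ ∞ e'.symm a := by
    intro a ha
    have h1 := e'.map_target ha
    obtain ⟨T, hT⟩ := (he' h1).2
    refine e'.contDiffAt_symm (f₀' := T) ha ?_ (hfW _ (he' h1).1)
    rw [hT]
    exact ((hfW _ (he' h1).1).differentiableAt (by simp)).hasFDerivAt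
  have h0e : (0 : E) ∈ e'.source :=
    ⟨(hfW 0 h0W).mem_toOpenPartialHomeomorph_source hfd (by simp), h0O⟩
  have he'0 : e' 0 = oneCoord G := hf0
  have h1t : oneCoord G ∈ e'.target := he'0 ▸ e'.map_source h0e
  have he'1 : e'.symm (oneCoord G) = 0 := by rw [← he'0, e'.left_inv h0e]
  refine ⟨c.trans e'.symm, ?_, he'1, fun ξ hξ => ?_, ?_, ?_⟩
  · rw [OpenPartialHomeomorph.trans_source]
    exact ⟨one_mem_source G, h1t⟩
  · rw [OpenPartialHomeomorph.trans_target] at hξ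
    exact c.left_inv (he' hξ.1).1
  · intro g hg
    rw [OpenPartialHomeomorph.trans_source] at hg
    have h1 : ContMDiffAt 𝓘(ℝ, E) 𝓘(ℝ, E) ∞ c g :=
      contMDiffAt_of_mem_maximalAtlas (IsManifold.chart_mem_maximalAtlas (1 : G)) hg.1
    exact ((he's _ hg.2).contMDiffAt.comp g h1).contMDiffWithinAt
  · have h1 : HasFDerivAt e'.symm
        (((ContinuousLinearEquiv.refl ℝ E).symm : E ≃L[ℝ] E) : E →L[ℝ] E) (S 0) := by
      rw [hS0]
      refine e'.hasFDerivAt_symm h1t ?_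
      rw [he'1]
      exact hfd
    have h2 := (h1.comp (0 : C(unitInterval, E)) hSd)
    refine (h2.congr_of_eventuallyEq ?_).congr_fderiv ?_
    · filter_upwards [hcS] with A hA
      change e'.symm (c (hol G A)) = e'.symm (S A)
      rw [hA]
    · rfl

end LogChart

/-! ### The Nahm equations as a quadratic Volterra equation -/

section Nahm

variable {E : Type u} [NormedAddCommGroup E] [NormedSpace ℝ E] [FiniteDimensional ℝ E]
  [CompleteSpace E]
variable (G : Type v) [TopologicalSpace G] [ChartedSpace E G] [Group G] [LieGroup 𝓘(ℝ, E) ∞ G]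

theorem octF_zero_mid (i l : Fin 8) : octF i 0 l = 0 := by revert i l; decide

theorem octF_zero_right (i j : Fin 8) : octF i j 0 = 0 := by revert i j; decide

theorem octF_swap (i j l : Fin 8) : octF i l j = -octF i j l := by revert i j l; decide

variable {G} in
-- The structure constants vanish when an index is `0`, so the cross product does not see the zeroth
-- components.
theorem cross_congr {x y x' y' : Fin 8 → E} (hx : ∀ i ≠ 0, x i = x' i) (hy : ∀ i ≠ 0, y i = y' i)
    (i : Fin 8) : cross G x y i = cross G x' y' i := by
  unfold cross
  congr 1
  refine Finset.sum_congr rfl fun j _ => Finset.sum_congr rfl fun l _ => ?_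
  by_cases hj : j = 0
  · rw [hj, octF_zero_mid]
    simp
  by_cases hl : l = 0
  · rw [hl, octF_zero_right]
    simp
  rw [hx j hj, hy l hl]

variable {G} in
-- The antisymmetries of the structure constants and of the bracket cancel.
theorem cross_swap (x y : Fin 8 → E) (i : Fin 8) : cross G x y i = cross G y x i := by
  unfold cross
  congr 1
  rw [Finset.sum_comm]
  refine Finset.sum_congr rfl fun j _ => Finset.sum_congr rfl fun l _ => ?_
  rw [octF_swap, lie_eq_lieL, lie_eq_lieL, lieL_neg_swap]
  push_cast
  rw [neg_smul_neg]

variable {G} in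
theorem map_cross {T : E →L[ℝ] E} (hT : ∀ x y, T (lieL G x y) = lieL G (T x) (T y))
    (x y : Fin 8 → E) (i : Fin 8) :
    T (cross G x y i) = cross G (fun i => T (x i)) (fun i => T (y i)) i := by
  simp only [cross, lie_eq_lieL, map_smul, map_sum, hT]

variable (E) in
/-- The quadratic term of the Nahm equations. -/
def nahmB : (Fin 8 → E) →L[ℝ] (Fin 8 → E) →L[ℝ] (Fin 8 → E) :=
  LinearMap.toContinuousLinearMap (LinearMap.toContinuousLinearMap.toLinearMap ∘ₗ
    LinearMap.mk₂ ℝ (fun x y i => if i = 0 then 0 else lie G (x 0) (y i) + cross G x y i)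
      (fun x y z => by
        ext i
        by_cases hi : i = 0
        · simp [hi]
        · simp only [hi, if_false, Pi.add_apply, (lie_bilin G).1, cross_add_left]
          abel)
      (fun c x y => by
        ext i
        by_cases hi : i = 0
        · simp [hi]
        · simp only [hi, if_false, Pi.smul_apply, (lie_bilin G).2.2.1, cross_smul_left, smul_add])
      (fun x y z => by
        ext i
        by_cases hi : i = 0
        · simp [hi]
        · simp only [hi, if_false, Pi.add_apply, (lie_bilin G).2.1, cross_add_right]
          abel)
      (fun c x y => by
        ext i
        by_cases hi : i = 0
        · simp [hi]
        · simp only [hi, if_false, Pi.smul_apply, (lie_bilin G).2.2.2, cross_smul_right,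
            smul_add]))

theorem nahmB_apply (x y : Fin 8 → E) (i : Fin 8) :
    nahmB E G x y i = if i = 0 then 0 else lie G (x 0) (y i) + cross G x y i := rfl

variable (E) in
/-- The inclusion of the `0`-th slot. -/
def inj0 : E →L[ℝ] (Fin 8 → E) := ContinuousLinearMap.single ℝ (fun _ : Fin 8 => E) 0

variable (E) in
/-- The projection to the `0`-th slot. -/
def proj0 : (Fin 8 → E) →L[ℝ] E := ContinuousLinearMap.proj 0

variable (E) in
/-- The projection which kills the `0`-th slot. -/
def kill0 : (Fin 8 → E) →L[ℝ] (Fin 8 → E) :=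
  ContinuousLinearMap.id ℝ (Fin 8 → E) - inj0 E ∘L proj0 E

@[simp] theorem proj0_apply (x : Fin 8 → E) : proj0 E x = x 0 := rfl

@[simp] theorem inj0_zero (x : E) : inj0 E x 0 = x := by simp [inj0]

theorem inj0_of_ne (x : E) {i : Fin 8} (hi : i ≠ 0) : inj0 E x i = 0 := by simp [inj0, hi]

@[simp] theorem kill0_zero (x : Fin 8 → E) : kill0 E x 0 = 0 := by simp [kill0]

theorem kill0_of_ne (x : Fin 8 → E) {i : Fin 8} (hi : i ≠ 0) : kill0 E x i = x i := by
  simp [kill0, inj0_of_ne _ hi]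

theorem inj0_add_kill0 (x : Fin 8 → E) : inj0 E (x 0) + kill0 E x = x := by simp [kill0]

theorem kill0_eq_iff {x y : Fin 8 → E} : kill0 E x = kill0 E y ↔ ∀ i ≠ 0, x i = y i := by
  constructor
  · intro h i hi
    rw [← kill0_of_ne x hi, h, kill0_of_ne y hi]
  · intro h
    ext i
    by_cases hi : i = 0
    · rw [hi, kill0_zero, kill0_zero]
    · rw [kill0_of_ne _ hi, kill0_of_ne _ hi, h i hi]

/-- The right-hand side of the Volterra form of the Nahm equations. -/
def nahmDatum (A : C(unitInterval, E)) (y : Fin 8 → E) : C(unitInterval, Fin 8 → E) :=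
  pmap (inj0 E) A + constPath (kill0 E y)

variable {G}

/-- The quadratic term has no zeroth component, so the zeroth slot of the Volterra equation merely
prescribes `X₀ = A`, while the other slots are the Nahm equations with their initial values in
integrated form. -/
theorem quadVolterra_nahmB_iff {x : C(unitInterval, Fin 8 → E)} {A : C(unitInterval, E)}
    {y : Fin 8 → E} : quadVolterra (nahmB E G) x = nahmDatum A y ↔
      pmap (proj0 E) x = A ∧ kill0 E (x 0) = kill0 E y ∧ ∀ t ∈ Icc (0 : ℝ) 1,
        HasDerivWithinAt (fun t => kill0 E (pext x t))
          (-nahmB E G (pext x t) (pext x t)) (Icc 0 1) t := by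
  have hb : ∀ z : C(unitInterval, Fin 8 → E), ∀ t : unitInterval,
      pmap (kill0 E) (primitive (pointwise (nahmB E G) z z)) = primitive (pointwise (nahmB E G) z z) ∧
      pmap (proj0 E) (primitive (pointwise (nahmB E G) z z)) = 0 := by
    intro z t
    have h0 : pmap (proj0 E) (primitive (pointwise (nahmB E G) z z)) = 0 := by
      ext t
      change proj0 E (∫ s in (0 : ℝ)..t, pext (pointwise (nahmB E G) z z) s) = 0
      rw [← ContinuousLinearMap.intervalIntegral_comp_comm _
        ((continuous_pext _).intervalIntegrable _ _)]
      have : ∀ s : ℝ, proj0 E (pext (pointwise (nahmB E G) z z) s) = 0 := fun s => rfl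
      simp [this]
    refine ⟨?_, h0⟩
    ext1 t
    have h1 : primitive (pointwise (nahmB E G) z z) t 0 = 0 :=
      congrArg (fun f : C(unitInterval, E) => f t) h0
    have h2 := inj0_add_kill0 (primitive (pointwise (nahmB E G) z z) t)
    rw [h1, map_zero, zero_add] at h2
    exact h2
  constructor
  · intro h
    have h1 : pmap (proj0 E) x = A := by
      have := congrArg (pmap (proj0 E)) h
      rw [quadVolterra, map_add, (hb x 0).2, add_zero] at this
      rw [this]
      ext t
      change (inj0 E (A t) + kill0 E y) 0 = A t
      simp
    have h2 : pmap (kill0 E) x = constPath (kill0 E y) + primitive (-pointwise (nahmB E G) x x) := by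
      have := congrArg (pmap (kill0 E)) h
      rw [quadVolterra, map_add, (hb x 0).1] at this
      rw [map_neg, ← sub_eq_add_neg, eq_sub_iff_add_eq, this]
      ext t i
      change kill0 E (inj0 E (A t) + kill0 E y) i = kill0 E y i
      by_cases hi : i = 0
      · simp [hi]
      · rw [kill0_of_ne _ hi, Pi.add_apply, inj0_of_ne _ hi, zero_add]
    refine ⟨h1, ?_, fun t ht => ?_⟩
    · have := congrArg (fun f : C(unitInterval, Fin 8 → E) => f 0) h2
      change kill0 E (x 0) = kill0 E y + primitive _ 0 at this
      rwa [primitive_zero, add_zero] at this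
    · exact hasDerivWithinAt_of_eq h2 ht
  · rintro ⟨h1, h2, h3⟩
    have h4 : pmap (kill0 E) x = constPath (kill0 E (x 0)) + primitive (-pointwise (nahmB E G) x x) :=
      eq_const_add_primitive h3
    rw [map_neg, ← sub_eq_add_neg, eq_sub_iff_add_eq] at h4
    have h5 : x = pmap (inj0 E) A + pmap (kill0 E) x := by
      rw [← h1]
      ext1 t
      exact (inj0_add_kill0 (x t)).symm
    rw [nahmDatum, quadVolterra, ← h2, ← h4]
    nth_rewrite 1 [h5]
    rw [add_assoc]

variable {k : ℕ∞}

theorem isSolution_iff (hk : 1 ≤ k) {X : CkPath k (Fin 8 → E)} : IsSolution G X ↔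
    quadVolterra (nahmB E G) X.1 = nahmDatum (pmap (proj0 E) X.1) (X.1 0) := by
  rw [quadVolterra_nahmB_iff]
  have hd := fun t (ht : t ∈ Icc (0 : ℝ) 1) => hasDerivWithinAt_pi.1 (X.hasDerivWithinAt_ext hk ht)
  constructor
  · intro h
    refine ⟨rfl, rfl, fun t ht => hasDerivWithinAt_pi.2 fun i => ?_⟩
    by_cases hi : i = 0
    · subst hi
      simp only [kill0_zero, Pi.neg_apply, nahmB_apply, if_true, neg_zero]
      exact hasDerivWithinAt_const _ _ _
    · simp only [kill0_of_ne _ hi, Pi.neg_apply, nahmB_apply, hi, if_false]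
      refine (hd t ht i).congr_deriv ?_
      have := h t ht i hi
      rw [add_assoc] at this
      exact eq_neg_of_add_eq_zero_left this
  · rintro ⟨-, -, h⟩ t ht i hi
    have h1 := hasDerivWithinAt_pi.1 (h t ht) i
    simp only [kill0_of_ne _ hi, Pi.neg_apply, nahmB_apply, hi, if_false] at h1
    rw [(uniqueDiffOn_Icc zero_lt_one t ht).eq_deriv _ (hd t ht i) h1, add_assoc]
    exact neg_add_cancel _

/-! ### Solutions with prescribed zeroth component and initial values. -/

namespace Solution

/-- The component `X₀` of a solution. -/
def zeroPath (X : Solution E G k) : C(unitInterval, E) := pmap (proj0 E) X.1.1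

/-- The initial values `X_i(0)`, `i = 1, …, 7`. -/
def init (X : Solution E G k) : Fin 8 → E := kill0 E (X.1.1 0)

theorem quadVolterra_eq (hk : 1 ≤ k) (X : Solution E G k) :
    quadVolterra (nahmB E G) X.1.1 = nahmDatum X.zeroPath (X.1.1 0) := (isSolution_iff hk).1 X.2

theorem nahmDatum_init (A : C(unitInterval, E)) (y : Fin 8 → E) :
    nahmDatum A (kill0 E y) = nahmDatum A y := by
  rw [nahmDatum, nahmDatum]
  congr 2
  rw [kill0_eq_iff]
  exact fun i hi => kill0_of_ne _ hi

theorem ext_of_eq (hk : 1 ≤ k) {X Y : Solution E G k} (h0 : X.zeroPath = Y.zeroPath)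
    (hi : X.init = Y.init) : X = Y := by
  refine Subtype.ext (Subtype.ext (quadVolterra_injective (nahmB E G) ?_))
  rw [X.quadVolterra_eq hk, Y.quadVolterra_eq hk, h0, ← nahmDatum_init, ← nahmDatum_init _ (Y.1.1 0)]
  exact congrArg _ hi

theorem smoothInto_zeroPath {P : Type*} [NormedAddCommGroup P] [NormedSpace ℝ P] {U : Set P}
    (X : Solution E G k) {j : ℕ} (hj : (j : ℕ∞) ≤ k) :
    SmoothInto j U (fun _ : P => X.zeroPath) := (X.1.smoothInto_const hj).map _

section Family

variable {P : Type*} [NormedAddCommGroup P] [NormedSpace ℝ P] {U : Set P}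
  {A : P → C(unitInterval, E)} {y : P → Fin 8 → E}

theorem smoothInto_nahmDatum {j : ℕ} (hA : SmoothInto j U A) (hy : ContDiffOn ℝ ∞ y U) :
    SmoothInto j U (fun p => nahmDatum (A p) (y p)) :=
  (hA.map (inj0 E)).add (SmoothInto.const ((kill0 E).contDiff.comp_contDiffOn hy))

variable (G) in
-- Smooth dependence in the uniform norm comes from the inverse function theorem, and
-- `SmoothInto.of_quadVolterra` upgrades it to the `C^j` norm.
theorem smoothInto_quadSolve {j : ℕ} (hA : SmoothInto j U A) (hy : ContDiffOn ℝ ∞ y U)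
    (hU : ∀ p ∈ U, nahmDatum (A p) (y p) ∈ range (quadVolterra (nahmB E G))) :
    SmoothInto j U (fun p => quadSolve (nahmB E G) (nahmDatum (A p) (y p))) := by
  have hd := smoothInto_nahmDatum hA hy
  refine SmoothInto.of_quadVolterra (b := nahmB E G) (fun p hp => ?_) hd
    fun p hp => quadVolterra_quadSolve _ (hU p hp)
  obtain ⟨x, hx⟩ := hU p hp
  have h1 := contDiffAt_quadSolve (nahmB E G) x (n := ∞) (by simp)
  rw [hx] at h1
  exact h1.comp_contDiffWithinAt p (hd.contDiffOn p hp)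

variable (G) in
theorem quadSolve_mem (hA : ∀ j : ℕ, (j : ℕ∞) ≤ k → SmoothInto j U A) (hy : ContDiffOn ℝ ∞ y U)
    (hU : ∀ p ∈ U, nahmDatum (A p) (y p) ∈ range (quadVolterra (nahmB E G))) {p : P} (hp : p ∈ U) :
    quadSolve (nahmB E G) (nahmDatum (A p) (y p)) ∈ ckSubmodule k (Fin 8 → E) :=
  CkPath.mem_ckSubmodule (fun j hj => smoothInto_quadSolve G (hA j hj) hy hU) hp

theorem isSolution_quadSolve (hk : 1 ≤ k) {A : C(unitInterval, E)} {y : Fin 8 → E}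
    (hd : nahmDatum A y ∈ range (quadVolterra (nahmB E G)))
    (h : quadSolve (nahmB E G) (nahmDatum A y) ∈ ckSubmodule k (Fin 8 → E)) :
    IsSolution (k := k) G (⟨quadSolve (nahmB E G) (nahmDatum A y), h⟩ : ckSubmodule k (Fin 8 → E)) := by
  have h1 := quadVolterra_nahmB_iff.1 (quadVolterra_quadSolve _ hd)
  refine (isSolution_iff hk).2 ((quadVolterra_quadSolve _ hd).trans ?_)
  change _ = nahmDatum (pmap (proj0 E) (quadSolve (nahmB E G) (nahmDatum A y))) _
  rw [h1.1]
  exact (nahmDatum_init A y).symm.trans ((congrArg _ h1.2.1.symm).trans (nahmDatum_init A _))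

open scoped Classical in
/-- The solution with given `0`-th component and initial values, if it exists, and `X` otherwise. -/
def ofDatum (X : Solution E G k) (A : C(unitInterval, E)) (y : Fin 8 → E) : Solution E G k :=
  if h : ∃ Y : Solution E G k, Y.zeroPath = A ∧ Y.init = kill0 E y then h.choose else X

variable {X : Solution E G k}

theorem ofDatum_val (hk : 1 ≤ k) (hA : ∀ j : ℕ, (j : ℕ∞) ≤ k → SmoothInto j U A)
    (hy : ContDiffOn ℝ ∞ y U)
    (hU : ∀ p ∈ U, nahmDatum (A p) (y p) ∈ range (quadVolterra (nahmB E G))) {p : P} (hp : p ∈ U) :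
    (ofDatum X (A p) (y p)).1.1 = quadSolve (nahmB E G) (nahmDatum (A p) (y p)) ∧
    (ofDatum X (A p) (y p)).zeroPath = A p ∧ (ofDatum X (A p) (y p)).init = kill0 E (y p) := by
  have h1 := quadVolterra_nahmB_iff.1 (quadVolterra_quadSolve _ (hU p hp))
  have hex : ∃ Y : Solution E G k, Y.zeroPath = A p ∧ Y.init = kill0 E (y p) :=
    ⟨⟨⟨_, quadSolve_mem G hA hy hU hp⟩, isSolution_quadSolve hk (hU p hp) _⟩, h1.1, h1.2.1⟩
  have h2 : (ofDatum X (A p) (y p)).zeroPath = A p ∧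
      (ofDatum X (A p) (y p)).init = kill0 E (y p) := by
    rw [ofDatum, dif_pos hex]
    exact hex.choose_spec
  refine ⟨?_, h2⟩
  apply quadVolterra_injective (nahmB E G)
  rw [quadVolterra_quadSolve _ (hU p hp), quadVolterra_eq hk, h2.1, ← nahmDatum_init _ (y p), ← h2.2,
    init, nahmDatum_init]

theorem smoothFamilyOn_ofDatum (hk : 1 ≤ k) (hA : ∀ j : ℕ, (j : ℕ∞) ≤ k → SmoothInto j U A)
    (hy : ContDiffOn ℝ ∞ y U)
    (hU : ∀ p ∈ U, nahmDatum (A p) (y p) ∈ range (quadVolterra (nahmB E G))) :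
    SmoothFamilyOn (fun p => ofDatum X (A p) (y p)) U := fun j hj =>
  CkPath.contDiffOn_iterDeriv (c := fun p => (ofDatum X (A p) (y p)).1) hj
    ((smoothInto_quadSolve G (hA j hj) hy hU).congr fun _ hp => (ofDatum_val hk hA hy hU hp).1)

end Family

end Solution

end Nahm

/-! ### Gauge transformations -/

section Gauge

variable {E : Type u} [NormedAddCommGroup E] [NormedSpace ℝ E] [FiniteDimensional ℝ E]
  [CompleteSpace E]
variable {G : Type v} [TopologicalSpace G] [ChartedSpace E G] [Group G] [LieGroup 𝓘(ℝ, E) ∞ G]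
variable {B : LinearMap.BilinForm ℝ E} {k : ℕ∞}

namespace Solution

/-- The endpoint of the path `h` with `h(0) = 1` and `h' h⁻¹ = -X₀`. -/
def hol (X : Solution E G k) : G := OctNahm.hol G (-X.zeroPath)

theorem isDev_dev (hB : IsInvariantInner G B) (X : Solution E G k) :
    IsDev (-X.zeroPath) (dev G (-X.zeroPath)) := OctNahm.isDev_dev hB _

theorem contDiffOn_zeroPath (X : Solution E G k) : ContDiffOn ℝ k (pext X.zeroPath) (Icc 0 1) :=
  (proj0 E).contDiff.comp_contDiffOn X.1.contDiffOn_ext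

end Solution

theorem IsDev.contMDiffOn {A : C(unitInterval, E)} {h : ℝ → G} (hh : IsDev A h)
    (hA : ContDiffOn ℝ k (pext A) (Icc 0 1)) :
    ContMDiffOn 𝓘(ℝ, ℝ) 𝓘(ℝ, E) ((k + 1 : ℕ∞) : WithTop ℕ∞) h (Icc 0 1) := by
  induction k using ENat.recTopCoe with
  | top =>
    refine contMDiffOn_infty.2 fun n => ?_
    exact (contMDiffOn_of_hasRLD (n := n) (hA.of_le (by exact_mod_cast le_top)) hh.2).of_le
      (by exact_mod_cast Nat.le_succ n)
  | coe n => exact contMDiffOn_of_hasRLD hA hh.2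

/-- A gauge transformation is the development of its own logarithmic derivative `r`. The formula for
`Y₀` gives `r = Ad(g) X₀ - Y₀`, so `r` is a continuous path. -/
theorem GaugeRel.exists_isDev {X Y : Solution E G k} (h : GaugeRel X Y) :
    ∃ (r : C(unitInterval, E)) (g : ℝ → G), IsDev r g ∧ g 1 = 1 ∧ ∀ t : unitInterval,
      Y.1.1 t 0 = AdL (g t) (X.1.1 t 0) - r t ∧ ∀ i ≠ 0, Y.1.1 t i = AdL (g t) (X.1.1 t i) := by
  obtain ⟨g, hg, hg0, hg1, hgX⟩ := h
  have h1 : ∀ t ∈ Icc (0 : ℝ) 1, HasRLD g (rightLogDeriv g t : E) (Icc 0 1) t := fun t ht =>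
    hasRLD_rightLogDeriv (by simp) (by exact_mod_cast le_top) hg ht
  let T : C(unitInterval, E →L[ℝ] E) := ⟨fun t => AdL (g t),
    continuousOn_iff_continuous_domRestrict.1 (fun t ht =>
      (h1 t ht).hasDerivWithinAt_AdL.continuousWithinAt)⟩
  have h2 : ∀ t : unitInterval, Y.1.1 t 0 = AdL (g t) (X.1.1 t 0) - rightLogDeriv g t := fun t => by
    have := (hgX t t.2).1
    rwa [Ad_eq_AdL, CkPath.ext_eq_pext, CkPath.ext_eq_pext, pext_coe, pext_coe] at this
  have h3 : ∀ t : unitInterval, (pmul T X.zeroPath - Y.zeroPath) t = rightLogDeriv g t := fun t => by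
    change AdL (g t) (X.1.1 t 0) - Y.1.1 t 0 = _
    rw [h2, sub_sub_cancel]
  refine ⟨pmul T X.zeroPath - Y.zeroPath, g, ⟨hg0, fun t ht => ?_⟩, hg1, fun t => ⟨?_, ?_⟩⟩
  · rw [pext_of_mem _ ht, h3]
    exact h1 t ht
  · rw [h3, h2]
  · intro i hi
    have := (hgX t t.2).2 i hi
    rwa [Ad_eq_AdL, CkPath.ext_eq_pext, CkPath.ext_eq_pext, pext_coe, pext_coe] at this

variable [T2Space G]

/-- If `h` develops `-X₀`, then `g h` develops `r - Ad(g) X₀ = -Y₀`. The condition `g(1) = 1`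
preserves the endpoint, and `g(0) = 1` preserves the initial values. -/
theorem GaugeRel.hol_eq (hB : IsInvariantInner G B) {X Y : Solution E G k}
    (h : GaugeRel X Y) : X.hol = Y.hol ∧ X.init = Y.init := by
  obtain ⟨r, g, hg, hg1, hXY⟩ := h.exists_isDev
  constructor
  · have h1 := hg.mul (X.isDev_dev hB)
    have h2 : r + pmul hg.adPath (-X.zeroPath) = -Y.zeroPath := by
      ext t
      change r t + AdL (g t) (-X.1.1 t 0) = -Y.1.1 t 0
      rw [(hXY t).1, map_neg]
      abel
    rw [h2] at h1
    have h3 : Y.hol = _ := OctNahm.hol_eq hB h1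
    rw [h3]
    change _ = g 1 * X.hol
    rw [hg1, one_mul]
  · refine kill0_eq_iff.2 fun i hi => ?_
    have h4 := (hXY 0).2 i hi
    have h5 : g ((0 : unitInterval) : ℝ) = 1 := hg.1
    rw [h5, AdL_one] at h4
    exact h4.symm

/-- The quotient of the developments of `-A` and `-X₀` is a gauge transformation carrying `X₀` to
`A`, and it is trivial at time `1` exactly because the holonomies agree. Besides the related
solution this shows that the Nahm equations with zeroth component `A` are solvable up to time `1`.
-/
theorem exists_gaugeRel (hB : IsInvariantInner G B) (hk : 1 ≤ k) (X : Solution E G k)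
    {A : C(unitInterval, E)} (hA : A ∈ ckSubmodule k E) (hAX : hol G (-A) = X.hol) :
    nahmDatum A X.init ∈ range (quadVolterra (nahmB E G)) ∧
    ∃ Y : Solution E G k, GaugeRel X Y ∧ Y.zeroPath = A ∧ Y.init = X.init := by
  have hX := X.isDev_dev hB
  have hAd := isDev_dev hB (-A)
  set hx := dev G (-X.zeroPath)
  set ha := dev G (-A)
  let g : ℝ → G := fun t => ha t * (hx t)⁻¹
  let r : C(unitInterval, E) := pmul hAd.adPath (pmul hX.adInvPath X.zeroPath) - A
  have hg : IsDev r g := by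
    refine ⟨by simp only [g, hX.1, hAd.1, inv_one, mul_one], fun t ht => ?_⟩
    have h1 := (hAd.2 t ht).mul (hX.2 t ht).inv
    have h2 : pext (-A) t + AdL (ha t) (-AdL (hx t)⁻¹ (pext (-X.zeroPath) t)) = pext r t := by
      rw [pext_of_mem _ ht, pext_of_mem _ ht, pext_of_mem _ ht]
      change -A ⟨t, ht⟩ + AdL (ha t) (-AdL (hx t)⁻¹ (-X.zeroPath ⟨t, ht⟩)) =
        AdL (ha t) (AdL (hx t)⁻¹ (X.zeroPath ⟨t, ht⟩)) - A ⟨t, ht⟩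
      rw [map_neg, map_neg, map_neg, neg_neg]
      abel
    rwa [h2] at h1
  have hgAd : ∀ t : unitInterval, ∀ x : E, AdL (g t) x = AdL (ha t) (AdL (hx t)⁻¹ x) := fun t x => by
    simp only [g, AdL_mul]
    rfl
  have hA0 : ∀ t : unitInterval, A t = AdL (g t) (X.1.1 t 0) - r t := fun t => by
    change _ = _ - (AdL (ha t) (AdL (hx t)⁻¹ (X.1.1 t 0)) - A t)
    rw [hgAd, sub_sub_cancel]
  -- This is the gauge transform of `X`, so far only as a continuous path.
  let w : C(unitInterval, Fin 8 → E) := ⟨fun t i => if i = 0 then A t else AdL (g t) (X.1.1 t i), by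
    refine continuous_pi fun i => ?_
    by_cases hi : i = 0
    · simp only [hi, if_true]
      exact A.continuous
    · simp only [hi, if_false]
      exact (pmul hg.adPath (pmap (ContinuousLinearMap.proj i) X.1.1)).continuous⟩
  have hw0 : ∀ t, w t 0 = A t := fun _ => rfl
  have hwi : ∀ t, ∀ i ≠ 0, w t i = AdL (g t) (X.1.1 t i) := fun t i hi => if_neg hi
  have hX' := (quadVolterra_nahmB_iff.1 (X.quadVolterra_eq hk)).2.2
  have hw : quadVolterra (nahmB E G) w = nahmDatum A X.init := by
    refine quadVolterra_nahmB_iff.2 ⟨?_, ?_, fun t ht => hasDerivWithinAt_pi.2 fun i => ?_⟩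
    · ext t
      exact hw0 t
    · rw [Solution.init, kill0_eq_iff]
      intro i hi
      have h5 : g ((0 : unitInterval) : ℝ) = 1 := hg.1
      rw [hwi 0 i hi, kill0_of_ne _ hi, h5, AdL_one]
      rfl
    · by_cases hi : i = 0
      · subst hi
        simp only [kill0_zero, Pi.neg_apply, nahmB_apply, if_true, neg_zero]
        exact hasDerivWithinAt_const _ _ _
      · have h1 := hasDerivWithinAt_pi.1 (hX' t ht) i
        simp only [kill0_of_ne _ hi, Pi.neg_apply, nahmB_apply, hi, if_false] at h1 ⊢
        have h2 := (hg.hasDerivWithinAt ht).clm_apply h1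
        refine (h2.congr (fun s hs => ?_) ?_).congr_deriv ?_
        · rw [pext_of_mem _ hs, pext_of_mem _ hs, hwi _ i hi]
        · rw [pext_of_mem _ ht, pext_of_mem _ ht, hwi _ i hi]
        · rw [pext_of_mem _ ht, pext_of_mem _ ht, pext_of_mem _ ht]
          set τ : unitInterval := ⟨t, ht⟩
          -- Transporting `[X₀, X_i]` by `Ad(g)` gives `[A + r, w_i]`. The excess `[r, w_i]` is
          -- cancelled by the term from differentiating `Ad(g)`.
          have h3 : AdL (g t) (X.1.1 τ 0) = A τ + r τ := by
            rw [hA0 τ]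
            exact (sub_add_cancel _ _).symm
          rw [map_neg, map_add, map_cross (fun x y => hg.AdL_lieL ht x y), hw0, hwi τ i hi,
            lie_eq_lieL, lie_eq_lieL, hg.AdL_lieL ht, h3,
            cross_congr (x' := w τ) (y' := w τ) (fun j hj => (hwi τ j hj).symm)
              (fun j hj => (hwi τ j hj).symm)]
          simp only [ContinuousLinearMap.comp_apply, map_add, add_apply]
          change lieL G (r τ) (AdL (g t) _) + _ = -(lieL G (A τ) (AdL (g t) _) + _)
          abel
  refine ⟨⟨w, hw⟩, ?_⟩
  -- Since `w` solves the Volterra equation with a `C^k` datum, it is itself of class `C^k`; a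
  -- constant family is used to quote this.
  have hfam := Solution.ofDatum_val (P := ℝ) (U := univ) (X := X) (A := fun _ => A)
    (y := fun _ => X.init) hk (fun j hj => (CkPath.smoothInto_const (⟨A, hA⟩ : ckSubmodule k E) hj))
    contDiffOn_const (fun _ _ => ⟨w, hw⟩) (mem_univ 0)
  rw [← hw, quadSolve_quadVolterra] at hfam
  have hgs : ContMDiffOn 𝓘(ℝ, ℝ) 𝓘(ℝ, E) ((k + 1 : ℕ∞) : WithTop ℕ∞) g (Icc 0 1) := by
    have h1 := hAd.contMDiffOn (k := k) (ContDiffOn.neg hA)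
    have h2 := hX.contMDiffOn (k := k) X.contDiffOn_zeroPath.neg
    have : LieGroup 𝓘(ℝ, E) ((k + 1 : ℕ∞) : WithTop ℕ∞) G := LieGroup.of_le (n := ∞)
      (by exact_mod_cast le_top)
    exact ContMDiffOn.mul (I := 𝓘(ℝ, E)) h1 (ContMDiffOn.inv h2)
  refine ⟨_, ⟨g, hgs, hg.1, ?_, fun t ht => ⟨?_, fun i hi => ?_⟩⟩, hfam.2.1, ?_⟩
  · change ha 1 * (hx 1)⁻¹ = 1
    rw [mul_inv_eq_one]
    exact hAX
  · have hr : (rightLogDeriv g t : E) = r ⟨t, ht⟩ := by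
      rw [← pext_of_mem r ht]
      exact (hasRLD_rightLogDeriv (by simp) (by exact_mod_cast le_top) hgs ht).unique (hg.2 t ht)
        (uniqueDiffOn_Icc zero_lt_one t ht)
    rw [Ad_eq_AdL, CkPath.ext_eq_pext, CkPath.ext_eq_pext, pext_of_mem _ ht, pext_of_mem _ ht,
      hfam.1, hw0, hr]
    exact hA0 ⟨t, ht⟩
  · rw [Ad_eq_AdL, CkPath.ext_eq_pext, CkPath.ext_eq_pext, pext_of_mem _ ht, pext_of_mem _ ht,
      hfam.1, hwi _ i hi]
  · rw [hfam.2.2, Solution.init, kill0_eq_iff]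
    exact fun i hi => kill0_of_ne _ hi

/-- For the converse, transform `X` to zeroth component `Y₀`; the result has the same zeroth
component and initial values as `Y`, so it is `Y`. -/
theorem gaugeRel_iff (hB : IsInvariantInner G B) (hk : 1 ≤ k) {X Y : Solution E G k} :
    GaugeRel X Y ↔ X.hol = Y.hol ∧ X.init = Y.init := by
  refine ⟨fun h => h.hol_eq hB, fun ⟨h1, h2⟩ => ?_⟩
  obtain ⟨-, Z, hZ, hZ0, hZi⟩ := exists_gaugeRel hB hk X (A := Y.zeroPath) Y.contDiffOn_zeroPath
    h1.symm
  rwa [← Solution.ext_of_eq hk hZ0 (hZi.trans h2)]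

/-- The quotient is by the equivalence relation generated by `GaugeRel`; equality of holonomies and
initial values is already an equivalence relation, so nothing is added. -/
theorem proj_eq_iff (hB : IsInvariantInner G B) (hk : 1 ≤ k) {X Y : Solution E G k} :
    proj X = proj Y ↔ X.hol = Y.hol ∧ X.init = Y.init := by
  constructor
  · intro h
    have h1 := Quot.eqvGen_exact h
    induction h1 with
    | rel X Y hr => exact hr.hol_eq hB
    | refl X => exact ⟨rfl, rfl⟩
    | symm X Y _ ih => exact ⟨(ih (Quot.eqvGen_sound ‹_›)).1.symm, (ih (Quot.eqvGen_sound ‹_›)).2.symm⟩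
    | trans X Y Z h1 h2 ih1 ih2 =>
      have h1 := ih1 (Quot.eqvGen_sound h1)
      have h2 := ih2 (Quot.eqvGen_sound h2)
      exact ⟨h1.1.trans h2.1, h1.2.trans h2.2⟩
  · exact fun h => Quot.sound ((gaugeRel_iff hB hk).2 h)

end Gauge

/-! ### Charts of the moduli space -/

section Charts

variable {E : Type u} [NormedAddCommGroup E] [NormedSpace ℝ E] [FiniteDimensional ℝ E]
  [CompleteSpace E]
variable {G : Type v} [TopologicalSpace G] [ChartedSpace E G] [Group G] [LieGroup 𝓘(ℝ, E) ∞ G]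
variable {B : LinearMap.BilinForm ℝ E} {k : ℕ∞}

instance {F : Type*} [NormedAddCommGroup F] [NormedSpace ℝ F] :
    NormedAddCommGroup ((F →L[ℝ] F) →L[ℝ] (F →L[ℝ] F)) :=
  ContinuousLinearMap.toNormedAddCommGroup

instance {F : Type*} [NormedAddCommGroup F] [NormedSpace ℝ F] :
    NormedSpace ℝ ((F →L[ℝ] F) →L[ℝ] (F →L[ℝ] F)) :=
  ContinuousLinearMap.toNormedSpace

/-- `Ad(h)` solves the linear equation `T' = [A, T ·]` with `T(0) = id`, so it has one more
derivative than `A`. -/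
theorem IsDev.smoothInto_adPath {A : C(unitInterval, E)} {h : ℝ → G} (hh : IsDev A h)
    {P : Type*} [NormedAddCommGroup P] [NormedSpace ℝ P] {U : Set P} {j : ℕ}
    (hA : SmoothInto j U (fun _ : P => A)) : SmoothInto (j + 1) U (fun _ : P => hh.adPath) := by
  let C : E →L[ℝ] (E →L[ℝ] E) →L[ℝ] (E →L[ℝ] E) :=
    (ContinuousLinearMap.compL ℝ E E E) ∘L lieL G
  refine SmoothInto.of_volterra (L := fun _ => pmap (-C) A) contDiffOn_const (hA.map (-C))
    (SmoothInto.const (x := fun _ => ContinuousLinearMap.id ℝ E) contDiffOn_const) fun p _ => ?_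
  have h1 : hh.adPath = constPath (hh.adPath 0) + primitive (pmul (pmap C A) hh.adPath) := by
    refine eq_const_add_primitive fun t ht => ?_
    refine ((hh.hasDerivWithinAt ht).congr (fun s hs => ?_) ?_).congr_deriv ?_
    · rw [pext_of_mem _ hs]; rfl
    · rw [pext_of_mem _ ht]; rfl
    · rw [pext_of_mem _ ht, pext_of_mem _ ht]; rfl
  have h2 : hh.adPath 0 = ContinuousLinearMap.id ℝ E := by
    change AdL (h 0) = _
    rw [hh.1, AdL_one]
  rw [h2] at h1
  have h3 : volterra (pmap (-C) A) hh.adPath = -primitive (pmul (pmap C A) hh.adPath) := by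
    have : pmap (-C) A = -pmap C A := rfl
    rw [this, volterra_neg]
    rfl
  rw [h3, ← sub_eq_add_neg, sub_eq_iff_eq_add]
  exact h1

/-! ### Slices through a solution. -/

namespace Solution

/-- The variation `ξ ↦ Ad(h) ξ` of the component `X₀`, where `h' h⁻¹ = -X₀`. -/
def adConst (hB : IsInvariantInner G B) (X : Solution E G k) : E →L[ℝ] C(unitInterval, E) :=
  pmul (X.isDev_dev hB).adPath ∘L constPath

/-- The components `X₀` of the solutions in a slice through `X`. -/
def sliceZero (hB : IsInvariantInner G B) (X : Solution E G k) (p : Fin 8 → E) :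
    C(unitInterval, E) := X.zeroPath - X.adConst hB (p 0)

/-- The parameters of the slice through `X`. -/
def sliceDom (hB : IsInvariantInner G B) (X : Solution E G k) : Set (Fin 8 → E) :=
  {p | nahmDatum (X.sliceZero hB p) p ∈ range (quadVolterra (nahmB E G))}

/-- A slice through the solution `X`. -/
def slice (hB : IsInvariantInner G B) (X : Solution E G k) (p : Fin 8 → E) : Solution E G k :=
  ofDatum X (X.sliceZero hB p) p

theorem kill0_init (X : Solution E G k) : kill0 E X.init = X.init := by
  rw [init, kill0_eq_iff]
  exact fun i hi => kill0_of_ne _ hi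

theorem smoothInto_sliceZero (hB : IsInvariantInner G B) (X : Solution E G k)
    {U : Set (Fin 8 → E)} {j : ℕ} (hj : (j : ℕ∞) ≤ k) : SmoothInto j U (X.sliceZero hB) := by
  have h0 := X.smoothInto_zeroPath (P := Fin 8 → E) (U := U) hj
  refine h0.sub ?_
  exact ((X.isDev_dev hB).smoothInto_adPath h0.neg).of_succ.bilinear
    (SmoothInto.const (x := fun p : Fin 8 → E => p 0) (proj0 E).contDiff.contDiffOn)
    (ContinuousLinearMap.id ℝ (E →L[ℝ] E))

theorem isOpen_sliceDom (hB : IsInvariantInner G B) (X : Solution E G k) :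
    IsOpen (X.sliceDom hB) := by
  refine (isOpen_range_quadVolterra (nahmB E G)).preimage ?_
  have h1 := smoothInto_nahmDatum (U := univ) (X.smoothInto_sliceZero hB (j := 0) (by simp))
    (contDiffOn_id (𝕜 := ℝ) (n := ∞))
  exact continuousOn_univ.1 (SmoothInto.contDiffOn h1).continuousOn

theorem slice_spec (hB : IsInvariantInner G B) (hk : 1 ≤ k) (X : Solution E G k) {p : Fin 8 → E}
    (hp : p ∈ X.sliceDom hB) :
    (X.slice hB p).1.1 = quadSolve (nahmB E G) (nahmDatum (X.sliceZero hB p) p) ∧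
    (X.slice hB p).zeroPath = X.sliceZero hB p ∧ (X.slice hB p).init = kill0 E p :=
  ofDatum_val (U := X.sliceDom hB) (A := X.sliceZero hB) (y := id) hk
    (fun _ hj => X.smoothInto_sliceZero hB hj) contDiffOn_id (fun _ h => h) hp

theorem smoothFamilyOn_slice (hB : IsInvariantInner G B) (hk : 1 ≤ k) (X : Solution E G k) :
    SmoothFamilyOn (X.slice hB) (X.sliceDom hB) :=
  smoothFamilyOn_ofDatum (U := X.sliceDom hB) (A := X.sliceZero hB) (y := id) hk
    (fun _ hj => X.smoothInto_sliceZero hB hj) contDiffOn_id (fun _ h => h)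

/-- The variation `Ad(h) ξ` is chosen so that pulling it back by `Ad(h)⁻¹` leaves the constant path
`ξ`, whose endpoint is `exp ξ`. -/
theorem hol_sliceZero [T2Space G] (hB : IsInvariantInner G B) (X : Solution E G k)
    (p : Fin 8 → E) :
    OctNahm.hol G (-X.sliceZero hB p) = X.hol * OctNahm.hol G (constPath (p 0)) := by
  have h := hol_eq_mul hB (X.isDev_dev hB) (-X.sliceZero hB p)
  have h1 : -X.sliceZero hB p - -X.zeroPath = pmul (X.isDev_dev hB).adPath (constPath (p 0)) := by
    rw [sliceZero, adConst, ContinuousLinearMap.comp_apply]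
    abel
  rw [h1, IsDev.pmul_adInvPath_adPath] at h
  exact h

theorem hol_slice [T2Space G] (hB : IsInvariantInner G B) (hk : 1 ≤ k) (X : Solution E G k)
    {p : Fin 8 → E} (hp : p ∈ X.sliceDom hB) :
    (X.slice hB p).hol = X.hol * OctNahm.hol G (constPath (p 0)) := by
  rw [← hol_sliceZero hB, ← (X.slice_spec hB hk hp).2.1]
  rfl

theorem slice_init (hB : IsInvariantInner G B) (hk : 1 ≤ k) (X : Solution E G k) :
    X.init ∈ X.sliceDom hB ∧ X.slice hB X.init = X := by
  have h0 : X.sliceZero hB X.init = X.zeroPath := by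
    rw [sliceZero, init, kill0_zero, map_zero, sub_zero]
  have h1 : X.init ∈ X.sliceDom hB := by
    change nahmDatum (X.sliceZero hB X.init) X.init ∈ range (quadVolterra (nahmB E G))
    rw [h0, init, nahmDatum_init, ← X.quadVolterra_eq hk]
    exact mem_range_self _
  have h2 := X.slice_spec hB hk h1
  refine ⟨h1, ext_of_eq hk (h2.2.1.trans h0) (h2.2.2.trans ?_)⟩
  exact X.kill0_init

theorem continuous_hol [T2Space G] (hB : IsInvariantInner G B) :
    Continuous (hol : Solution E G k → G) := by
  refine (contMDiff_hol hB).continuous.comp (Continuous.neg ?_)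
  exact (pmap (proj0 E)).continuous.comp (CkPath.continuous_val.comp continuous_subtype_val)

theorem continuous_init : Continuous (init : Solution E G k → Fin 8 → E) :=
  (kill0 E).continuous.comp ((continuous_eval_const (0 : unitInterval)).comp
    (CkPath.continuous_val.comp continuous_subtype_val))

theorem continuousOn_of_smoothFamilyOn {P : Type*} [NormedAddCommGroup P] [NormedSpace ℝ P]
    {c : P → Solution E G k} {U : Set P} (hc : SmoothFamilyOn c U) : ContinuousOn c U := by
  have h1 : ContinuousOn (fun p => (c p).1) U :=
    CkPath.continuousOn_of_iterDeriv fun j hj => (hc j hj).continuousOn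
  exact continuousOn_iff_continuous_domRestrict.2
    ((continuousOn_iff_continuous_domRestrict.1 h1).subtype_mk _)

theorem contDiffOn_val {P : Type*} [NormedAddCommGroup P] [NormedSpace ℝ P]
    {c : P → Solution E G k} {U : Set P} (hc : SmoothFamilyOn c U) :
    ContDiffOn ℝ ∞ (fun p => (c p).1.1) U :=
  (hc 0 (by simp)).congr fun p _ => ((c p).1.iterDeriv_zero _).symm

end Solution

theorem continuous_proj : Continuous (proj : Solution E G k → Moduli E G k) := continuous_quot_mk

/-! ### Holonomy and initial values as coordinates of the moduli space. -/

namespace Moduli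

/-- The holonomy of a point of the moduli space. -/
def hol (q : Moduli E G k) : G := (Quot.out q : Solution E G k).hol

/-- The initial values of a point of the moduli space. -/
def init (q : Moduli E G k) : Fin 8 → E := (Quot.out q : Solution E G k).init

theorem proj_out (q : Moduli E G k) : proj (Quot.out q : Solution E G k) = q := Quot.out_eq q

variable [T2Space G]

theorem hol_proj (hB : IsInvariantInner G B) (hk : 1 ≤ k) (X : Solution E G k) :
    hol (proj X) = X.hol := ((proj_eq_iff hB hk).1 (proj_out (proj X))).1

theorem init_proj (hB : IsInvariantInner G B) (hk : 1 ≤ k) (X : Solution E G k) :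
    init (proj X) = X.init := ((proj_eq_iff hB hk).1 (proj_out (proj X))).2

omit [T2Space G] in
theorem kill0_init (q : Moduli E G k) : kill0 E q.init = q.init := Solution.kill0_init _

theorem ext_of_eq (hB : IsInvariantInner G B) (hk : 1 ≤ k) {p q : Moduli E G k}
    (h : p.hol = q.hol) (h' : p.init = q.init) : p = q := by
  rw [← proj_out p, ← proj_out q]
  exact (proj_eq_iff hB hk).2 ⟨h, h'⟩

theorem continuous_hol (hB : IsInvariantInner G B) (hk : 1 ≤ k) :
    Continuous (hol : Moduli E G k → G) :=
  isQuotientMap_quot_mk.continuous_iff.2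
    ((Solution.continuous_hol hB).congr fun X => (hol_proj hB hk X).symm)

theorem continuous_init (hB : IsInvariantInner G B) (hk : 1 ≤ k) :
    Continuous (init : Moduli E G k → Fin 8 → E) :=
  isQuotientMap_quot_mk.continuous_iff.2
    (Solution.continuous_init.congr fun X => (init_proj hB hk X).symm)

omit [T2Space G] in
theorem chart_zero (ξ : E) (q : Moduli E G k) : (inj0 E ξ + q.init) 0 = ξ := by
  rw [Pi.add_apply, inj0_zero, ← kill0_init, kill0_zero, add_zero]

theorem kill0_inj0 (ξ : E) : kill0 E (inj0 E ξ) = 0 := by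
  ext i
  by_cases hi : i = 0
  · simp [hi]
  · rw [kill0_of_ne _ hi, inj0_of_ne _ hi]
    rfl

/-- A representative of `q` and the slice path with `ξ = log(X.hol⁻¹ q.hol)` have the same holonomy.
By `exists_gaugeRel` the representative can be moved to this zeroth component, so the slice meets
the class `q`. -/
theorem mem_sliceDom (hB : IsInvariantInner G B) (hk : 1 ≤ k) {L : OpenPartialHomeomorph G E}
    (hL : IsLog L) {X : Solution E G k} {q : Moduli E G k} (hq : X.hol⁻¹ * q.hol ∈ L.source) :
    inj0 E (L (X.hol⁻¹ * q.hol)) + q.init ∈ X.sliceDom hB := by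
  have h2 := exists_gaugeRel hB hk (Quot.out q : Solution E G k)
    (A := X.sliceZero hB (inj0 E (L (X.hol⁻¹ * q.hol)) + q.init))
    (CkPath.mem_ckSubmodule (fun j hj => X.smoothInto_sliceZero hB (U := univ) hj) (mem_univ _)) (by
      rw [Solution.hol_sliceZero, chart_zero, ← hL.symm_eq _ (L.map_source hq), L.left_inv hq,
        mul_inv_cancel_left]
      rfl)
  have h3 := h2.1
  change nahmDatum _ _ ∈ range (quadVolterra (nahmB E G))
  rw [← Solution.nahmDatum_init, map_add, kill0_inj0, zero_add, kill0_init]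
  exact h3

/-- The chart of the moduli space at the solution `X`. -/
def chart (hB : IsInvariantInner G B) (hk : 1 ≤ k) {L : OpenPartialHomeomorph G E} (hL : IsLog L)
    (X : Solution E G k) : OpenPartialHomeomorph (Moduli E G k) (Fin 8 → E) where
  toFun q := inj0 E (L (X.hol⁻¹ * q.hol)) + q.init
  invFun p := proj (X.slice hB p)
  source := {q | X.hol⁻¹ * q.hol ∈ L.source}
  target := {p | p 0 ∈ L.target} ∩ X.sliceDom hB
  map_source' q hq := ⟨by
    rw [mem_ofPred_eq, chart_zero]
    exact L.map_source hq, mem_sliceDom hB hk hL hq⟩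
  map_target' p hp := by
    change X.hol⁻¹ * hol _ ∈ L.source
    rw [hol_proj hB hk, X.hol_slice hB hk hp.2, inv_mul_cancel_left,
      ← hL.symm_eq _ hp.1]
    exact L.map_target hp.1
  left_inv' q hq := by
    have h1 := mem_sliceDom hB hk hL hq
    have h2 := X.slice_spec hB hk h1
    refine ext_of_eq hB hk ?_ ?_
    · rw [hol_proj hB hk, X.hol_slice hB hk h1, chart_zero, ← hL.symm_eq _ (L.map_source hq),
        L.left_inv hq, mul_inv_cancel_left]
    · rw [init_proj hB hk, h2.2.2, map_add, kill0_init, kill0_inj0, zero_add]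
  right_inv' p hp := by
    have h1 := X.slice_spec hB hk hp.2
    rw [hol_proj hB hk, init_proj hB hk, X.hol_slice hB hk hp.2,
      inv_mul_cancel_left, ← hL.symm_eq _ hp.1, L.right_inv hp.1, h1.2.2]
    exact inj0_add_kill0 p
  open_source := by
    have : IsTopologicalGroup G := topologicalGroup_of_lieGroup 𝓘(ℝ, E) ∞
    exact L.open_source.preimage (continuous_const.mul (continuous_hol hB hk))
  open_target := (L.open_target.preimage (continuous_apply 0)).inter (X.isOpen_sliceDom hB)
  continuousOn_toFun := by
    have : IsTopologicalGroup G := topologicalGroup_of_lieGroup 𝓘(ℝ, E) ∞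
    refine ContinuousOn.add ((inj0 E).continuous.comp_continuousOn ?_)
      (continuous_init hB hk).continuousOn
    exact L.continuousOn.comp (continuous_const.mul (continuous_hol hB hk)).continuousOn
      fun q hq => hq
  continuousOn_invFun := continuous_proj.comp_continuousOn
    ((Solution.continuousOn_of_smoothFamilyOn (X.smoothFamilyOn_slice hB hk)).mono inter_subset_right)

end Moduli

end Charts

/-! ### The manifold structure of the moduli space -/

section ManifoldStructure

variable {E : Type u} [NormedAddCommGroup E] [NormedSpace ℝ E] [FiniteDimensional ℝ E]
  [CompleteSpace E]
variable {G : Type v} [TopologicalSpace G] [ChartedSpace E G] [Group G] [LieGroup 𝓘(ℝ, E) ∞ G]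
  [T2Space G]
variable {B : LinearMap.BilinForm ℝ E} {k : ℕ∞}

namespace Solution

variable {P : Type*} [NormedAddCommGroup P] [NormedSpace ℝ P] {c : P → Solution E G k} {U : Set P}

theorem contDiffOn_zeroPath_family (hc : SmoothFamilyOn c U) :
    ContDiffOn ℝ ∞ (fun p => (c p).zeroPath) U :=
  (pmap (proj0 E)).contDiff.comp_contDiffOn (contDiffOn_val hc)

theorem contMDiffOn_hol_family (hB : IsInvariantInner G B) (hc : SmoothFamilyOn c U) :
    ContMDiffOn 𝓘(ℝ, P) 𝓘(ℝ, E) ∞ (fun p => (c p).hol) U :=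
  (contMDiff_hol hB).comp_contMDiffOn (contDiffOn_zeroPath_family hc).neg.contMDiffOn

theorem contDiffOn_init_family (hc : SmoothFamilyOn c U) :
    ContDiffOn ℝ ∞ (fun p => (c p).init) U :=
  ((kill0 E) ∘L ContinuousMap.evalCLM ℝ (M := Fin 8 → E)
    (0 : unitInterval)).contDiff.comp_contDiffOn (contDiffOn_val hc)

end Solution

namespace Moduli

variable {L : OpenPartialHomeomorph G E}

theorem chart_apply (hB : IsInvariantInner G B) (hk : 1 ≤ k) (hL : IsLog L) (X : Solution E G k)
    (q : Moduli E G k) : chart hB hk hL X q = inj0 E (L (X.hol⁻¹ * q.hol)) + q.init := rfl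

theorem mem_chart_source_self (hB : IsInvariantInner G B) (hk : 1 ≤ k) (hL : IsLog L)
    (X : Solution E G k) : proj X ∈ (chart hB hk hL X).source := by
  change X.hol⁻¹ * hol (proj X) ∈ L.source
  rw [hol_proj hB hk, inv_mul_cancel]
  exact hL.one_mem

theorem chart_proj_self (hB : IsInvariantInner G B) (hk : 1 ≤ k) (hL : IsLog L)
    (X : Solution E G k) : chart hB hk hL X (proj X) = X.init := by
  rw [chart_apply, hol_proj hB hk, inv_mul_cancel, hL.map_one, map_zero, zero_add, init_proj hB hk]

theorem contDiffOn_chart_family (hB : IsInvariantInner G B) (hk : 1 ≤ k) (hL : IsLog L)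
    (X : Solution E G k) {P : Type*} [NormedAddCommGroup P] [NormedSpace ℝ P]
    {c : P → Solution E G k} {U : Set P} (hc : SmoothFamilyOn c U)
    (hU : ∀ p ∈ U, proj (c p) ∈ (chart hB hk hL X).source) :
    ContDiffOn ℝ ∞ (fun p => chart hB hk hL X (proj (c p))) U := by
  have hU' : ∀ p ∈ U, X.hol⁻¹ * (c p).hol ∈ L.source := fun p hp => by
    rw [← hol_proj hB hk (c p)]
    exact hU p hp
  have h1 : ContMDiffOn 𝓘(ℝ, P) 𝓘(ℝ, E) ∞ (fun p => L (X.hol⁻¹ * (c p).hol)) U :=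
    hL.contMDiffOn.comp (contMDiffOn_const.mul (I := 𝓘(ℝ, E)) (Solution.contMDiffOn_hol_family hB hc))
      hU'
  refine (((inj0 E).contDiff.comp_contDiffOn (contMDiffOn_iff_contDiffOn.1 h1)).add
    (Solution.contDiffOn_init_family hc)).congr fun p hp => ?_
  rw [chart_apply, hol_proj hB hk, init_proj hB hk]
  rfl

variable {m : ℕ} (Q : (Fin 8 → E) ≃L[ℝ] EuclideanSpace ℝ (Fin m))

/-- The chart at a solution, with values in Euclidean space. -/
def euclideanChart (hB : IsInvariantInner G B) (hk : 1 ≤ k) (hL : IsLog L) (X : Solution E G k) :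
    OpenPartialHomeomorph (Moduli E G k) (EuclideanSpace ℝ (Fin m)) :=
  (chart hB hk hL X).transHomeomorph Q.toHomeomorph

/-- The atlas of the moduli space. -/
@[reducible] def chartedSpace (hB : IsInvariantInner G B) (hk : 1 ≤ k) (hL : IsLog L) :
    ChartedSpace (EuclideanSpace ℝ (Fin m)) (Moduli E G k) where
  atlas := range (euclideanChart Q hB hk hL)
  chartAt q := euclideanChart Q hB hk hL (Quot.out q : Solution E G k)
  mem_chart_source q := by
    have := mem_chart_source_self hB hk hL (Quot.out q : Solution E G k)
    rwa [proj_out] at this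
  chart_mem_atlas q := mem_range_self _

/-- A transition map is a chart evaluated along the smooth family of solutions given by a slice. -/
theorem isManifold (hB : IsInvariantInner G B) (hk : 1 ≤ k) (hL : IsLog L) :
    letI := chartedSpace Q hB hk hL
    IsManifold (𝓡 m) ∞ (Moduli E G k) := by
  let _ := chartedSpace Q hB hk hL
  refine isManifold_of_contDiffOn (𝓡 m) ∞ _ ?_
  rintro _ _ ⟨X, rfl⟩ ⟨Y, rfl⟩
  simp only [modelWithCornersSelf_coe, modelWithCornersSelf_coe_symm, Function.comp_id,
    Function.id_comp, range_id, inter_univ, preimage_id]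
  have h1 : ((euclideanChart Q hB hk hL X).symm.trans (euclideanChart Q hB hk hL Y)).source ⊆
      Q.symm ⁻¹' (X.sliceDom hB ∩ {p | proj (X.slice hB p) ∈ (chart hB hk hL Y).source}) := by
    intro x hx
    rw [OpenPartialHomeomorph.trans_source] at hx
    exact ⟨hx.1.2, hx.2⟩
  have h2 := contDiffOn_chart_family hB hk hL Y (c := X.slice hB)
    (U := X.sliceDom hB ∩ {p | proj (X.slice hB p) ∈ (chart hB hk hL Y).source})
    (fun j hj => (X.smoothFamilyOn_slice hB hk j hj).mono inter_subset_left) (fun p hp => hp.2)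
  exact Q.contDiff.comp_contDiffOn (h2.comp Q.symm.contDiff.contDiffOn h1)

theorem injective_hol_init (hB : IsInvariantInner G B) (hk : 1 ≤ k) :
    Function.Injective (fun q : Moduli E G k => (q.hol, q.init)) := fun _ _ h =>
  ext_of_eq hB hk (congrArg Prod.fst h) (congrArg Prod.snd h)

theorem t2Space (hB : IsInvariantInner G B) (hk : 1 ≤ k) : T2Space (Moduli E G k) :=
  T2Space.of_injective_continuous (injective_hol_init hB hk)
    ((continuous_hol hB hk).prodMk (continuous_init hB hk))

/-- The charts are continuous functions of holonomy and initial values, so every neighbourhood of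
`q` is pulled back from one in `G × 𝔤⁷`. Second countability is inherited through this map. -/
theorem isInducing_hol_init (hB : IsInvariantInner G B) (hk : 1 ≤ k) :
    IsInducing (fun q : Moduli E G k => (q.hol, q.init)) := by
  have : IsTopologicalGroup G := topologicalGroup_of_lieGroup 𝓘(ℝ, E) ∞
  obtain ⟨L, hL⟩ := exists_isLog (E := E) hB
  have hcont := (continuous_hol (k := k) hB hk).prodMk (continuous_init hB hk)
  refine isInducing_iff_nhds.2 fun q => le_antisymm hcont.continuousAt.le_comap fun N hN => ?_
  let X : Solution E G k := Quot.out q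
  have hq : q ∈ (chart hB hk hL X).source := by
    have := mem_chart_source_self hB hk hL X
    rwa [proj_out] at this
  have hq' := (chart hB hk hL X).map_source hq
  have h1 : (chart hB hk hL X).symm ⁻¹' N ∈ 𝓝 (chart hB hk hL X q) := by
    refine ((chart hB hk hL X).continuousAt_symm hq').preimage_mem_nhds ?_
    rwa [(chart hB hk hL X).left_inv hq]
  let ψ : G × (Fin 8 → E) → (Fin 8 → E) := fun a => inj0 E (L (X.hol⁻¹ * a.1)) + a.2
  have h2 : ContinuousAt ψ (q.hol, q.init) := by
    refine ContinuousAt.add ((inj0 E).continuous.continuousAt.comp ?_) continuousAt_snd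
    have h3 : ContinuousAt (fun a : G × (Fin 8 → E) => X.hol⁻¹ * a.1) (q.hol, q.init) := by fun_prop
    exact (L.continuousAt hq).comp_of_eq h3 rfl
  have h4 : ∀ᶠ a in 𝓝 (q.hol, q.init), X.hol⁻¹ * a.1 ∈ L.source := by
    have h3 : Continuous (fun a : G × (Fin 8 → E) => X.hol⁻¹ * a.1) := by fun_prop
    exact (L.open_source.preimage h3).mem_nhds hq
  refine mem_comap.2 ⟨_, h4.and (h2.preimage_mem_nhds h1), fun q' hq' => ?_⟩
  have h5 : (chart hB hk hL X).symm (chart hB hk hL X q') ∈ N := hq'.2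
  rwa [(chart hB hk hL X).left_inv hq'.1] at h5

theorem secondCountableTopology [CompactSpace G] (hB : IsInvariantInner G B) (hk : 1 ≤ k) :
    SecondCountableTopology (Moduli E G k) := by
  have : ProperSpace E := FiniteDimensional.proper_real E
  have : SecondCountableTopology G := ChartedSpace.secondCountable_of_sigmaCompact E G
  exact (isInducing_hol_init hB hk).secondCountableTopology

/-- The local section through `X` is the slice composed with the chart at `X`. -/
theorem isQuotientManifold (hB : IsInvariantInner G B) (hk : 1 ≤ k) (hL : IsLog L) :
    letI := chartedSpace Q hB hk hL
    IsQuotientManifold E G k m := by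
  let _ := chartedSpace Q hB hk hL
  have := isManifold Q hB hk hL
  refine ⟨fun P _ _ _ U c hU hc => ?_, fun X => ?_⟩
  · intro p hp
    refine ContMDiffAt.contMDiffWithinAt (contMDiffAt_iff_target.2 ⟨?_, ?_⟩)
    · exact continuous_proj.continuousAt.comp
        ((Solution.continuousOn_of_smoothFamilyOn hc).continuousAt (hU.mem_nhds hp))
    · let X : Solution E G k := Quot.out (proj (c p))
      have hX : proj (c p) ∈ (chart hB hk hL X).source := by
        have := mem_chart_source_self hB hk hL X
        rwa [proj_out] at this
      have hopen : IsOpen (U ∩ (fun p => proj (c p)) ⁻¹' (chart hB hk hL X).source) :=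
        (continuous_proj.comp_continuousOn
          (Solution.continuousOn_of_smoothFamilyOn hc)).isOpen_inter_preimage hU
            (chart hB hk hL X).open_source
      have h1 := contDiffOn_chart_family hB hk hL X
        (U := U ∩ (fun p => proj (c p)) ⁻¹' (chart hB hk hL X).source)
        (fun j hj => (hc j hj).mono inter_subset_left) (fun p hp => hp.2)
      exact ((Q.contDiff.comp_contDiffOn h1).contDiffAt (hopen.mem_nhds ⟨hp, hX⟩)).contMDiffAt
  · refine ⟨(chart hB hk hL X).source, (chart hB hk hL X).open_source,
      mem_chart_source_self hB hk hL X, fun q => X.slice hB (chart hB hk hL X q), ?_,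
      fun q hq => (chart hB hk hL X).left_inv hq, fun j hj => ?_⟩
    · simp only [chart_proj_self, (X.slice_init hB hk).2]
    · have h1 : ContMDiffOn (𝓡 m) (𝓡 m) ∞ (euclideanChart Q hB hk hL X)
          (euclideanChart Q hB hk hL X).source :=
        contMDiffOn_of_mem_maximalAtlas (IsManifold.subset_maximalAtlas (mem_range_self X))
      have h2 : ContMDiffOn (𝓡 m) 𝓘(ℝ, Fin 8 → E) ∞ (chart hB hk hL X)
          (chart hB hk hL X).source := by
        have := Q.symm.contDiff.contMDiff (n := ∞) |>.comp_contMDiffOn h1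
        refine this.congr fun q hq => ?_
        exact (Q.symm_apply_apply _).symm
      exact (X.smoothFamilyOn_slice hB hk j hj).contMDiffOn.comp h2
        fun q hq => ((chart hB hk hL X).map_source hq).2

end Moduli

end ManifoldStructure

/-! ### Horizontal tangent vectors -/

section Horizontal

variable {E : Type u} [NormedAddCommGroup E] [NormedSpace ℝ E] [FiniteDimensional ℝ E]
  [CompleteSpace E]
variable (G : Type v) [TopologicalSpace G] [ChartedSpace E G] [Group G] [LieGroup 𝓘(ℝ, E) ∞ G]
variable {B : LinearMap.BilinForm ℝ E} {k : ℕ∞}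

theorem pmap_primitive {F F₁ : Type*} [NormedAddCommGroup F] [NormedSpace ℝ F] [CompleteSpace F]
    [NormedAddCommGroup F₁] [NormedSpace ℝ F₁] [CompleteSpace F₁] (T : F →L[ℝ] F₁)
    (f : C(unitInterval, F)) : pmap T (primitive f) = primitive (pmap T f) := by
  ext t
  exact (T.intervalIntegral_comp_comm ((continuous_pext f).intervalIntegrable _ _)).symm

variable (E) in
/-- The coefficients of the equations for horizontal tangent vectors. -/
def nahmH : (Fin 8 → E) →L[ℝ] (Fin 8 → E) →L[ℝ] (Fin 8 → E) :=
  nahmB E G + (nahmB E G).flip + (ContinuousLinearMap.compL ℝ (Fin 8 → E) E (Fin 8 → E) (inj0 E)) ∘L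
    ∑ i, (lieL G).bilinearComp (ContinuousLinearMap.proj i) (ContinuousLinearMap.proj i)

variable {G}

theorem nahmH_apply (x a : Fin 8 → E) :
    nahmH E G x a = nahmB E G x a + nahmB E G a x + inj0 E (∑ i, lieL G (x i) (a i)) := by
  simp [nahmH]

theorem nahmH_zero (x a : Fin 8 → E) : nahmH E G x a 0 = ∑ i, lieL G (x i) (a i) := by
  simp [nahmH_apply, nahmB_apply]

theorem nahmH_of_ne (x a : Fin 8 → E) {i : Fin 8} (hi : i ≠ 0) :
    nahmH E G x a i = nahmB E G x a i + nahmB E G a x i := by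
  simp [nahmH_apply, inj0_of_ne _ hi]

theorem kill0_nahmH (x a : Fin 8 → E) :
    kill0 E (nahmH E G x a) = nahmB E G x a + nahmB E G a x := by
  ext i
  by_cases hi : i = 0
  · simp [hi, nahmB_apply]
  · rw [kill0_of_ne _ hi, nahmH_of_ne _ _ hi, Pi.add_apply]

/-- The zeroth component acts by the bracket on all eight slots alike. This is what makes the
horizontal equations covariant under gauge transformations. -/
theorem nahmH_inj0 (r : E) (a : Fin 8 → E) (i : Fin 8) :
    nahmH E G (inj0 E r) a i = lieL G r (a i) := by
  have hc : ∀ y, cross G (inj0 E r) y i = 0 := fun y => by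
    rw [cross_congr (x' := 0) (y' := y) (fun j hj => inj0_of_ne r hj) fun _ _ => rfl]
    simpa using cross_smul_left G (0 : ℝ) (0 : Fin 8 → E) y i
  by_cases hi : i = 0
  · subst hi
    rw [nahmH_zero, Finset.sum_eq_single 0 (fun j _ hj => by simp [inj0_of_ne r hj]) (by simp),
      inj0_zero]
  · rw [nahmH_of_ne _ _ hi, nahmB_apply, nahmB_apply, if_neg hi, if_neg hi, cross_swap a, hc,
      inj0_of_ne _ hi, inj0_zero, lie_eq_lieL, lie_eq_lieL]
    simp

theorem map_nahmH {T : E →L[ℝ] E} (hT : ∀ x y, T (lieL G x y) = lieL G (T x) (T y))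
    (x a : Fin 8 → E) (i : Fin 8) :
    T (nahmH E G x a i) = nahmH E G (fun i => T (x i)) (fun i => T (a i)) i := by
  by_cases hi : i = 0
  · subst hi
    simp only [nahmH_zero, map_sum, hT]
  · simp only [nahmH_of_ne _ _ hi, nahmB_apply, if_neg hi, map_add, map_cross hT, lie_eq_lieL, hT]

/-- `a` is a horizontal tangent vector along the path `x`. -/
def IsHoriz (G : Type v) [TopologicalSpace G] [ChartedSpace E G] [Group G] [LieGroup 𝓘(ℝ, E) ∞ G]
    (x a : C(unitInterval, Fin 8 → E)) : Prop :=
  a + volterra (pmap (nahmH E G) x) a = constPath (a 0)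

theorem isHoriz_iff {x a : C(unitInterval, Fin 8 → E)} : IsHoriz G x a ↔
    ∀ t ∈ Icc (0 : ℝ) 1, HasDerivWithinAt (pext a) (-nahmH E G (pext x t) (pext a t))
      (Icc 0 1) t := by
  let f : C(unitInterval, Fin 8 → E) := -pmul (pmap (nahmH E G) x) a
  have hf : volterra (pmap (nahmH E G) x) a = -primitive f := by
    rw [map_neg, neg_neg]
    rfl
  have hft : ∀ t, pext f t = -nahmH E G (pext x t) (pext a t) := fun t => rfl
  rw [IsHoriz, hf, ← sub_eq_add_neg, sub_eq_iff_eq_add]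
  exact ⟨fun h t ht => hasDerivWithinAt_of_eq h ht, fun h => eq_const_add_primitive h⟩

theorem mem_horizontal_iff (hk : 1 ≤ k) (X : Solution E G k) (a : CkPath k (Fin 8 → E)) :
    a ∈ horizontal hk X ↔ IsHoriz G X.1.1 a.1 := by
  rw [isHoriz_iff]
  have hx : ∀ t, pext X.1.1 t = X.1.ext t := fun t => rfl
  have key : ∀ t ∈ Icc (0 : ℝ) 1, (a.dt t = -nahmH E G (pext X.1.1 t) (pext a.1 t) ↔
      a.dt t 0 + ∑ i, lie G (X.1.ext t i) (a.ext t i) = 0 ∧ ∀ i : Fin 8, i ≠ 0 →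
      a.dt t i + lie G (a.ext t 0) (X.1.ext t i) + lie G (X.1.ext t 0) (a.ext t i)
        + (cross G (X.1.ext t) (a.ext t) i + cross G (a.ext t) (X.1.ext t) i) = 0) := by
    intro t ht
    have h0 : nahmH E G (pext X.1.1 t) (pext a.1 t) 0 = ∑ i, lie G (X.1.ext t i) (a.ext t i) := by
      simp only [nahmH_zero, lie_eq_lieL]
      rfl
    have hi : ∀ i ≠ 0, nahmH E G (pext X.1.1 t) (pext a.1 t) i =
        lie G (a.ext t 0) (X.1.ext t i) + lie G (X.1.ext t 0) (a.ext t i)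
        + (cross G (X.1.ext t) (a.ext t) i + cross G (a.ext t) (X.1.ext t) i) := fun i hi => by
      rw [nahmH_of_ne _ _ hi, nahmB_apply, nahmB_apply, if_neg hi, if_neg hi]
      change lie G (X.1.ext t 0) (a.ext t i) + cross G (X.1.ext t) (a.ext t) i +
        (lie G (a.ext t 0) (X.1.ext t i) + cross G (a.ext t) (X.1.ext t) i) = _
      abel
    constructor
    · intro h
      refine ⟨?_, fun i hi' => ?_⟩
      · rw [← h0, h]
        exact neg_add_cancel _
      · rw [add_assoc, add_assoc, ← add_assoc (lie G _ _), ← hi i hi', h]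
        exact neg_add_cancel _
    · rintro ⟨h1, h2⟩
      ext i
      by_cases hi' : i = 0
      · subst hi'
        rw [Pi.neg_apply, h0]
        exact eq_neg_of_add_eq_zero_left h1
      · have := h2 i hi'
        rw [add_assoc, add_assoc, ← add_assoc (lie G _ _), ← hi i hi'] at this
        exact eq_neg_of_add_eq_zero_left this
  constructor
  · intro h t ht
    have h1 := a.hasDerivWithinAt_ext hk ht
    rw [(key t ht).2 (h t ht)] at h1
    exact h1
  · intro h t ht
    exact (key t ht).1 (a.dt_eq_of_hasDerivWithinAt ht (h t ht))

variable (G) in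
/-- The horizontal vector along `x` with a given initial value. -/
def horizSol (x : C(unitInterval, Fin 8 → E)) : (Fin 8 → E) →L[ℝ] C(unitInterval, Fin 8 → E) :=
  Ring.inverse (1 + volterra (pmap (nahmH E G) x)) ∘L constPath

theorem add_volterra_horizSol (x : C(unitInterval, Fin 8 → E)) (v : Fin 8 → E) :
    horizSol G x v + volterra (pmap (nahmH E G) x) (horizSol G x v) = constPath v := by
  have h := Ring.mul_inverse_cancel _ (isUnit_one_add_volterra (pmap (nahmH E G) x))
  exact congrArg (fun T : C(unitInterval, Fin 8 → E) →L[ℝ] C(unitInterval, Fin 8 → E) =>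
    T (constPath v)) h

theorem horizSol_zero (x : C(unitInterval, Fin 8 → E)) (v : Fin 8 → E) :
    horizSol G x v 0 = v := by
  have := congrArg (fun f : C(unitInterval, Fin 8 → E) => f 0) (add_volterra_horizSol (G := G) x v)
  change horizSol G x v 0 + primitive _ 0 = v at this
  rwa [primitive_zero, add_zero] at this

theorem isHoriz_horizSol (x : C(unitInterval, Fin 8 → E)) (v : Fin 8 → E) :
    IsHoriz G x (horizSol G x v) := by
  rw [IsHoriz, horizSol_zero, add_volterra_horizSol]

theorem IsHoriz.eq_horizSol {x a : C(unitInterval, Fin 8 → E)} (ha : IsHoriz G x a) :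
    a = horizSol G x (a 0) := by
  rw [← sub_eq_zero]
  refine eq_zero_of_add_volterra_eq_zero (L := pmap (nahmH E G) x) ?_
  rw [map_sub, sub_add_sub_comm, add_volterra_horizSol, ha, sub_self]

variable (G) in
-- The Volterra operator depends linearly on `x`, and inversion in a Banach algebra is smooth at
-- units.
theorem contDiff_horizSol :
    ContDiff ℝ ∞ (horizSol G : C(unitInterval, Fin 8 → E) → _) := by
  refine ContDiff.clm_comp (contDiff_iff_contDiffAt.2 fun x => ?_) contDiff_const
  have h1 := contDiffAt_ringInverse ℝ (n := ∞) (isUnit_one_add_volterra (pmap (nahmH E G) x)).unit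
  have h2 : ContDiff ℝ ∞ (fun x : C(unitInterval, Fin 8 → E) =>
      (1 + volterra (pmap (nahmH E G) x) :
        C(unitInterval, Fin 8 → E) →L[ℝ] C(unitInterval, Fin 8 → E))) := by
    refine contDiff_const.add ?_
    exact ContDiff.clm_comp contDiff_const
      ((pmul (F := Fin 8 → E) (F₁ := Fin 8 → E)).contDiff.comp (pmap (nahmH E G)).contDiff)
  exact h1.comp x h2.contDiffAt

theorem horizSol_mem_ckSubmodule (X : Solution E G k) (v : Fin 8 → E) :
    horizSol G X.1.1 v ∈ ckSubmodule k (Fin 8 → E) := by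
  refine CkPath.mem_ckSubmodule (P := ℝ) (U := univ) (f := fun _ => horizSol G X.1.1 v)
    (fun j hj => ?_) (mem_univ 0)
  refine SmoothInto.of_succ (SmoothInto.of_volterra (L := fun _ => pmap (nahmH E G) X.1.1)
    contDiffOn_const ((X.1.smoothInto_const hj).map _)
    (SmoothInto.const (x := fun _ => v) contDiffOn_const) fun _ _ => add_volterra_horizSol _ _)

/-- Horizontal vectors at a solution are parametrized by their initial values. -/
def horizontalEquiv (hk : 1 ≤ k) (X : Solution E G k) : horizontal hk X ≃ₗ[ℝ] (Fin 8 → E) where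
  toFun a := a.1.1 0
  map_add' _ _ := rfl
  map_smul' _ _ := rfl
  invFun v := ⟨(⟨horizSol G X.1.1 v, horizSol_mem_ckSubmodule X v⟩ : ckSubmodule k (Fin 8 → E)),
    (mem_horizontal_iff hk X _).2 (isHoriz_horizSol _ _)⟩
  left_inv a := Subtype.ext (Subtype.ext ((mem_horizontal_iff hk X _).1 a.2).eq_horizSol.symm)
  right_inv _ := horizSol_zero _ _

/-! ### The `L²` inner product -/

/-- The pointwise inner product of vectors in `𝔤 ⊗ ℝ⁸`. -/
def bilin8 (B : LinearMap.BilinForm ℝ E) : (Fin 8 → E) →L[ℝ] (Fin 8 → E) →L[ℝ] ℝ :=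
  ∑ i, (bilinL B).bilinearComp (ContinuousLinearMap.proj i) (ContinuousLinearMap.proj i)

theorem bilin8_apply (x y : Fin 8 → E) : bilin8 B x y = ∑ i, B (x i) (y i) := by
  simp [bilin8, bilinL_apply]

/-- The `L²` inner product on continuous paths. -/
def l2Path (B : LinearMap.BilinForm ℝ E) :
    C(unitInterval, Fin 8 → E) →L[ℝ] C(unitInterval, Fin 8 → E) →L[ℝ] ℝ :=
  (ContinuousLinearMap.compL ℝ C(unitInterval, Fin 8 → E) C(unitInterval, ℝ) ℝ
    (evalOne ℝ ∘L primitive)) ∘L pointwise (bilin8 B)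

theorem l2Path_apply (a b : C(unitInterval, Fin 8 → E)) :
    l2Path B a b = ∫ t in (0 : ℝ)..1, ∑ i, B (pext a t i) (pext b t i) := by
  have : l2Path B a b = ∫ t in (0 : ℝ)..1, bilin8 B (pext a t) (pext b t) := rfl
  rw [this]
  simp only [bilin8_apply]

theorem l2Inner_eq (a b : CkPath k (Fin 8 → E)) : l2Inner B a b = l2Path B a.1 b.1 :=
  (l2Path_apply a.1 b.1).symm

theorem l2Path_symm (hB : IsInvariantInner G B) (a b : C(unitInterval, Fin 8 → E)) :
    l2Path B a b = l2Path B b a := by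
  simp only [l2Path_apply, hB.symm]

theorem bilin8_nonneg (hB : IsInvariantInner G B) (x : Fin 8 → E) : 0 ≤ bilin8 B x x := by
  rw [bilin8_apply]
  exact Finset.sum_nonneg fun i _ => hB.nonneg _

theorem l2Path_nonneg (hB : IsInvariantInner G B) (a : C(unitInterval, Fin 8 → E)) :
    0 ≤ l2Path B a a := by
  have : l2Path B a a = ∫ t in (0 : ℝ)..1, bilin8 B (pext a t) (pext a t) := rfl
  rw [this]
  exact intervalIntegral.integral_nonneg zero_le_one fun t _ => bilin8_nonneg hB _

theorem eq_zero_of_l2Path (hB : IsInvariantInner G B) {a : C(unitInterval, Fin 8 → E)}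
    (h : l2Path B a a = 0) : a = 0 := by
  have h1 : l2Path B a a = ∫ t in (0 : ℝ)..1, bilin8 B (pext a t) (pext a t) := rfl
  have hc : Continuous fun t => bilin8 B (pext a t) (pext a t) := by
    have := continuous_pext a
    fun_prop
  by_contra hne
  obtain ⟨t, ht⟩ : ∃ t : unitInterval, a t ≠ 0 := by
    by_contra! hall
    exact hne (ContinuousMap.ext hall)
  obtain ⟨i, hi⟩ : ∃ i, a t i ≠ 0 := by
    by_contra! hall
    exact ht (funext hall)
  have h2 : 0 < ∫ t in (0 : ℝ)..1, bilin8 B (pext a t) (pext a t) := by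
    refine intervalIntegral.integral_pos zero_lt_one hc.continuousOn
      (fun t _ => bilin8_nonneg hB _) ⟨t, t.2, ?_⟩
    rw [pext_coe, bilin8_apply]
    exact Finset.sum_pos' (fun i _ => hB.nonneg _) ⟨i, Finset.mem_univ _, hB.pos _ hi⟩
  rw [← h1, h] at h2
  exact lt_irrefl _ h2

/-! ### Vertical vectors are orthogonal to horizontal ones -/

theorem lieL_cross (x y : Fin 8 → E) (ξ : E) (i : Fin 8) :
    lieL G (cross G x y i) ξ = cross G (fun i => lieL G (x i) ξ) y i +
      cross G x (fun i => lieL G (y i) ξ) i := by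
  have key : ∀ a b : E, lieL G (lieL G a b) ξ =
      lieL G (lieL G a ξ) b + lieL G a (lieL G b ξ) := fun a b => by
    have h := lieL_jacobi (G := G) ξ a b
    rw [lieL_neg_swap (lieL G a b), h, lieL_neg_swap ξ a, lieL_neg_swap ξ b]
    simp only [map_neg, neg_apply]
    abel
  simp only [cross, lie_eq_lieL, map_smul, map_sum, sum_apply, smul_apply,
    key, smul_add, Finset.sum_add_distrib]

/-- The two hypotheses say that the initial values and, to first order, the holonomy do not change.
Then `ξ = Ad(h) ∫ Ad(h)⁻¹ a₀` vanishes at both ends and satisfies `a₀ = ξ' + [X₀, ξ]`; it follows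
that `a_i = [X_i, ξ]`, so `a` is tangent to the gauge orbit, and integration by parts against `ξ`
gives `‖a‖² = 0`. -/
theorem eq_zero_of_isHoriz_of_vertical (hB : IsInvariantInner G B) (hk : 1 ≤ k)
    (X : Solution E G k) {a : C(unitInterval, Fin 8 → E)} (ha : IsHoriz G X.1.1 a)
    (h0 : kill0 E (a 0) = 0)
    (h1 : evalOne E (primitive (pmul (X.isDev_dev hB).adInvPath (pmap (proj0 E) a))) = 0) :
    a = 0 := by
  have hX := X.isDev_dev hB
  set h := dev G (-X.zeroPath) with hh
  let η : C(unitInterval, E) := primitive (pmul hX.adInvPath (pmap (proj0 E) a))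
  let ξ : C(unitInterval, E) := pmul hX.adPath η
  have hξ0 : ξ 0 = 0 := by
    change hX.adPath 0 (primitive _ 0) = 0
    rw [primitive_zero, map_zero]
  have hξ1 : ξ 1 = 0 := by
    change hX.adPath 1 (η 1) = 0
    have : η 1 = 0 := h1
    rw [this, map_zero]
  have hξ : ∀ t (ht : t ∈ Icc (0 : ℝ) 1), HasDerivWithinAt (pext ξ)
      (a ⟨t, ht⟩ 0 - lieL G (X.1.1 ⟨t, ht⟩ 0) (ξ ⟨t, ht⟩)) (Icc 0 1) t := fun t ht => by
    have h2 := (hX.hasDerivWithinAt ht).clm_apply (hasDerivWithinAt_primitive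
      (pmul hX.adInvPath (pmap (proj0 E) a)) ht)
    refine (h2.congr (fun s hs => ?_) ?_).congr_deriv ?_
    · rw [pext_of_mem _ hs, pext_of_mem _ hs]
      rfl
    · rw [pext_of_mem _ ht, pext_of_mem _ ht]
      rfl
    · rw [pext_of_mem _ ht, pext_of_mem _ ht, pext_of_mem _ ht]
      change lieL G (-X.1.1 ⟨t, ht⟩ 0) (ξ ⟨t, ht⟩) + AdL (h t) (AdL (h t)⁻¹ (a ⟨t, ht⟩ 0)) = _
      rw [AdL_apply_AdL_inv, map_neg, neg_apply]
      abel
  have ha' := isHoriz_iff.1 ha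
  have hX' := (quadVolterra_nahmB_iff.1 (X.quadVolterra_eq hk)).2.2
  have hac : ∀ t ∈ Icc (0 : ℝ) 1, kill0 E (pext a t) =
      kill0 E (fun i => lieL G (pext X.1.1 t i) (pext ξ t)) := by
    -- Both sides solve the linearized Nahm equations with the given `a₀` as forcing term, the right
    -- side by the Jacobi identity and the equation for `ξ'`, and both vanish at time `0`.
    refine eqOn_of_linear_ode (L := -linPath (nahmB E G) X.1.1)
      (r := fun t => -(nahmB E G (pext X.1.1 t) (inj0 E (pext a t 0)) +
        nahmB E G (inj0 E (pext a t 0)) (pext X.1.1 t))) (fun t ht => ?_) (fun t ht => ?_) ?_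
    · refine ((kill0 E).hasFDerivAt.comp_hasDerivWithinAt t (ha' t ht)).congr_deriv ?_
      rw [map_neg, kill0_nahmH]
      have h3 : ∀ x y : Fin 8 → E, -(nahmB E G x y + nahmB E G y x) =
          -(nahmB E G x (kill0 E y) + nahmB E G (kill0 E y) x) +
          -(nahmB E G x (inj0 E (y 0)) + nahmB E G (inj0 E (y 0)) x) := fun x y => by
        nth_rewrite 1 2 [← inj0_add_kill0 y]
        simp only [map_add, add_apply]
        abel
      exact h3 _ _
    · have hval : pext (-linPath (nahmB E G) X.1.1) t =
          -((nahmB E G + (nahmB E G).flip) (pext X.1.1 t)) := rfl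
      rw [hval]
      refine hasDerivWithinAt_pi.2 fun i => ?_
      by_cases hi : i = 0
      · subst hi
        simp only [kill0_zero]
        refine (hasDerivWithinAt_const _ _ _).congr_deriv ?_
        simp [nahmB_apply]
      · have h3 := hasDerivWithinAt_pi.1 (hX' t ht) i
        simp only [kill0_of_ne _ hi, Pi.neg_apply, nahmB_apply, hi, if_false] at h3
        have h4 := (lieL G).hasDerivWithinAt_of_bilinear h3 (hξ t ht)
        simp only [kill0_of_ne _ hi]
        refine h4.congr_deriv ?_
        have h5 := nahmH_inj0 (G := G) (pext a t 0) (pext X.1.1 t) i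
        rw [nahmH_of_ne _ _ hi] at h5
        rw [Pi.add_apply, Pi.neg_apply, Pi.add_apply, add_comm (nahmB E G (pext X.1.1 t) _ i), h5]
        change _ = -(nahmB E G (pext X.1.1 t) _ i + nahmB E G _ (pext X.1.1 t) i) + _
        set x := pext X.1.1 t with hx
        have hxt : X.1.1 ⟨t, ht⟩ = x := (pext_of_mem _ ht).symm
        have hat : a ⟨t, ht⟩ = pext a t := (pext_of_mem _ ht).symm
        have hξt : ξ ⟨t, ht⟩ = pext ξ t := (pext_of_mem _ ht).symm
        rw [hxt, hat, hξt, nahmB_apply, nahmB_apply, if_neg hi, if_neg hi, kill0_of_ne _ hi,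
          kill0_zero,
          cross_congr (x := x) (x' := x)
            (y := kill0 E fun i => lieL G (x i) (pext ξ t)) (y' := fun i => lieL G (x i) (pext ξ t)) (fun _ _ => rfl)
            (fun j hj => kill0_of_ne _ hj),
          cross_congr (x := kill0 E fun i => lieL G (x i) (pext ξ t))
            (x' := fun i => lieL G (x i) (pext ξ t)) (y := x) (y' := x)
            (fun j hj => kill0_of_ne _ hj) (fun _ _ => rfl)]
        simp only [lie_eq_lieL, map_neg, map_add, map_sub, neg_apply, add_apply, lieL_cross, map_zero,
          zero_apply]
        rw [lieL_neg_swap (pext a t 0), lieL_jacobi (x 0) (x i)]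
        abel
    · have h3 : pext ξ 0 = 0 := (pext_of_mem ξ (left_mem_Icc.2 zero_le_one)).trans hξ0
      rw [h3, pext_of_mem _ (left_mem_Icc.2 zero_le_one)]
      simp only [map_zero]
      exact h0.trans (map_zero (kill0 E)).symm
  -- Invariance turns `B(a₀', ξ)` into `∑ B(a_i, [X_i, ξ])`. Its term with `i = 0` cancels against
  -- `-B(a₀, [X₀, ξ])` from `ξ'`, and `[X_i, ξ] = a_i` for the others.
  have hsum : ∀ t ∈ Icc (0 : ℝ) 1, HasDerivWithinAt (fun t => bilinL B (pext a t 0) (pext ξ t))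
      (bilin8 B (pext a t) (pext a t)) (Icc 0 1) t := by
    intro t ht
    have h2 := hasDerivWithinAt_pi.1 (ha' t ht) 0
    refine ((bilinL B).hasDerivWithinAt_of_bilinear h2 (hξ t ht)).congr_deriv ?_
    have hxt : X.1.1 ⟨t, ht⟩ = pext X.1.1 t := (pext_of_mem _ ht).symm
    have hat : a ⟨t, ht⟩ = pext a t := (pext_of_mem _ ht).symm
    have hξt : ξ ⟨t, ht⟩ = pext ξ t := (pext_of_mem _ ht).symm
    have h3 : ∀ i ≠ 0, lieL G (pext X.1.1 t i) (pext ξ t) = pext a t i := fun i hi => by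
      have := congrFun (hac t ht) i
      rw [kill0_of_ne _ hi, kill0_of_ne _ hi] at this
      exact this.symm
    have h4 : B (-∑ i, lieL G (pext X.1.1 t i) (pext a t i)) (pext ξ t) =
        ∑ i, B (pext a t i) (lieL G (pext X.1.1 t i) (pext ξ t)) := by
      rw [map_neg, LinearMap.neg_apply, map_sum, LinearMap.sum_apply, ← Finset.sum_neg_distrib]
      exact Finset.sum_congr rfl fun i _ => by rw [hB.inv', neg_neg]
    rw [hxt, hat, hξt, Pi.neg_apply, nahmH_zero, bilin8_apply, bilinL_apply, bilinL_apply, h4,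
      map_sub, Fin.sum_univ_succ, Fin.sum_univ_succ (fun i => B (pext a t i) (pext a t i)),
      ← add_assoc, sub_add_cancel]
    congr 1
    exact Finset.sum_congr rfl fun j _ => by rw [h3 j.succ (Fin.succ_ne_zero j)]
  refine eq_zero_of_l2Path hB ?_
  let u : C(unitInterval, ℝ) := pointwise (bilinL B) (pmap (proj0 E) a) ξ
  have hu : u = constPath (u 0) + primitive (pointwise (bilin8 B) a a) :=
    eq_const_add_primitive hsum
  have hu1 := congrArg (fun f : C(unitInterval, ℝ) => f 1) hu
  have hu1' : bilinL B (a 1 0) (ξ 1) = bilinL B (a 0 0) (ξ 0) + l2Path B a a := hu1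
  rw [hξ0, hξ1, map_zero, map_zero, zero_add] at hu1'
  exact hu1'.symm

end Horizontal

/-! ### The differential of the projection -/

section Differential

variable {E : Type u} [NormedAddCommGroup E] [NormedSpace ℝ E] [FiniteDimensional ℝ E]
  [CompleteSpace E]
variable {G : Type v} [TopologicalSpace G] [ChartedSpace E G] [Group G] [LieGroup 𝓘(ℝ, E) ∞ G]
variable {B : LinearMap.BilinForm ℝ E} {k : ℕ∞}

/-- The coordinates of the point of the moduli space determined by a path. -/
def coordVal (L : OpenPartialHomeomorph G E) (γ : G) (x : C(unitInterval, Fin 8 → E)) :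
    Fin 8 → E := inj0 E (L (γ * hol G (-pmap (proj0 E) x))) + kill0 E (x 0)

/-- The change of coordinates. -/
def coordChange (L : OpenPartialHomeomorph G E) (γ : G) (p : Fin 8 → E) : Fin 8 → E :=
  inj0 E (L (γ * hol G (constPath (p 0)))) + kill0 E p

variable {L : OpenPartialHomeomorph G E} {γ γ' : G}

/-- The metric in coordinates, as a function of a path representing the point. -/
def metricForm (B : LinearMap.BilinForm ℝ E) (L : OpenPartialHomeomorph G E) (γ : G)
    (x : C(unitInterval, Fin 8 → E)) : (Fin 8 → E) →L[ℝ] (Fin 8 → E) →L[ℝ] ℝ :=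
  (l2Path B).bilinearComp
    (horizSol G x ∘L (fderiv ℝ (coordVal L γ) x ∘L horizSol G x).inverse)
    (horizSol G x ∘L (fderiv ℝ (coordVal L γ) x ∘L horizSol G x).inverse)

theorem isOpen_coordVal_dom [T2Space G] (hB : IsInvariantInner G B) :
    IsOpen {x : C(unitInterval, Fin 8 → E) | γ * hol G (-pmap (proj0 E) x) ∈ L.source} := by
  have : IsTopologicalGroup G := topologicalGroup_of_lieGroup 𝓘(ℝ, E) ∞
  have h1 := (contMDiff_hol hB).continuous
  refine L.open_source.preimage (continuous_const.mul (h1.comp ?_))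
  exact (pmap (proj0 E)).continuous.neg

theorem contDiffAt_coordVal [T2Space G] (hB : IsInvariantInner G B) (hL : IsLog L)
    {x : C(unitInterval, Fin 8 → E)} (hx : γ * hol G (-pmap (proj0 E) x) ∈ L.source) :
    ContDiffAt ℝ ∞ (coordVal L γ) x := by
  have h1 : ContMDiffAt 𝓘(ℝ, C(unitInterval, Fin 8 → E)) 𝓘(ℝ, E) ∞
      (fun x => γ * hol G (-pmap (proj0 E) x)) x :=
    contMDiffAt_const.mul (I := 𝓘(ℝ, E))
      ((contMDiff_hol hB).comp (pmap (proj0 E)).contDiff.neg.contMDiff x)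
  have h2 := (hL.contMDiffOn.contMDiffAt (L.open_source.mem_nhds hx)).comp x h1
  exact ((inj0 E).contDiff.contDiffAt.comp x h2.contDiffAt).add
    ((kill0 E) ∘L ContinuousMap.evalCLM ℝ (M := Fin 8 → E) (0 : unitInterval)).contDiff.contDiffAt

theorem contDiffAt_coordChange [T2Space G] (hB : IsInvariantInner G B) (hL : IsLog L)
    {p : Fin 8 → E} (hp : γ * hol G (constPath (p 0)) ∈ L.source) :
    ContDiffAt ℝ ∞ (coordChange L γ) p := by
  have h1 : ContMDiffAt 𝓘(ℝ, Fin 8 → E) 𝓘(ℝ, E) ∞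
      (fun p : Fin 8 → E => γ * hol G (constPath (p 0))) p :=
    contMDiffAt_const.mul (I := 𝓘(ℝ, E))
      ((contMDiff_hol hB).comp ((constPath (F := E)).contDiff.comp (proj0 E).contDiff).contMDiff p)
  have h2 := (hL.contMDiffOn.contMDiffAt (L.open_source.mem_nhds hp)).comp p h1
  exact ((inj0 E).contDiff.contDiffAt.comp p h2.contDiffAt).add (kill0 E).contDiff.contDiffAt

theorem coordVal_zero (x : C(unitInterval, Fin 8 → E)) :
    coordVal L γ x 0 = L (γ * hol G (-pmap (proj0 E) x)) := by
  simp [coordVal]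

theorem kill0_coordVal (x : C(unitInterval, Fin 8 → E)) :
    kill0 E (coordVal L γ x) = kill0 E (x 0) := by
  rw [kill0_eq_iff]
  intro i hi
  rw [coordVal, Pi.add_apply, inj0_of_ne _ hi, zero_add, kill0_of_ne _ hi]

theorem coordChange_coordVal (hL : IsLog L) {x : C(unitInterval, Fin 8 → E)}
    (hx : γ * hol G (-pmap (proj0 E) x) ∈ L.source) :
    coordChange L (γ' * γ⁻¹) (coordVal L γ x) = coordVal L γ' x := by
  rw [coordChange, kill0_coordVal, coordVal_zero, ← hL.symm_eq _ (L.map_source hx), L.left_inv hx,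
    mul_assoc, inv_mul_cancel_left, coordVal]

theorem fderiv_coordChange_comp [T2Space G] (hB : IsInvariantInner G B) (hL : IsLog L)
    {x : C(unitInterval, Fin 8 → E)} (hx : γ * hol G (-pmap (proj0 E) x) ∈ L.source)
    (hx' : γ' * hol G (-pmap (proj0 E) x) ∈ L.source) :
    fderiv ℝ (coordChange L (γ' * γ⁻¹)) (coordVal L γ x) ∘L fderiv ℝ (coordVal L γ) x =
      fderiv ℝ (coordVal L γ') x := by
  have h1 := ((contDiffAt_coordVal hB hL hx).differentiableAt (by simp)).hasFDerivAt
  have h2 : DifferentiableAt ℝ (coordChange L (γ' * γ⁻¹)) (coordVal L γ x) := by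
    refine (contDiffAt_coordChange hB hL ?_).differentiableAt (by simp)
    rwa [coordVal_zero, ← hL.symm_eq _ (L.map_source hx), L.left_inv hx, mul_assoc,
      inv_mul_cancel_left]
  refine ((h2.hasFDerivAt.comp x h1).congr_of_eventuallyEq ?_).fderiv.symm
  filter_upwards [(isOpen_coordVal_dom (L := L) (γ := γ) hB).mem_nhds hx] with y hy
  exact (coordChange_coordVal hL hy).symm

/-- Relative to `X`, the holonomy of a path `x` is the endpoint of `Ad(h)⁻¹(X₀ - x₀)`, and the
derivative of `log` of the endpoint map at `0` is `A ↦ ∫₀¹ A`. -/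
theorem fderiv_coordVal_self [T2Space G] (hB : IsInvariantInner G B) (hL : IsLog L)
    (X : Solution E G k) (a : C(unitInterval, Fin 8 → E)) :
    fderiv ℝ (coordVal L X.hol⁻¹) X.1.1 a =
      inj0 E (-evalOne E (primitive (pmul (X.isDev_dev hB).adInvPath (pmap (proj0 E) a)))) +
        kill0 E (a 0) := by
  have hX := X.isDev_dev hB
  let S : C(unitInterval, Fin 8 → E) → C(unitInterval, E) := fun x =>
    pmul hX.adInvPath (-pmap (proj0 E) x - -X.zeroPath)
  have hS : HasFDerivAt S (pmul hX.adInvPath ∘L (-pmap (proj0 E))) X.1.1 :=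
    (pmul hX.adInvPath).hasFDerivAt.comp X.1.1
      ((-pmap (proj0 E)).hasFDerivAt.sub_const (-X.zeroPath))
  have hS0 : S X.1.1 = 0 := by
    change pmul hX.adInvPath (-X.zeroPath - -X.zeroPath) = 0
    rw [sub_self, map_zero]
  have h1 : ∀ x, X.hol⁻¹ * hol G (-pmap (proj0 E) x) = hol G (S x) := fun x => by
    rw [hol_eq_mul hB hX (-pmap (proj0 E) x)]
    exact inv_mul_cancel_left _ _
  have h2 : HasFDerivAt (fun A => L (hol G A)) (evalOne E ∘L primitive) (S X.1.1) := by
    rw [hS0]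
    exact hL.hasFDerivAt
  have h3 := ((inj0 E).hasFDerivAt.comp X.1.1 (h2.comp X.1.1 hS)).add
    ((kill0 E) ∘L ContinuousMap.evalCLM ℝ (M := Fin 8 → E) (0 : unitInterval)).hasFDerivAt
  have h4 : coordVal L X.hol⁻¹ = fun x => inj0 E (L (hol G (S x))) + kill0 E (x 0) := by
    funext x
    rw [coordVal, h1]
  rw [h4]
  have h5 := congrArg (fun T : C(unitInterval, Fin 8 → E) →L[ℝ] Fin 8 → E => T a) h3.fderiv
  refine h5.trans ?_
  change inj0 E (evalOne E (primitive (pmul hX.adInvPath (-pmap (proj0 E) a)))) + _ = _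
  rw [map_neg, map_neg, map_neg]
  rfl

/-- Passing to the coordinates centred at `X` itself, the derivative splits into the variations of
holonomy and of initial values; their vanishing is the input of `eq_zero_of_isHoriz_of_vertical`. -/
theorem fderiv_coordVal_injective [T2Space G] (hB : IsInvariantInner G B) (hk : 1 ≤ k)
    (hL : IsLog L) (X : Solution E G k) (hX : γ * X.hol ∈ L.source)
    {a : C(unitInterval, Fin 8 → E)} (ha : IsHoriz G X.1.1 a)
    (h : fderiv ℝ (coordVal L γ) X.1.1 a = 0) : a = 0 := by
  have h1 := fderiv_coordChange_comp (γ' := X.hol⁻¹) hB hL hX (by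
    change X.hol⁻¹ * X.hol ∈ _
    rw [inv_mul_cancel]
    exact hL.one_mem)
  have h2 : fderiv ℝ (coordVal L X.hol⁻¹) X.1.1 a = 0 := by
    rw [← h1, ContinuousLinearMap.comp_apply, h, map_zero]
  rw [fderiv_coordVal_self hB hL] at h2
  refine eq_zero_of_isHoriz_of_vertical hB hk X ha ?_ ?_
  · have := congrArg (kill0 E) h2
    rw [map_add, Moduli.kill0_inj0, zero_add, (kill0 E).map_zero] at this
    rw [← this, kill0_eq_iff]
    exact fun i hi => (kill0_of_ne _ hi).symm
  · have := congrFun h2 0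
    rw [Pi.add_apply, inj0_zero, kill0_zero, add_zero] at this
    exact neg_eq_zero.1 this

theorem isInvertible_coordFrame [T2Space G] (hB : IsInvariantInner G B) (hk : 1 ≤ k)
    (hL : IsLog L) (X : Solution E G k) (hX : γ * X.hol ∈ L.source) :
    (fderiv ℝ (coordVal L γ) X.1.1 ∘L horizSol G X.1.1).IsInvertible := by
  set T := fderiv ℝ (coordVal L γ) X.1.1 ∘L horizSol G X.1.1
  have hinj : Function.Injective T := by
    refine (injective_iff_map_eq_zero T).2 fun v hv => ?_
    have h1 := fderiv_coordVal_injective hB hk hL X hX (isHoriz_horizSol X.1.1 v) hv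
    rw [← horizSol_zero (G := G) X.1.1 v, h1]
    rfl
  exact ⟨(LinearEquiv.ofInjectiveEndo (T : (Fin 8 → E) →ₗ[ℝ] (Fin 8 → E))
    hinj).toContinuousLinearEquiv, by ext; rfl⟩

/-- `metricForm` lifts coordinate vectors to horizontal ones, and lifting the image of a horizontal
vector returns it. -/
theorem metricForm_apply [T2Space G] (hB : IsInvariantInner G B) (hk : 1 ≤ k)
    (hL : IsLog L) (X : Solution E G k) (hX : γ * X.hol ∈ L.source)
    {a b : C(unitInterval, Fin 8 → E)} (ha : IsHoriz G X.1.1 a) (hb : IsHoriz G X.1.1 b) :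
    metricForm B L γ X.1.1 (fderiv ℝ (coordVal L γ) X.1.1 a) (fderiv ℝ (coordVal L γ) X.1.1 b) =
      l2Path B a b := by
  have hT := isInvertible_coordFrame hB hk hL X hX
  have key : ∀ {a}, IsHoriz G X.1.1 a → horizSol G X.1.1
      ((fderiv ℝ (coordVal L γ) X.1.1 ∘L horizSol G X.1.1).inverse
        (fderiv ℝ (coordVal L γ) X.1.1 a)) = a := fun {a} ha => by
    conv_rhs => rw [ha.eq_horizSol]
    conv_lhs => rw [ha.eq_horizSol]
    congr 1
    exact hT.inverse_apply_self (a 0)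
  rw [metricForm, ContinuousLinearMap.bilinearComp_apply, ContinuousLinearMap.comp_apply,
    ContinuousLinearMap.comp_apply, key ha, key hb]

theorem exists_isHoriz_eq [T2Space G] (hB : IsInvariantInner G B) (hk : 1 ≤ k)
    (hL : IsLog L) (X : Solution E G k) (hX : γ * X.hol ∈ L.source) (v : Fin 8 → E) :
    ∃ a, IsHoriz G X.1.1 a ∧ fderiv ℝ (coordVal L γ) X.1.1 a = v := by
  obtain ⟨e, he⟩ := isInvertible_coordFrame hB hk hL X hX
  refine ⟨horizSol G X.1.1 (e.symm v), isHoriz_horizSol _ _, ?_⟩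
  rw [← ContinuousLinearMap.comp_apply, ← he]
  exact e.apply_symm_apply v

theorem contDiffAt_bilinearComp {P V W : Type*} [NormedAddCommGroup P] [NormedSpace ℝ P]
    [NormedAddCommGroup V] [NormedSpace ℝ V] [NormedAddCommGroup W] [NormedSpace ℝ W]
    {β : P → W →L[ℝ] W →L[ℝ] ℝ} {T : P → V →L[ℝ] W} {x : P} (hβ : ContDiffAt ℝ ∞ β x)
    (hT : ContDiffAt ℝ ∞ T x) : ContDiffAt ℝ ∞ (fun x => (β x).bilinearComp (T x) (T x)) x := by
  let _ : NormedAddCommGroup (V →L[ℝ] W →L[ℝ] ℝ) := ContinuousLinearMap.toNormedAddCommGroup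
  let _ : NormedAddCommGroup (V →L[ℝ] V →L[ℝ] ℝ) := ContinuousLinearMap.toNormedAddCommGroup
  let _ : NormedAddCommGroup (W →L[ℝ] V →L[ℝ] ℝ) := ContinuousLinearMap.toNormedAddCommGroup
  let _ : NormedAddCommGroup (W →L[ℝ] W →L[ℝ] ℝ) := ContinuousLinearMap.toNormedAddCommGroup
  have h1 := hβ.clm_comp hT
  have h2 := (LinearIsometryEquiv.contDiff (E := V →L[ℝ] W →L[ℝ] ℝ) (F := W →L[ℝ] V →L[ℝ] ℝ)
    (ContinuousLinearMap.flipₗᵢ ℝ V W ℝ)).contDiffAt.comp x h1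
  exact (LinearIsometryEquiv.contDiff (E := V →L[ℝ] V →L[ℝ] ℝ) (F := V →L[ℝ] V →L[ℝ] ℝ)
    (ContinuousLinearMap.flipₗᵢ ℝ V V ℝ)).contDiffAt.comp x (h2.clm_comp hT)

theorem contDiffAt_metricForm [T2Space G] (hB : IsInvariantInner G B) (hk : 1 ≤ k)
    (hL : IsLog L) (X : Solution E G k) (hX : γ * X.hol ∈ L.source) :
    ContDiffAt ℝ ∞ (metricForm B L γ) X.1.1 := by
  have h1 : ContDiffAt ℝ ∞ (fderiv ℝ (coordVal L γ)) X.1.1 :=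
    (contDiffAt_coordVal hB hL hX).fderiv_right (by simp)
  have h2 : ContDiffAt ℝ ∞ (horizSol G) X.1.1 := (contDiff_horizSol G).contDiffAt
  have h3 := h1.clm_comp h2
  have h4 := (isInvertible_coordFrame hB hk hL X hX).contDiffAt_map_inverse (n := ∞)
  have h5 := h2.clm_comp (h4.comp X.1.1 h3)
  exact contDiffAt_bilinearComp contDiffAt_const h5

/-! ### Gauge invariance -/

variable (E) in
/-- The diagonal action of a linear map. -/
def diagMap : (E →L[ℝ] E) →L[ℝ] (Fin 8 → E) →L[ℝ] (Fin 8 → E) :=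
  LinearMap.toContinuousLinearMap
    { toFun := fun T => ContinuousLinearMap.pi fun i => T ∘L ContinuousLinearMap.proj i
      map_add' := fun _ _ => rfl
      map_smul' := fun _ _ => rfl }

namespace IsDev

variable {r : C(unitInterval, E)} {g : ℝ → G}

/-- The adjoint action of a path in the group. -/
def ad8 (hg : IsDev r g) : C(unitInterval, Fin 8 → E) →L[ℝ] C(unitInterval, Fin 8 → E) :=
  pmul (pmap (diagMap E) hg.adPath)

theorem hol_add [T2Space G] (hB : IsInvariantInner G B) (hg : IsDev r g) (hg1 : g 1 = 1)
    (A : C(unitInterval, E)) : hol G (r + pmul hg.adPath A) = hol G A := by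
  rw [hol_eq hB (hg.mul (isDev_dev hB A)), hg1, one_mul]
  rfl

theorem coordVal_gauge [T2Space G] (hB : IsInvariantInner G B) (hg : IsDev r g) (hg1 : g 1 = 1)
    (x : C(unitInterval, Fin 8 → E)) :
    coordVal L γ (hg.ad8 x - pmap (inj0 E) r) = coordVal L γ x := by
  have h1 : -pmap (proj0 E) (hg.ad8 x - pmap (inj0 E) r) =
      r + pmul hg.adPath (-pmap (proj0 E) x) := by
    ext t
    change -(AdL (g t) (x t 0) - inj0 E (r t) 0) = r t + AdL (g t) (-x t 0)
    rw [inj0_zero, map_neg]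
    abel
  rw [coordVal, coordVal, h1, hg.hol_add hB hg1]
  congr 1
  rw [kill0_eq_iff]
  intro i hi
  change AdL (g ((0 : unitInterval) : ℝ)) (x 0 i) - inj0 E (r 0) i = x 0 i
  have h5 : g ((0 : unitInterval) : ℝ) = 1 := hg.1
  rw [h5, AdL_one, inj0_of_ne _ hi, sub_zero]
  rfl

/-- The gauge action on paths is affine with linear part `ad8`; differentiate the invariance of the
coordinates. -/
theorem fderiv_coordVal_gauge [T2Space G] (hB : IsInvariantInner G B) (hL : IsLog L)
    (hg : IsDev r g) (hg1 : g 1 = 1) {x : C(unitInterval, Fin 8 → E)}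
    (hx : γ * hol G (-pmap (proj0 E) (hg.ad8 x - pmap (inj0 E) r)) ∈ L.source)
    (a : C(unitInterval, Fin 8 → E)) :
    fderiv ℝ (coordVal L γ) (hg.ad8 x - pmap (inj0 E) r) (hg.ad8 a) =
      fderiv ℝ (coordVal L γ) x a := by
  have h1 := ((contDiffAt_coordVal hB hL hx).differentiableAt (by simp)).hasFDerivAt
  have h2 := h1.comp x (hg.ad8.hasFDerivAt.sub_const (pmap (inj0 E) r))
  have h3 : coordVal L γ ∘ (fun x => hg.ad8 x - pmap (inj0 E) r) = coordVal L γ :=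
    funext fun x => hg.coordVal_gauge hB hg1 x
  have h4 : HasFDerivAt (coordVal L γ ∘ (fun x => hg.ad8 x - pmap (inj0 E) r)) _ x := h2
  rw [h3] at h4
  rw [h4.fderiv]
  rfl

theorem l2Path_ad8 (hB : IsInvariantInner G B) (hg : IsDev r g)
    (a b : C(unitInterval, Fin 8 → E)) : l2Path B (hg.ad8 a) (hg.ad8 b) = l2Path B a b := by
  have : pointwise (bilin8 B) (hg.ad8 a) (hg.ad8 b) = pointwise (bilin8 B) a b := by
    ext t
    rw [pointwise_apply, pointwise_apply, bilin8_apply, bilin8_apply]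
    exact Finset.sum_congr rfl fun i _ => hg.bilin_AdL hB t.2 _ _
  change evalOne ℝ (primitive (pointwise (bilin8 B) (hg.ad8 a) (hg.ad8 b))) = _
  rw [this]
  rfl

/-- Differentiating `Ad(g)` contributes `[r, ·]` in every component, which by `nahmH_inj0` is the
effect of subtracting `r` from the zeroth component of `x`. -/
theorem isHoriz_ad8 (hg : IsDev r g) {x a : C(unitInterval, Fin 8 → E)} (ha : IsHoriz G x a) :
    IsHoriz G (hg.ad8 x - pmap (inj0 E) r) (hg.ad8 a) := by
  rw [isHoriz_iff] at ha ⊢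
  intro t ht
  refine hasDerivWithinAt_pi.2 fun i => ?_
  have h1 := (hg.hasDerivWithinAt ht).clm_apply (hasDerivWithinAt_pi.1 (ha t ht) i)
  refine (h1.congr (fun s hs => ?_) ?_).congr_deriv ?_
  · rw [pext_of_mem _ hs, pext_of_mem _ hs]
    rfl
  · rw [pext_of_mem _ ht, pext_of_mem _ ht]
    rfl
  · have h2 : pext (hg.ad8 x - pmap (inj0 E) r) t =
        (fun i => AdL (g t) (pext x t i)) - inj0 E (pext r t) := by
      rw [pext_of_mem _ ht, pext_of_mem _ ht, pext_of_mem _ ht]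
      rfl
    have h3 : pext (hg.ad8 a) t = fun i => AdL (g t) (pext a t i) := by
      rw [pext_of_mem _ ht, pext_of_mem _ ht]
      rfl
    rw [h2, h3, map_sub, sub_apply, Pi.neg_apply, Pi.neg_apply, Pi.sub_apply, nahmH_inj0, map_neg,
      map_nahmH (fun x y => hg.AdL_lieL ht x y)]
    simp only [ContinuousLinearMap.comp_apply]
    abel

end IsDev

theorem GaugeRel.exists_path {X Y : Solution E G k} (h : GaugeRel X Y) :
    ∃ (r : C(unitInterval, E)) (g : ℝ → G) (hg : IsDev r g), g 1 = 1 ∧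
      Y.1.1 = hg.ad8 X.1.1 - pmap (inj0 E) r := by
  obtain ⟨r, g, hg, hg1, hXY⟩ := h.exists_isDev
  refine ⟨r, g, hg, hg1, ?_⟩
  ext t i
  change Y.1.1 t i = AdL (g t) (X.1.1 t i) - inj0 E (r t) i
  by_cases hi : i = 0
  · subst hi
    rw [inj0_zero, (hXY t).1]
  · rw [inj0_of_ne _ hi, sub_zero, (hXY t).2 i hi]

/-- A gauge transformation maps horizontal vectors to horizontal vectors with the same coordinate
image and the same `L²` products, and horizontal vectors represent all coordinate vectors. -/
theorem metricForm_eq_of_proj_eq [T2Space G] (hB : IsInvariantInner G B) (hk : 1 ≤ k)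
    (hL : IsLog L) {X Y : Solution E G k} (hX : γ * X.hol ∈ L.source) (h : proj X = proj Y) :
    metricForm B L γ X.1.1 = metricForm B L γ Y.1.1 := by
  have hXY := (proj_eq_iff hB hk).1 h
  have hY : γ * Y.hol ∈ L.source := hXY.1 ▸ hX
  obtain ⟨r, g, hg, hg1, hYX⟩ := ((gaugeRel_iff hB hk).2 hXY).exists_path
  ext v w
  obtain ⟨a, ha, rfl⟩ := exists_isHoriz_eq hB hk hL X hX v
  obtain ⟨b, hb, rfl⟩ := exists_isHoriz_eq hB hk hL X hX w
  have hY' : γ * hol G (-pmap (proj0 E) (hg.ad8 X.1.1 - pmap (inj0 E) r)) ∈ L.source := by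
    rw [← hYX]
    exact hY
  have ha' := hg.isHoriz_ad8 ha
  have hb' := hg.isHoriz_ad8 hb
  have h1 := fun a => hg.fderiv_coordVal_gauge hB hL hg1 hY' a
  rw [← hYX] at ha' hb' h1
  rw [metricForm_apply hB hk hL X hX ha hb, ← h1, ← h1, metricForm_apply hB hk hL Y hY ha' hb',
    hg.l2Path_ad8 hB]

theorem metricForm_symm [T2Space G] (hB : IsInvariantInner G B) (hk : 1 ≤ k)
    (hL : IsLog L) (X : Solution E G k) (hX : γ * X.hol ∈ L.source) (v w : Fin 8 → E) :
    metricForm B L γ X.1.1 v w = metricForm B L γ X.1.1 w v := by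
  obtain ⟨a, ha, rfl⟩ := exists_isHoriz_eq hB hk hL X hX v
  obtain ⟨b, hb, rfl⟩ := exists_isHoriz_eq hB hk hL X hX w
  rw [metricForm_apply hB hk hL X hX ha hb, metricForm_apply hB hk hL X hX hb ha, l2Path_symm hB]

theorem metricForm_pos [T2Space G] (hB : IsInvariantInner G B) (hk : 1 ≤ k)
    (hL : IsLog L) (X : Solution E G k) (hX : γ * X.hol ∈ L.source) {v : Fin 8 → E} (hv : v ≠ 0) :
    0 < metricForm B L γ X.1.1 v v := by
  obtain ⟨a, ha, rfl⟩ := exists_isHoriz_eq hB hk hL X hX v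
  rw [metricForm_apply hB hk hL X hX ha ha]
  refine lt_of_le_of_ne (l2Path_nonneg hB a) fun h0 => hv ?_
  rw [eq_zero_of_l2Path hB h0.symm, map_zero]

/-- The metric transforms correctly under changes of coordinates. -/
theorem metricForm_coordChange [T2Space G] (hB : IsInvariantInner G B) (hk : 1 ≤ k)
    (hL : IsLog L) (X : Solution E G k) (hX : γ * X.hol ∈ L.source) (hX' : γ' * X.hol ∈ L.source)
    (v w : Fin 8 → E) :
    metricForm B L γ' X.1.1
      (fderiv ℝ (coordChange L (γ' * γ⁻¹)) (coordVal L γ X.1.1) v)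
      (fderiv ℝ (coordChange L (γ' * γ⁻¹)) (coordVal L γ X.1.1) w) =
    metricForm B L γ X.1.1 v w := by
  obtain ⟨a, ha, rfl⟩ := exists_isHoriz_eq hB hk hL X hX v
  obtain ⟨b, hb, rfl⟩ := exists_isHoriz_eq hB hk hL X hX w
  have h1 := fun a => congrArg (fun T : C(unitInterval, Fin 8 → E) →L[ℝ] (Fin 8 → E) => T a)
    (fderiv_coordChange_comp hB hL hX hX')
  simp only [ContinuousLinearMap.comp_apply] at h1
  rw [h1, h1, metricForm_apply hB hk hL X hX' ha hb, metricForm_apply hB hk hL X hX ha hb]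

end Differential

/-! ### Riemannian metrics in coordinates -/

section Coordinates

theorem isVonNBounded_of_pos {V : Type*} [NormedAddCommGroup V] [NormedSpace ℝ V]
    [FiniteDimensional ℝ V] (β : V →L[ℝ] V →L[ℝ] ℝ) (hβ : ∀ v ≠ 0, 0 < β v v) :
    Bornology.IsVonNBounded ℝ {v : V | β v v < 1} := by
  have hpos : ∃ c > 0, ∀ v : V, c * ‖v‖ ^ 2 ≤ β v v := by
    rcases subsingleton_or_nontrivial V with hV | hV
    · exact ⟨1, one_pos, fun v => by simp [Subsingleton.elim v 0]⟩
    have : ProperSpace V := FiniteDimensional.proper_real V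
    obtain ⟨w, hw, hmin⟩ := (isCompact_sphere (0 : V) 1).exists_isMinOn
      (NormedSpace.sphere_nonempty.2 zero_le_one)
      (by fun_prop : Continuous fun v => β v v).continuousOn
    have hw1 : ‖w‖ = 1 := by simpa using hw
    refine ⟨β w w, hβ w (fun h => by simp [h] at hw1), fun v => ?_⟩
    rcases eq_or_ne v 0 with rfl | hv
    · simp
    have h1 : (‖v‖⁻¹ • v) ∈ Metric.sphere (0 : V) 1 := by
      simp [norm_smul, inv_mul_cancel₀ (norm_ne_zero_iff.2 hv)]
    have h2 : β w w ≤ β (‖v‖⁻¹ • v) (‖v‖⁻¹ • v) := hmin h1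
    have hv' : 0 < ‖v‖ := norm_pos_iff.2 hv
    have h3 : β (‖v‖⁻¹ • v) (‖v‖⁻¹ • v) * ‖v‖ ^ 2 = β v v := by
      simp only [map_smul, smul_apply, smul_eq_mul]
      field_simp
    calc β w w * ‖v‖ ^ 2 ≤ β (‖v‖⁻¹ • v) (‖v‖⁻¹ • v) * ‖v‖ ^ 2 := by gcongr
      _ = β v v := h3
  obtain ⟨c, hc, hcv⟩ := hpos
  refine NormedSpace.isVonNBounded_of_isBounded ℝ
    -- Outside this ball both `‖v‖ ≥ 1` and `c ‖v‖ ≥ 1`, hence `c ‖v‖² ≥ 1`.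
    ((Metric.isBounded_ball (x := (0 : V)) (r := max 1 c⁻¹ + 1)).subset fun v hv => ?_)
  have hv' : β v v < 1 := hv
  rw [mem_ball_zero_iff]
  by_contra! hle
  have h1 : 1 ≤ ‖v‖ := by linarith [le_max_left 1 c⁻¹]
  have h2 : c⁻¹ ≤ ‖v‖ := by linarith [le_max_right 1 c⁻¹]
  have h3 : 1 ≤ c * ‖v‖ := by
    rw [← mul_inv_cancel₀ hc.ne']
    gcongr
  nlinarith [hcv v]

variable {m : ℕ} {M : Type*} [TopologicalSpace M] [ChartedSpace (EuclideanSpace ℝ (Fin m)) M]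
  [IsManifold (𝓡 m) ∞ M]

/-- The tangent space at `q` is identified with Euclidean space by the preferred chart at `q`, which
need not vary continuously. In the trivialization at `p` the form is evaluated on vectors
transported from the chart at `p` to that at `q`, and this expression must be smooth. -/
theorem contMDiff_of_tangentCoordChange
    (β : ∀ q : M, TangentSpace (𝓡 m) q →L[ℝ] TangentSpace (𝓡 m) q →L[ℝ] ℝ)
    (h : ∀ p : M, ∃ ψ : M → EuclideanSpace ℝ (Fin m) →L[ℝ] EuclideanSpace ℝ (Fin m) →L[ℝ] ℝ,
      ContMDiffAt (𝓡 m)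
        𝓘(ℝ, EuclideanSpace ℝ (Fin m) →L[ℝ] EuclideanSpace ℝ (Fin m) →L[ℝ] ℝ) ∞ ψ p ∧
      ∀ᶠ q in 𝓝 p, ∀ v w : EuclideanSpace ℝ (Fin m),
        β q (tangentCoordChange (𝓡 m) p q q v) (tangentCoordChange (𝓡 m) p q q w) = ψ q v w) :
    ContMDiff (𝓡 m) ((𝓡 m).prod
        𝓘(ℝ, EuclideanSpace ℝ (Fin m) →L[ℝ] EuclideanSpace ℝ (Fin m) →L[ℝ] ℝ)) ∞
      (fun q => TotalSpace.mk'
        (EuclideanSpace ℝ (Fin m) →L[ℝ] EuclideanSpace ℝ (Fin m) →L[ℝ] ℝ)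
        (E := fun q : M => TangentSpace (𝓡 m) q →L[ℝ] TangentSpace (𝓡 m) q →L[ℝ] ℝ) q (β q)) := by
  intro p
  obtain ⟨ψ, hψ, hβ⟩ := h p
  rw [contMDiffAt_hom_bundle]
  refine ⟨contMDiffAt_id, hψ.congr_of_eventuallyEq ?_⟩
  filter_upwards [hβ, (chartAt (EuclideanSpace ℝ (Fin m)) p).open_source.mem_nhds
    (mem_chart_source _ p)] with q hq hqp
  have hb : q ∈ (trivializationAt (EuclideanSpace ℝ (Fin m))
      (fun q : M => TangentSpace (𝓡 m) q) p).baseSet := by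
    rwa [TangentBundle.trivializationAt_baseSet]
  ext v w
  rw [inCoordinates_apply_eq₂ hb hb (mem_univ _)]
  have h1 : ∀ v, (trivializationAt (EuclideanSpace ℝ (Fin m))
      (fun q : M => TangentSpace (𝓡 m) q) p).symm q v = tangentCoordChange (𝓡 m) p q q v :=
    fun v => by
      have h2 := TangentBundle.symmL_trivializationAt_eq_core (I := 𝓡 m) (𝕜 := ℝ) hqp
      exact (Trivialization.symmL_apply (R := ℝ) _ hb v).symm.trans
        (congrArg (fun T : EuclideanSpace ℝ (Fin m) →L[ℝ] EuclideanSpace ℝ (Fin m) => T v) h2)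
  rw [h1, h1, ← hq v w]
  simp

end Coordinates

/-! ### The metric of the moduli space -/

section Metric

variable {E : Type u} [NormedAddCommGroup E] [NormedSpace ℝ E] [FiniteDimensional ℝ E]
  [CompleteSpace E]
variable {G : Type v} [TopologicalSpace G] [ChartedSpace E G] [Group G] [LieGroup 𝓘(ℝ, E) ∞ G]
  [T2Space G]
variable {B : LinearMap.BilinForm ℝ E} {k : ℕ∞}

namespace Moduli

variable {L : OpenPartialHomeomorph G E}

theorem chart_proj (hB : IsInvariantInner G B) (hk : 1 ≤ k) (hL : IsLog L) (Y X : Solution E G k) :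
    chart hB hk hL Y (proj X) = coordVal L Y.hol⁻¹ X.1.1 := by
  rw [chart_apply, hol_proj hB hk, init_proj hB hk]
  rfl

theorem chart_out (hB : IsInvariantInner G B) (hk : 1 ≤ k) (hL : IsLog L) (Y : Solution E G k)
    (q : Moduli E G k) : chart hB hk hL Y q = coordVal L Y.hol⁻¹ (Quot.out q : Solution E G k).1.1 := by
  rw [← chart_proj hB hk, proj_out]

theorem mem_source_self (hL : IsLog L) (X : Solution E G k) : X.hol⁻¹ * X.hol ∈ L.source := by
  rw [inv_mul_cancel]
  exact hL.one_mem

variable {m : ℕ} (Q : (Fin 8 → E) ≃L[ℝ] EuclideanSpace ℝ (Fin m))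

/-- The metric at a point of the moduli space, in the preferred chart at this point. -/
def metricInner (B : LinearMap.BilinForm ℝ E) (L : OpenPartialHomeomorph G E) (q : Moduli E G k) :
    EuclideanSpace ℝ (Fin m) →L[ℝ] EuclideanSpace ℝ (Fin m) →L[ℝ] ℝ :=
  (metricForm B L (Quot.out q : Solution E G k).hol⁻¹
    (Quot.out q : Solution E G k).1.1).bilinearComp (Q.symm : _ →L[ℝ] _) (Q.symm : _ →L[ℝ] _)

theorem metricInner_map (q : Moduli E G k) (v w : Fin 8 → E) :
    metricInner Q B L q (Q v) (Q w) = metricForm B L (Quot.out q : Solution E G k).hol⁻¹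
      (Quot.out q : Solution E G k).1.1 v w := by
  change metricForm B L _ _ (Q.symm (Q v)) (Q.symm (Q w)) = _
  rw [Q.symm_apply_apply, Q.symm_apply_apply]

theorem metricInner_symm (hB : IsInvariantInner G B) (hk : 1 ≤ k) (hL : IsLog L) (q : Moduli E G k)
    (v w : EuclideanSpace ℝ (Fin m)) : metricInner Q B L q v w = metricInner Q B L q w v :=
  metricForm_symm hB hk hL _ (mem_source_self hL _) _ _

theorem metricInner_pos (hB : IsInvariantInner G B) (hk : 1 ≤ k) (hL : IsLog L) (q : Moduli E G k)
    (v : EuclideanSpace ℝ (Fin m)) (hv : v ≠ 0) : 0 < metricInner Q B L q v v :=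
  metricForm_pos hB hk hL _ (mem_source_self hL _) (by simpa using hv)

/-- Near the image of `q` the transition between the preferred charts is `coordChange` for the ratio
of the base holonomies, because the exponential recovers the holonomy from the coordinates. -/
theorem tangentCoordChange_apply (hB : IsInvariantInner G B) (hk : 1 ≤ k) (hL : IsLog L)
    (p q : Moduli E G k) (hpq : q ∈ (chart hB hk hL (Quot.out p : Solution E G k)).source)
    (v : EuclideanSpace ℝ (Fin m)) :
    letI := chartedSpace Q hB hk hL
    haveI := isManifold Q hB hk hL
    tangentCoordChange (𝓡 m) p q q v = Q (fderiv ℝ (coordChange L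
      ((Quot.out q : Solution E G k).hol⁻¹ * (Quot.out p : Solution E G k).hol⁻¹⁻¹))
      (coordVal L (Quot.out p : Solution E G k).hol⁻¹ (Quot.out q : Solution E G k).1.1)
      (Q.symm v)) := by
  let _ := chartedSpace Q hB hk hL
  have := isManifold Q hB hk hL
  set X : Solution E G k := Quot.out p with hX
  set Y : Solution E G k := Quot.out q with hY
  have hqq : q ∈ (chart hB hk hL Y).source := by
    have := mem_chart_source_self hB hk hL Y
    rwa [proj_out] at this
  have h1 : HasFDerivWithinAt ((extChartAt (𝓡 m) q) ∘ (extChartAt (𝓡 m) p).symm)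
      (tangentCoordChange (𝓡 m) p q q) (range (𝓡 m)) (extChartAt (𝓡 m) p q) := by
    refine hasFDerivWithinAt_tangentCoordChange ⟨?_, mem_extChartAt_source q⟩
    rw [extChartAt_source]
    exact hpq
  rw [ModelWithCorners.range_eq_univ, hasFDerivWithinAt_univ] at h1
  have hval : extChartAt (𝓡 m) p q = Q (coordVal L X.hol⁻¹ Y.1.1) :=
    congrArg Q (chart_out hB hk hL X q)
  have hdiff : DifferentiableAt ℝ (coordChange L (Y.hol⁻¹ * X.hol⁻¹⁻¹)) (coordVal L X.hol⁻¹ Y.1.1) := by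
    have hXY : X.hol⁻¹ * OctNahm.hol G (-pmap (proj0 E) Y.1.1) ∈ L.source := hpq
    refine (contDiffAt_coordChange hB hL ?_).differentiableAt (by simp)
    rw [coordVal_zero, ← hL.symm_eq _ (L.map_source hXY), L.left_inv hXY, mul_assoc,
      inv_mul_cancel_left]
    exact mem_source_self hL Y
  have h2 : HasFDerivAt (coordChange L (Y.hol⁻¹ * X.hol⁻¹⁻¹)) (fderiv ℝ (coordChange L
      (Y.hol⁻¹ * X.hol⁻¹⁻¹)) (coordVal L X.hol⁻¹ Y.1.1)) (Q.symm (extChartAt (𝓡 m) p q)) := by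
    rw [hval, ContinuousLinearEquiv.symm_apply_apply]
    exact hdiff.hasFDerivAt
  have h2 := Q.hasFDerivAt.comp (extChartAt (𝓡 m) p q)
    (h2.comp (extChartAt (𝓡 m) p q) Q.symm.hasFDerivAt)
  have h3 : (extChartAt (𝓡 m) q) ∘ (extChartAt (𝓡 m) p).symm =ᶠ[𝓝 (extChartAt (𝓡 m) p q)]
      fun x => Q (coordChange L (Y.hol⁻¹ * X.hol⁻¹⁻¹) (Q.symm x)) := by
    have h4 : Q.symm ⁻¹' (chart hB hk hL X).target ∈ 𝓝 (extChartAt (𝓡 m) p q) := by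
      refine ((chart hB hk hL X).open_target.preimage Q.symm.continuous).mem_nhds ?_
      rw [mem_preimage, hval, ContinuousLinearEquiv.symm_apply_apply, ← chart_out hB hk hL]
      exact (chart hB hk hL X).map_source hpq
    filter_upwards [h4] with x hx
    change Q (chart hB hk hL Y (proj (X.slice hB (Q.symm x)))) = _
    have h5 : coordVal L X.hol⁻¹ (X.slice hB (Q.symm x)).1.1 = Q.symm x := by
      rw [← chart_proj hB hk hL]
      exact (chart hB hk hL X).right_inv hx
    have h6 : X.hol⁻¹ * (X.slice hB (Q.symm x)).hol ∈ L.source := by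
      rw [← hol_proj hB hk (X.slice hB _)]
      exact (chart hB hk hL X).map_target hx
    rw [chart_proj]
    conv_rhs => rw [← h5]
    rw [coordChange_coordVal hL h6]
  have h7 := congrArg (fun T : EuclideanSpace ℝ (Fin m) →L[ℝ] EuclideanSpace ℝ (Fin m) => T v)
    (h1.unique (h2.congr_of_eventuallyEq h3))
  exact h7

theorem contMDiff_metricInner (hB : IsInvariantInner G B) (hk : 1 ≤ k) (hL : IsLog L) :
    letI := chartedSpace (k := k) Q hB hk hL
    haveI := isManifold (k := k) Q hB hk hL
    ContMDiff (𝓡 m) ((𝓡 m).prod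
        𝓘(ℝ, EuclideanSpace ℝ (Fin m) →L[ℝ] EuclideanSpace ℝ (Fin m) →L[ℝ] ℝ)) ∞
      (fun q : Moduli E G k => TotalSpace.mk'
        (EuclideanSpace ℝ (Fin m) →L[ℝ] EuclideanSpace ℝ (Fin m) →L[ℝ] ℝ)
        (E := fun q : Moduli E G k => TangentSpace (𝓡 m) q →L[ℝ] TangentSpace (𝓡 m) q →L[ℝ] ℝ) q
          (metricInner Q B L q)) := by
  let _ := chartedSpace (k := k) Q hB hk hL
  have := isManifold (k := k) Q hB hk hL
  refine contMDiff_of_tangentCoordChange _ fun p => ?_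
  set X : Solution E G k := Quot.out p with hX
  have hp : p ∈ (chart hB hk hL X).source := by
    have := mem_chart_source_self hB hk hL X
    rwa [proj_out] at this
  -- The representatives `Quot.out q` need not depend continuously on `q`. Gauge invariance allows
  -- replacing them by the representatives in the slice, which vary smoothly.
  refine ⟨fun q => (metricForm B L X.hol⁻¹ (X.slice hB (chart hB hk hL X q)).1.1).bilinearComp
    (Q.symm : _ →L[ℝ] _) (Q.symm : _ →L[ℝ] _), ?_, ?_⟩
  · have h1 : ContMDiffAt (𝓡 m) 𝓘(ℝ, Fin 8 → E) ∞ (chart hB hk hL X) p := by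
      have h2 : ContMDiffAt (𝓡 m) 𝓘(ℝ, EuclideanSpace ℝ (Fin m)) ∞ (extChartAt (𝓡 m) p) p :=
        contMDiffAt_extChartAt
      have h3 := (Q.symm.contDiff (n := ∞)).contMDiff.contMDiffAt.comp p h2
      refine h3.congr_of_eventuallyEq (Eventually.of_forall fun q => ?_)
      exact (Q.symm_apply_apply _).symm
    have hdom := ((chart hB hk hL X).map_source hp).2
    have h4 : ContDiffAt ℝ ∞ (fun x => (X.slice hB x).1.1) (chart hB hk hL X p) :=
      (Solution.contDiffOn_val (X.smoothFamilyOn_slice hB hk)).contDiffAt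
        ((X.isOpen_sliceDom hB).mem_nhds hdom)
    have h5 : X.hol⁻¹ * (X.slice hB (chart hB hk hL X p)).hol ∈ L.source := by
      rw [← hol_proj hB hk (X.slice hB _)]
      exact (chart hB hk hL X).map_target ((chart hB hk hL X).map_source hp)
    have h6 := contDiffAt_bilinearComp
      (ContDiffAt.comp (f := fun x => (X.slice hB x).1.1) (chart hB hk hL X p)
        (contDiffAt_metricForm (B := B) hB hk hL (X.slice hB (chart hB hk hL X p)) h5) h4)
      (contDiffAt_const (c := (Q.symm : EuclideanSpace ℝ (Fin m) →L[ℝ] (Fin 8 → E))))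
    exact h6.contMDiffAt.comp p h1
  · filter_upwards [(chart hB hk hL X).open_source.mem_nhds hp] with q hq v w
    rw [tangentCoordChange_apply Q hB hk hL p q hq, tangentCoordChange_apply Q hB hk hL p q hq]
    refine (metricInner_map Q q _ _).trans ?_
    rw [metricForm_coordChange hB hk hL _ hq (mem_source_self hL _)]
    rw [metricForm_eq_of_proj_eq hB hk hL (Y := X.slice hB (chart hB hk hL X q)) hq]
    · rfl
    · rw [proj_out]
      exact ((chart hB hk hL X).left_inv hq).symm

/-- The `L²` metric of the moduli space. -/
def metric (hB : IsInvariantInner G B) (hk : 1 ≤ k) (hL : IsLog L) :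
    letI := chartedSpace (k := k) Q hB hk hL
    haveI := isManifold (k := k) Q hB hk hL
    ContMDiffRiemannianMetric (𝓡 m) ∞ (EuclideanSpace ℝ (Fin m))
      (fun q : Moduli E G k => TangentSpace (𝓡 m) q) :=
  letI := chartedSpace (k := k) Q hB hk hL
  haveI := isManifold (k := k) Q hB hk hL
  { inner := metricInner Q B L
    symm := metricInner_symm Q hB hk hL
    pos := metricInner_pos Q hB hk hL
    isVonNBounded := fun q => isVonNBounded_of_pos _ (metricInner_pos Q hB hk hL q)
    contMDiff := contMDiff_metricInner Q hB hk hL }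

end Moduli

end Metric

/-! ### Horizontal vectors as tangent vectors of the moduli space -/

section TangentSpaces

variable {E : Type u} [NormedAddCommGroup E] [NormedSpace ℝ E] [FiniteDimensional ℝ E]
  [CompleteSpace E]
variable {G : Type v} [TopologicalSpace G] [ChartedSpace E G] [Group G] [LieGroup 𝓘(ℝ, E) ∞ G]
variable {B : LinearMap.BilinForm ℝ E} {k : ℕ∞}

/-- Dropping the zeroth component of the horizontal equations leaves the linearized Nahm equations,
so the derivative of `quadVolterra` maps `a` to its own datum. -/
theorem IsHoriz.add_volterra_linPath {x a : C(unitInterval, Fin 8 → E)} (ha : IsHoriz G x a) :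
    a + volterra (linPath (nahmB E G) x) a = nahmDatum (pmap (proj0 E) a) (a 0) := by
  have h1 := congrArg (pmap (kill0 E)) ha
  have h2 : pmap (kill0 E) (volterra (pmap (nahmH E G) x) a) =
      volterra (linPath (nahmB E G) x) a := by
    rw [volterra_apply, volterra_apply, pmap_primitive]
    congr 1
    ext1 t
    exact kill0_nahmH (x t) (a t)
  have h3 : pmap (inj0 E) (pmap (proj0 E) a) + pmap (kill0 E) a = a := by
    ext1 t
    exact inj0_add_kill0 (a t)
  rw [map_add, h2] at h1
  rw [nahmDatum]
  nth_rewrite 1 [← h3]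
  rw [add_assoc, h1]
  rfl

theorem quadVolterraDeriv_symm_nahmDatum {x a : C(unitInterval, Fin 8 → E)} (ha : IsHoriz G x a) :
    (quadVolterraDeriv (nahmB E G) x).symm (nahmDatum (pmap (proj0 E) a) (a 0)) = a := by
  rw [ContinuousLinearEquiv.symm_apply_eq, ← ha.add_volterra_linPath]
  rfl

theorem nahmDatum_add_smul (A A' : C(unitInterval, E)) (y y' : Fin 8 → E) (τ : ℝ) :
    nahmDatum (A + τ • A') (y + τ • y') = nahmDatum A y + τ • nahmDatum A' y' := by
  simp only [nahmDatum, map_add, map_smul, smul_add]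
  abel

/-- Move the data along the line `X₀ + τ a₀`, `X_i(0) + τ a_i(0)` and solve the Nahm equations; the
derivative of the solution map returns the velocity `a`. -/
theorem exists_isCurveThrough (hk : 1 ≤ k) (X : Solution E G k) (a : horizontal hk X) :
    ∃ c : ℝ → Solution E G k, IsCurveThrough c X a := by
  have ha := (mem_horizontal_iff hk X _).1 a.2
  set A : ℝ → C(unitInterval, E) := fun τ => X.zeroPath + τ • pmap (proj0 E) a.1.1 with hA
  set y : ℝ → (Fin 8 → E) := fun τ => X.1.1 0 + τ • a.1.1 0 with hy
  have hAs : ∀ {U : Set ℝ} (j : ℕ), (j : ℕ∞) ≤ k → SmoothInto j U A := fun {U} j hj => by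
    have h1 := (SmoothInto.const (x := fun τ : ℝ => τ) (U := U) contDiffOn_id (j := j)).bilinear
      ((a.1.smoothInto_const (P := ℝ) (U := U) hj).map (proj0 E)) (ContinuousLinearMap.lsmul ℝ ℝ)
    exact (X.smoothInto_zeroPath hj).add h1
  have hys : ∀ {U : Set ℝ}, ContDiffOn ℝ ∞ y U := fun {U} =>
    contDiffOn_const.add (contDiffOn_id.smul contDiffOn_const)
  have hd : ∀ τ, nahmDatum (A τ) (y τ) = quadVolterra (nahmB E G) X.1.1 +
      τ • nahmDatum (pmap (proj0 E) a.1.1) (a.1.1 0) := fun τ => by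
    rw [hA, hy, nahmDatum_add_smul, X.quadVolterra_eq hk]
  set U : Set ℝ := {τ | nahmDatum (A τ) (y τ) ∈ range (quadVolterra (nahmB E G))} with hU
  have hUo : IsOpen U := by
    refine (isOpen_range_quadVolterra (nahmB E G)).preimage ?_
    simp only [hd]
    fun_prop
  have h0U : (0 : ℝ) ∈ U := ⟨X.1.1, by rw [hd, zero_smul, add_zero]⟩
  have hval := fun {τ : ℝ} (hτ : τ ∈ U) =>
    Solution.ofDatum_val (X := X) hk (fun j hj => hAs j hj) hys (fun _ h => h) hτ
  have hsm := Solution.smoothFamilyOn_ofDatum (X := X) (U := U) hk (fun j hj => hAs j hj) hys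
    (fun _ h => h)
  refine ⟨fun τ => Solution.ofDatum X (A τ) (y τ), ?_, ?_, ?_⟩
  · refine Solution.ext_of_eq hk ((hval h0U).2.1.trans ?_) ((hval h0U).2.2.trans ?_)
    · simp [hA]
    · simp [hy, Solution.init]
  · obtain ⟨ε, hε, hεU⟩ := Metric.isOpen_iff.1 hUo 0 h0U
    rw [Real.ball_eq_Ioo, zero_sub, zero_add] at hεU
    exact ⟨ε, hε, fun j hj => (hsm j hj).mono hεU⟩
  · refine CkPath.hasDerivAt_iterDeriv (c := fun τ => (Solution.ofDatum X (A τ) (y τ)).1)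
      (hUo.mem_nhds h0U) hsm ?_
    have h1 : HasDerivAt (fun τ => nahmDatum (A τ) (y τ))
        (nahmDatum (pmap (proj0 E) a.1.1) (a.1.1 0)) 0 := by
      simp only [hd]
      simpa using ((hasDerivAt_id (0 : ℝ)).smul_const
        (nahmDatum (pmap (proj0 E) a.1.1) (a.1.1 0))).const_add (quadVolterra (nahmB E G) X.1.1)
    have h2 : HasFDerivAt (quadSolve (nahmB E G)) ((quadVolterraDeriv (nahmB E G) X.1.1).symm :
        C(unitInterval, Fin 8 → E) →L[ℝ] C(unitInterval, Fin 8 → E)) (nahmDatum (A 0) (y 0)) := by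
      rw [hd, zero_smul, add_zero]
      exact hasFDerivAt_quadSolve _ _
    have h3 := h2.comp_hasDerivAt 0 h1
    rw [ContinuousLinearEquiv.coe_coe, quadVolterraDeriv_symm_nahmDatum ha] at h3
    refine h3.congr_of_eventuallyEq ?_
    filter_upwards [hUo.mem_nhds h0U] with τ hτ
    exact (hval hτ).1

variable [T2Space G] {L : OpenPartialHomeomorph G E} {γ : G}
variable {m : ℕ} (Q : (Fin 8 → E) ≃L[ℝ] EuclideanSpace ℝ (Fin m))

/-- The differential of the projection on horizontal vectors, in coordinates. -/
def horizontalToTangent (hk : 1 ≤ k) (L : OpenPartialHomeomorph G E) (γ : G) (X : Solution E G k) :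
    horizontal hk X →ₗ[ℝ] EuclideanSpace ℝ (Fin m) where
  toFun a := Q (fderiv ℝ (coordVal L γ) X.1.1 a.1.1)
  map_add' a b := by
    change Q (fderiv ℝ (coordVal L γ) X.1.1 (a.1.1 + b.1.1)) = _
    rw [map_add, map_add]
  map_smul' r a := by
    change Q (fderiv ℝ (coordVal L γ) X.1.1 (r • a.1.1)) = _
    rw [map_smul, map_smul]
    rfl

theorem bijective_horizontalToTangent (hB : IsInvariantInner G B) (hk : 1 ≤ k) (hL : IsLog L)
    (X : Solution E G k) (hX : γ * X.hol ∈ L.source) :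
    Function.Bijective (horizontalToTangent Q hk L γ X) := by
  refine ⟨(injective_iff_map_eq_zero _).2 fun a ha => ?_, fun v => ?_⟩
  · refine Subtype.ext (Subtype.ext (fderiv_coordVal_injective hB hk hL X hX
      ((mem_horizontal_iff hk X _).1 a.2) ?_))
    exact Q.map_eq_zero_iff.1 ha
  · obtain ⟨a, ha, hav⟩ := exists_isHoriz_eq hB hk hL X hX (Q.symm v)
    refine ⟨(horizontalEquiv hk X).symm (a 0), ?_⟩
    change Q (fderiv ℝ (coordVal L γ) X.1.1 (horizSol G X.1.1 (a 0))) = v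
    rw [← ha.eq_horizSol, hav, ContinuousLinearEquiv.apply_symm_apply]

theorem isL2Metric (hB : IsInvariantInner G B) (hk : 1 ≤ k) (hL : IsLog L) :
    letI := Moduli.chartedSpace (k := k) Q hB hk hL
    haveI := Moduli.isManifold (k := k) Q hB hk hL
    IsL2Metric E G hk B (Moduli.metric Q hB hk hL) := by
  let _ := Moduli.chartedSpace (k := k) Q hB hk hL
  have := Moduli.isManifold (k := k) Q hB hk hL
  intro X
  set Y : Solution E G k := Quot.out (proj X) with hY
  have hYX : Y.hol = X.hol := Moduli.hol_proj hB hk X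
  have hX : Y.hol⁻¹ * X.hol ∈ L.source := by
    rw [hYX]
    exact Moduli.mem_source_self hL X
  refine ⟨LinearEquiv.ofBijective (horizontalToTangent Q hk L Y.hol⁻¹ X)
    (bijective_horizontalToTangent Q hB hk hL X hX), exists_isCurveThrough hk X, ?_, fun a b => ?_⟩
  · rintro a c ⟨rfl, ⟨ε, hε, hc⟩, hca⟩
    have h1 : HasMFDerivAt 𝓘(ℝ, ℝ) (𝓡 m) (fun τ => proj (c τ)) 0
        (ContinuousLinearMap.toSpanSingleton ℝ (horizontalToTangent Q hk L Y.hol⁻¹ (c 0) a)) := by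
      refine ⟨continuous_proj.continuousAt.comp ((Solution.continuousOn_of_smoothFamilyOn
        hc).continuousAt (Ioo_mem_nhds (neg_lt_zero.2 hε) hε)), ?_⟩
      have h2 : HasDerivAt (fun τ => (c τ).1.1) a.1.1 0 :=
        ((hca 0 (by simp)).congr_of_eventuallyEq (Eventually.of_forall fun τ =>
          ((c τ).1.iterDeriv_zero _).symm)).congr_deriv (a.1.iterDeriv_zero _)
      have h3 := ((contDiffAt_coordVal hB hL hX).differentiableAt (by simp)).hasFDerivAt
      have h4 := Q.hasFDerivAt.comp_hasDerivAt (0 : ℝ) (h3.comp_hasDerivAt (0 : ℝ) h2)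
      refine (HasFDerivAt.hasFDerivWithinAt ?_)
      refine h4.hasFDerivAt.congr_of_eventuallyEq (Eventually.of_forall fun τ => ?_)
      exact congrArg Q (Moduli.chart_proj hB hk hL Y (c τ))
    refine ⟨h1.mdifferentiableAt, ?_⟩
    rw [h1.mfderiv]
    exact ContinuousLinearMap.toSpanSingleton_apply_one ℝ
      (horizontalToTangent Q hk L Y.hol⁻¹ (c 0) a)
  · refine (Moduli.metricInner_map Q (proj X) _ _).trans ?_
    rw [← hY, ← metricForm_eq_of_proj_eq hB hk hL hX (Moduli.proj_out (proj X)).symm,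
      metricForm_apply hB hk hL X hX ((mem_horizontal_iff hk X _).1 a.2)
        ((mem_horizontal_iff hk X _).1 b.2), l2Inner_eq]

end TangentSpaces

/-! ### Functions which do not expand the Riemannian distance -/

section RiemannianDistance

variable {m : ℕ} {M : Type*} [TopologicalSpace M] [ChartedSpace (EuclideanSpace ℝ (Fin m)) M]
  [IsManifold (𝓡 m) ∞ M]

/-- Integrate the derivative of `f` along a curve whose length is close to the distance. -/
theorem edist_le_riemannianEDist [RiemannianBundle (fun p : M => TangentSpace (𝓡 m) p)] {f : M → ℝ}
    (hf : ContMDiff (𝓡 m) 𝓘(ℝ, ℝ) 1 f)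
    (hdf : ∀ (p : M) (v : TangentSpace (𝓡 m) p), abs (α := ℝ) (mfderiv (𝓡 m) 𝓘(ℝ, ℝ) f p v) ≤ ‖v‖) (p q : M) :
    edist (f p) (f q) ≤ riemannianEDist (𝓡 m) p q := by
  refine le_of_forall_gt fun r hr => ?_
  obtain ⟨γ, hγp, hγq, hγ, hlen, -⟩ :=
    exists_lt_locally_constant_of_riemannianEDist_lt hr zero_lt_one
  refine lt_of_le_of_lt ?_ hlen
  have hc : ContDiff ℝ 1 (f ∘ γ) := contMDiff_iff_contDiff.1 (hf.comp hγ)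
  have h1 := enorm_sub_le_lintegral_deriv_of_contDiffOn_Icc hc.contDiffOn zero_le_one
  rw [edist_comm, edist_eq_enorm_sub, ← hγp, ← hγq]
  refine h1.trans ?_
  rw [pathELength_eq_lintegral_mfderiv_Icc]
  refine lintegral_mono fun t => ?_
  have h2 := mfderiv_comp t (hf.mdifferentiable one_ne_zero (γ t)) (hγ.mdifferentiable one_ne_zero t)
  have h3 : deriv (f ∘ γ) t = mfderiv (𝓡 m) 𝓘(ℝ, ℝ) f (γ t)
      (mfderiv 𝓘(ℝ, ℝ) (𝓡 m) γ t (1 : ℝ)) := by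
    rw [← fderiv_apply_one_eq_deriv, ← mfderiv_eq_fderiv, h2]
    rfl
  have h4 : ‖deriv (f ∘ γ) t‖ ≤ ‖mfderiv 𝓘(ℝ, ℝ) (𝓡 m) γ t (1 : ℝ)‖ := by
    rw [h3]
    exact hdf (γ t) _
  rw [← ofReal_norm, ← ofReal_norm]
  exact ENNReal.ofReal_le_ofReal h4

end RiemannianDistance

/-! ### The `L²` norm of the solutions -/

section SquareRoot

variable {W : Type*} [NormedAddCommGroup W] [NormedSpace ℝ W] (β : W →L[ℝ] W →L[ℝ] ℝ)

/-- Cauchy-Schwarz via the discriminant. The form may be degenerate, as is the case for `l2Kill`,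
which ignores `X₀`. -/
theorem sq_le_mul_of_nonneg (hβ : ∀ x y, β x y = β y x) (h0 : ∀ x, 0 ≤ β x x) (x y : W) :
    (β x y) ^ 2 ≤ β x x * β y y := by
  have h2 : ∀ s : ℝ, 0 ≤ β y y * (s * s) + 2 * β x y * s + β x x := fun s => by
    have h3 := h0 (x + s • y)
    have h4 : ∀ z, β (x + s • y) z = β x z + s * β y z := fun z => by
      rw [β.map_add, β.map_smul]
      rfl
    rw [h4, (β x).map_add, (β y).map_add, (β x).map_smul, (β y).map_smul, hβ y x] at h3
    simp only [smul_eq_mul] at h3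
    linarith
  have h5 := discrim_le_zero h2
  rw [discrim] at h5
  linarith

theorem hasFDerivAt_sqrt_one_add (hβ : ∀ x y, β x y = β y x) (h0 : ∀ x, 0 ≤ β x x) (x : W) :
    HasFDerivAt (fun x => √(1 + β x x)) ((√(1 + β x x))⁻¹ • β x) x := by
  have hpos : 0 < 1 + β x x := by linarith [h0 x]
  have h1 : HasFDerivAt (fun x => 1 + β x x) ((2 : ℝ) • β x) x := by
    refine ((β.hasFDerivAt.clm_apply (hasFDerivAt_id x)).const_add 1).congr_fderiv ?_
    ext a
    change β x a + β a x = 2 * β x a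
    rw [hβ a x]
    ring
  refine (h1.sqrt hpos.ne').congr_fderiv ?_
  ext a
  change 1 / (2 * √(1 + β x x)) * (2 * β x a) = (√(1 + β x x))⁻¹ * β x a
  field_simp

/-- The summand `1` keeps the radicand away from zero, so the root is smooth everywhere. -/
theorem contDiff_sqrt_one_add (h0 : ∀ x, 0 ≤ β x x) : ContDiff ℝ ∞ (fun x => √(1 + β x x)) :=
  ContDiff.sqrt (contDiff_const.add (β.contDiff.clm_apply contDiff_id))
    fun x => (by linarith [h0 x] : 0 < 1 + β x x).ne'

theorem abs_fderiv_sqrt_one_add_le (hβ : ∀ x y, β x y = β y x) (h0 : ∀ x, 0 ≤ β x x) (x a : W) :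
    |(√(1 + β x x))⁻¹ * β x a| ≤ √(β a a) := by
  have hs : 0 < √(1 + β x x) := Real.sqrt_pos.2 (by linarith [h0 x])
  rw [inv_mul_eq_div, abs_div, abs_of_pos hs, div_le_iff₀ hs, ← Real.sqrt_mul (h0 a),
    ← Real.sqrt_sq_eq_abs]
  refine Real.sqrt_le_sqrt ((sq_le_mul_of_nonneg β hβ h0 x a).trans ?_)
  nlinarith [h0 a]

end SquareRoot

section Energy

variable {E : Type u} [NormedAddCommGroup E] [NormedSpace ℝ E] [FiniteDimensional ℝ E]
  [CompleteSpace E]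
variable {G : Type v} [TopologicalSpace G] [ChartedSpace E G] [Group G] [LieGroup 𝓘(ℝ, E) ∞ G]
variable {B : LinearMap.BilinForm ℝ E} {k : ℕ∞}

/-- The `L²` inner product of the components with positive index. -/
def l2Kill (B : LinearMap.BilinForm ℝ E) :
    C(unitInterval, Fin 8 → E) →L[ℝ] C(unitInterval, Fin 8 → E) →L[ℝ] ℝ :=
  (l2Path B).bilinearComp (pmap (kill0 E)) (pmap (kill0 E))

theorem l2Kill_apply (x y : C(unitInterval, Fin 8 → E)) :
    l2Kill B x y = l2Path B (pmap (kill0 E) x) (pmap (kill0 E) y) := rfl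

theorem l2Kill_nonneg (hB : IsInvariantInner G B) (x : C(unitInterval, Fin 8 → E)) :
    0 ≤ l2Kill B x x := l2Path_nonneg hB _

theorem bilin8_kill0_le (hB : IsInvariantInner G B) (x : Fin 8 → E) :
    bilin8 B (kill0 E x) (kill0 E x) ≤ bilin8 B x x := by
  rw [bilin8_apply, bilin8_apply]
  refine Finset.sum_le_sum fun i _ => ?_
  by_cases hi : i = 0
  · rw [hi, kill0_zero, map_zero]
    exact hB.nonneg _
  · rw [kill0_of_ne _ hi]

theorem intervalIntegrable_bilin8 (x : C(unitInterval, Fin 8 → E)) :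
    IntervalIntegrable (fun t => bilin8 B (pext x t) (pext x t)) volume 0 1 := by
  have := continuous_pext x
  exact (by fun_prop : Continuous fun t => bilin8 B (pext x t) (pext x t)).intervalIntegrable _ _

theorem l2Kill_le (hB : IsInvariantInner G B) (x : C(unitInterval, Fin 8 → E)) :
    l2Kill B x x ≤ l2Path B x x :=
  intervalIntegral.integral_mono_on zero_le_one (intervalIntegrable_bilin8 (pmap (kill0 E) x))
    (intervalIntegrable_bilin8 x) fun _ _ => bilin8_kill0_le hB _

/-- The components with positive index transform by `Ad(g)` alone, which is an isometry of `B`. -/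
theorem l2Kill_eq_of_proj_eq [T2Space G] (hB : IsInvariantInner G B) (hk : 1 ≤ k)
    {X Y : Solution E G k} (h : proj X = proj Y) : l2Kill B X.1.1 X.1.1 = l2Kill B Y.1.1 Y.1.1 := by
  obtain ⟨r, g, hg, hg1, hYX⟩ :=
    ((gaugeRel_iff hB hk).2 ((proj_eq_iff hB hk).1 h)).exists_path
  have h1 : pmap (kill0 E) Y.1.1 = hg.ad8 (pmap (kill0 E) X.1.1) := by
    rw [hYX]
    ext t i
    change kill0 E (hg.ad8 X.1.1 t - inj0 E (r t)) i = AdL (g t) (kill0 E (X.1.1 t) i)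
    by_cases hi : i = 0
    · rw [hi, kill0_zero, kill0_zero, map_zero]
    · rw [kill0_of_ne _ hi, kill0_of_ne _ hi, Pi.sub_apply, inj0_of_ne _ hi, sub_zero]
      rfl
  rw [l2Kill_apply, l2Kill_apply, h1, hg.l2Path_ad8 hB]

theorem l2Kill_symm (hB : IsInvariantInner G B) (x y : C(unitInterval, Fin 8 → E)) :
    l2Kill B x y = l2Kill B y x := l2Path_symm hB _ _

/-- A function of the solutions which measures the size of the components with positive index. -/
def energyPath (B : LinearMap.BilinForm ℝ E) (x : C(unitInterval, Fin 8 → E)) : ℝ :=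
  √(1 + l2Kill B x x)

theorem contDiff_energyPath (hB : IsInvariantInner G B) :
    ContDiff ℝ ∞ (energyPath B : C(unitInterval, Fin 8 → E) → ℝ) :=
  contDiff_sqrt_one_add (l2Kill B) (l2Kill_nonneg hB)

theorem hasFDerivAt_energyPath (hB : IsInvariantInner G B) (x : C(unitInterval, Fin 8 → E)) :
    HasFDerivAt (energyPath B) ((√(1 + l2Kill B x x))⁻¹ • l2Kill B x) x :=
  hasFDerivAt_sqrt_one_add (l2Kill B) (l2Kill_symm hB) (l2Kill_nonneg hB) x

theorem abs_fderiv_energyPath_le (hB : IsInvariantInner G B) (x a : C(unitInterval, Fin 8 → E)) :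
    |fderiv ℝ (energyPath B) x a| ≤ √(l2Path B a a) := by
  rw [(hasFDerivAt_energyPath hB x).fderiv]
  exact (abs_fderiv_sqrt_one_add_le (l2Kill B) (l2Kill_symm hB) (l2Kill_nonneg hB) _ _).trans
    (Real.sqrt_le_sqrt (l2Kill_le hB _))

/-- A proper function on the moduli space which does not expand the Riemannian distance. -/
def Moduli.energy (B : LinearMap.BilinForm ℝ E) (q : Moduli E G k) : ℝ :=
  energyPath B (Quot.out q : Solution E G k).1.1

theorem Moduli.energy_proj [T2Space G] (hB : IsInvariantInner G B) (hk : 1 ≤ k)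
    (X : Solution E G k) : (proj X).energy B = energyPath B X.1.1 := by
  rw [energy, energyPath, energyPath, l2Kill_eq_of_proj_eq hB hk (Moduli.proj_out (proj X))]

end Energy

/-! ### The energy does not expand the distance -/

section EnergyDistance

variable {E : Type u} [NormedAddCommGroup E] [NormedSpace ℝ E] [FiniteDimensional ℝ E]
  [CompleteSpace E]
variable {G : Type v} [TopologicalSpace G] [ChartedSpace E G] [Group G] [LieGroup 𝓘(ℝ, E) ∞ G]
  [T2Space G]
variable {B : LinearMap.BilinForm ℝ E} {k : ℕ∞}
variable {m : ℕ} [ChartedSpace (EuclideanSpace ℝ (Fin m)) (Moduli E G k)]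
  [IsManifold (𝓡 m) ∞ (Moduli E G k)]

theorem Moduli.contMDiff_energy (hB : IsInvariantInner G B) (hk : 1 ≤ k)
    (hQ : IsQuotientManifold E G k m) :
    ContMDiff (𝓡 m) 𝓘(ℝ, ℝ) ∞ (energy B : Moduli E G k → ℝ) := by
  intro q
  obtain ⟨X, rfl⟩ : ∃ X : Solution E G k, proj X = q := ⟨_, proj_out q⟩
  obtain ⟨U, hU, hXU, s, -, hs, hsm⟩ := hQ.exists_section X
  have h1 := ((contDiff_energyPath hB).contMDiff.comp_contMDiffOn
    (hsm 0 (by simp)))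
  refine (h1.congr fun q hq => ?_).contMDiffAt (hU.mem_nhds hXU)
  nth_rewrite 1 [← hs q hq]
  rw [energy_proj hB hk, Function.comp_apply, CkPath.iterDeriv_zero]

/-- A tangent vector is the velocity of the projection of a curve of solutions with horizontal
velocity `a`, and its length is the `L²` norm of `a`; the bound is therefore the one for
`energyPath` on paths. -/
theorem Moduli.abs_mfderiv_energy_le (hB : IsInvariantInner G B) (hk : 1 ≤ k)
    (hQ : IsQuotientManifold E G k m) (g : ContMDiffRiemannianMetric (𝓡 m) ∞
      (EuclideanSpace ℝ (Fin m)) (fun p : Moduli E G k => TangentSpace (𝓡 m) p))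
    (hg : IsL2Metric E G hk B g) (q : Moduli E G k) (v : TangentSpace (𝓡 m) q) :
    abs (α := ℝ) (mfderiv (𝓡 m) 𝓘(ℝ, ℝ) (energy B : Moduli E G k → ℝ) q v) ≤
      √(g.inner q v v) := by
  obtain ⟨X, rfl⟩ : ∃ X : Solution E G k, proj X = q := ⟨_, proj_out q⟩
  obtain ⟨Θ, hΘ, hΘc, hΘg⟩ := hg X
  obtain ⟨a, rfl⟩ := Θ.surjective v
  obtain ⟨c, hc⟩ := hΘ a
  obtain ⟨hd, hd1⟩ := hΘc a c hc
  obtain ⟨rfl, -, hca⟩ := hc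
  have h1 := mfderiv_comp (0 : ℝ)
    ((contMDiff_energy hB hk hQ).mdifferentiable (by simp) (proj (c 0))) hd
  have h2 : mfderiv (𝓡 m) 𝓘(ℝ, ℝ) (energy B) (proj (c 0)) (Θ a) =
      deriv (energy B ∘ fun τ => proj (c τ)) 0 := by
    rw [← fderiv_apply_one_eq_deriv, ← mfderiv_eq_fderiv, h1, ← hd1]
    rfl
  have h3 : HasDerivAt (fun τ => (c τ).1.1) a.1.1 0 :=
    ((hca 0 (by simp)).congr_of_eventuallyEq (Eventually.of_forall fun τ =>
      ((c τ).1.iterDeriv_zero _).symm)).congr_deriv (a.1.iterDeriv_zero _)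
  have h4 : energy B ∘ (fun τ => proj (c τ)) =
      fun τ => energyPath B (c τ).1.1 :=
    funext fun τ => energy_proj hB hk (c τ)
  have h5 := (((contDiff_energyPath hB).differentiable (by simp)
    (c 0).1.1).hasFDerivAt).comp_hasDerivAt (0 : ℝ) h3
  rw [hΘg, l2Inner_eq, h2, h4]
  exact (congrArg abs h5.deriv).trans_le (abs_fderiv_energyPath_le hB _ _)

theorem Moduli.edist_energy_le (hB : IsInvariantInner G B) (hk : 1 ≤ k)
    (hQ : IsQuotientManifold E G k m) (g : ContMDiffRiemannianMetric (𝓡 m) ∞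
      (EuclideanSpace ℝ (Fin m)) (fun p : Moduli E G k => TangentSpace (𝓡 m) p))
    (hg : IsL2Metric E G hk B g) (p q : Moduli E G k) :
    letI : RiemannianBundle (fun p : Moduli E G k => TangentSpace (𝓡 m) p) := ⟨g.toRiemannianMetric⟩
    edist (energy B p) (energy B q) ≤ riemannianEDist (𝓡 m) p q := by
  let _ : RiemannianBundle (fun p : Moduli E G k => TangentSpace (𝓡 m) p) := ⟨g.toRiemannianMetric⟩
  refine edist_le_riemannianEDist ((contMDiff_energy hB hk hQ).of_le (by simp)) (fun q v => ?_) p q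
  rw [norm_eq_sqrt_real_inner]
  exact abs_mfderiv_energy_le hB hk hQ g hg q v

end EnergyDistance

/-! ### Compactness -/

section Compactness

variable {E : Type u} [NormedAddCommGroup E] [NormedSpace ℝ E] [FiniteDimensional ℝ E]
  [CompleteSpace E]
variable {G : Type v} [TopologicalSpace G] [ChartedSpace E G] [Group G] [LieGroup 𝓘(ℝ, E) ∞ G]
variable {B : LinearMap.BilinForm ℝ E} {k : ℕ∞}

/-- On a ball the coefficients in `quadVolterra_sub` are bounded, so the inverse is Lipschitz on the
image of the ball, and preimages of a convergent sequence form a Cauchy sequence. In the compactness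
argument this excludes that the limiting equation blows up. -/
theorem isClosed_quadVolterra_image {F : Type*} [NormedAddCommGroup F] [NormedSpace ℝ F]
    [CompleteSpace F] (b : F →L[ℝ] F →L[ℝ] F) (C : ℝ) :
    IsClosed (quadVolterra b '' Metric.closedBall 0 C) := by
  obtain ⟨K, hK⟩ := exists_norm_le_mul_norm_add_volterra (F := F)
    (‖pmap (F := F) b‖ * C + ‖pmap (F := F) b.flip‖ * C)
  have hK' : ∀ x ∈ Metric.closedBall 0 C, ∀ y ∈ Metric.closedBall 0 C,
      ‖x - y‖ ≤ max K 1 * ‖quadVolterra b x - quadVolterra b y‖ := by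
    intro x hx y hy
    rw [mem_closedBall_zero_iff] at hx hy
    rw [quadVolterra_sub]
    refine (hK _ ?_ _).trans (mul_le_mul_of_nonneg_right (le_max_left _ _) (norm_nonneg _))
    refine (norm_add_le _ _).trans (add_le_add ?_ ?_)
    · exact (ContinuousLinearMap.le_opNorm _ _).trans (by gcongr)
    · exact (ContinuousLinearMap.le_opNorm _ _).trans (by gcongr)
  have hK1 : 0 < max K 1 := lt_max_of_lt_right one_pos
  refine IsSeqClosed.isClosed fun d d₀ hd hlim => ?_
  choose x hx hxd using hd
  have hcauchy : CauchySeq x := by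
    rw [Metric.cauchySeq_iff]
    intro ε hε
    obtain ⟨N, hN⟩ := Metric.cauchySeq_iff.1 hlim.cauchySeq (ε / max K 1) (by positivity)
    refine ⟨N, fun p hp q hq => ?_⟩
    have h1 := hN p hp q hq
    rw [dist_eq_norm, ← hxd, ← hxd, lt_div_iff₀' hK1] at h1
    rw [dist_eq_norm]
    exact (hK' _ (hx p) _ (hx q)).trans_lt h1
  obtain ⟨x₀, hx₀⟩ := cauchySeq_tendsto_of_complete hcauchy
  refine ⟨x₀, Metric.isClosed_closedBall.mem_of_tendsto hx₀ (Eventually.of_forall hx), ?_⟩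
  refine tendsto_nhds_unique (((contDiff_quadVolterra b (n := 0)).continuous.tendsto x₀).comp hx₀) ?_
  exact hlim.congr fun n => (hxd n).symm

theorem norm_primitive_apply_le {F : Type*} [NormedAddCommGroup F] [NormedSpace ℝ F]
    [CompleteSpace F] {f : C(unitInterval, F)} {u : ℝ → ℝ}
    (hu : IntervalIntegrable u volume 0 1) (h : ∀ t : unitInterval, ‖f t‖ ≤ u t)
    (t : unitInterval) : ‖primitive f t‖ ≤ ∫ s in (0 : ℝ)..1, u s := by
  have hu0 : ∀ s ∈ Icc (0 : ℝ) 1, ‖pext f s‖ ≤ u s := fun s hs => by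
    rw [pext_of_mem _ hs]
    exact h ⟨s, hs⟩
  have hsub : uIcc (0 : ℝ) t ⊆ uIcc 0 1 := by
    rw [uIcc_of_le t.2.1, uIcc_of_le zero_le_one]
    exact Icc_subset_Icc le_rfl t.2.2
  rw [primitive_apply]
  refine (intervalIntegral.norm_integral_le_of_norm_le t.2.1 (Eventually.of_forall fun s hs =>
    hu0 s ⟨hs.1.le, hs.2.trans t.2.2⟩) (hu.mono_set hsub)).trans ?_
  refine intervalIntegral.integral_mono_interval le_rfl t.2.1 t.2.2 ?_ hu
  filter_upwards [ae_restrict_mem measurableSet_Ioc] with s hs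
  exact (norm_nonneg _).trans (hu0 s ⟨hs.1.le, hs.2⟩)

theorem exists_bilin8_le (hB : IsInvariantInner G B) :
    ∃ c : ℝ, 0 < c ∧ ∀ x : Fin 8 → E, ‖x‖ ^ 2 ≤ c * bilin8 B x x := by
  obtain ⟨c, hc, h⟩ := hB.exists_le
  refine ⟨c⁻¹, inv_pos.2 hc, fun x => ?_⟩
  have hb : 0 ≤ c⁻¹ * bilin8 B x x := mul_nonneg (inv_nonneg.2 hc.le) (bilin8_nonneg hB x)
  rw [← Real.le_sqrt (norm_nonneg x) hb]
  refine (pi_norm_le_iff_of_nonneg (Real.sqrt_nonneg _)).2 fun i => ?_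
  rw [Real.le_sqrt (norm_nonneg _) hb, le_inv_mul_iff₀ hc, bilin8_apply]
  exact (h (x i)).trans (Finset.single_le_sum (f := fun i => B (x i) (x i))
    (fun j _ => hB.nonneg _) (Finset.mem_univ i))

/-- The nonlinearity is quadratic, so an `L²` bound on the positive components `z` bounds its
integral uniformly. Hence `z` stays within `C₁` of its initial value, and averaging over time bounds
this initial value by the `L²` norm. -/
theorem exists_norm_le_of_l2Kill_le (hB : IsInvariantInner G B) (R S : ℝ) :
    ∃ C, ∀ (x : C(unitInterval, Fin 8 → E)) (A : C(unitInterval, E)) (y : Fin 8 → E),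
      quadVolterra (nahmB E G) x = nahmDatum A y → ‖A‖ ≤ S → l2Kill B x x ≤ R → ‖x‖ ≤ C := by
  obtain ⟨c, hc, hcB⟩ := exists_bilin8_le hB
  set S' : ℝ := ‖inj0 E‖ * S with hS'
  obtain ⟨N, hN0, hN⟩ : ∃ N : ℝ, 0 ≤ N ∧ ∀ x y, ‖nahmB E G x y‖ ≤ N * ‖x‖ * ‖y‖ :=
    ⟨_, ContinuousLinearMap.opNorm_nonneg _, (nahmB E G).le_opNorm₂⟩
  -- The integral over `[0,1]` of the bound `N (S' + ‖z‖)² ≤ N (2 S'² + 2 ‖z‖²)`, with `‖z‖² ≤ c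
  -- B(z, z)`.
  set C₁ : ℝ := N * (2 * S' ^ 2 + 2 * c * R) with hC₁
  refine ⟨S' + (1 + c * R + C₁ + C₁), fun x A y hx hA hR => ?_⟩
  set z := pmap (kill0 E) x with hz
  set f := pointwise (nahmB E G) x x with hf
  have hS0 : 0 ≤ S := (norm_nonneg _).trans hA
  have hxA : ∀ t, x t = inj0 E (A t) + z t := fun t => by
    rw [← (quadVolterra_nahmB_iff.1 hx).1]
    exact (inj0_add_kill0 (x t)).symm
  have hAt : ∀ t, ‖inj0 E (A t)‖ ≤ S' := fun t =>
    (ContinuousLinearMap.le_opNorm _ _).trans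
      (mul_le_mul_of_nonneg_left ((A.norm_coe_le_norm t).trans hA) (norm_nonneg _))
  have hS'0 : 0 ≤ S' := by positivity
  have hzt : ∀ t, z t = kill0 E y - primitive f t := fun t => by
    have h1 := congrArg (fun w : C(unitInterval, Fin 8 → E) => w t) hx
    change x t + primitive f t = inj0 E (A t) + kill0 E y at h1
    rw [hxA, add_assoc] at h1
    rw [← add_left_cancel h1]
    abel
  have hzB : ∀ t : unitInterval, ‖z t‖ ^ 2 ≤ c * bilin8 B (pext z t) (pext z t) := fun t => by
    rw [pext_coe]
    exact hcB _
  have hint : IntervalIntegrable (fun t => bilin8 B (pext z t) (pext z t)) volume 0 1 :=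
    intervalIntegrable_bilin8 z
  have hintR : ∫ t in (0 : ℝ)..1, bilin8 B (pext z t) (pext z t) ≤ R := hR
  have hf1 : ∀ t : unitInterval, ‖f t‖ ≤
      N * (2 * S' ^ 2 + 2 * c * bilin8 B (pext z t) (pext z t)) := fun t => by
    have h1 : ‖f t‖ ≤ N * ‖x t‖ * ‖x t‖ := hN _ _
    have h2 : ‖x t‖ ≤ S' + ‖z t‖ := by
      rw [hxA]
      exact (norm_add_le _ _).trans (add_le_add_left (hAt t) _)
    have h3 : ‖x t‖ * ‖x t‖ ≤ 2 * S' ^ 2 + 2 * ‖z t‖ ^ 2 := by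
      nlinarith [norm_nonneg (x t), norm_nonneg (z t), sq_nonneg (S' - ‖z t‖)]
    rw [mul_assoc] at h1
    refine h1.trans (mul_le_mul_of_nonneg_left (h3.trans ?_) hN0)
    linarith [hzB t]
  have hf2 : ∀ t, ‖primitive f t‖ ≤ C₁ := fun t => by
    refine (norm_primitive_apply_le ((intervalIntegrable_const.add
      (hint.const_mul (2 * c))).const_mul N) hf1 t).trans ?_
    rw [intervalIntegral.integral_const_mul, intervalIntegral.integral_add
      intervalIntegrable_const (hint.const_mul _), intervalIntegral.integral_const_mul (2 * c),
      intervalIntegral.integral_const, sub_zero, one_smul]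
    have h5 := mul_le_mul_of_nonneg_left hintR (by positivity : 0 ≤ 2 * c)
    exact mul_le_mul_of_nonneg_left (by linarith) hN0
  -- At each time `‖kill0 y‖ ≤ ‖z‖ + C₁ ≤ 1 + ‖z‖² + C₁`; integrate over `[0,1]`.
  have hy : ‖kill0 E y‖ ≤ 1 + c * R + C₁ := by
    have h1 : ∀ t ∈ Icc (0 : ℝ) 1, ‖kill0 E y‖ ≤
        (1 + C₁) + c * bilin8 B (pext z t) (pext z t) := fun t ht => by
      have h2 := hzB ⟨t, ht⟩
      have h3 : ‖kill0 E y‖ ≤ ‖z ⟨t, ht⟩‖ + C₁ := by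
        have h4 : kill0 E y = z ⟨t, ht⟩ + primitive f ⟨t, ht⟩ := by
          rw [hzt]
          abel
        rw [h4]
        exact (norm_add_le _ _).trans (add_le_add_right (hf2 _) _)
      nlinarith [sq_nonneg (‖z ⟨t, ht⟩‖ - 1), norm_nonneg (z ⟨t, ht⟩)]
    have h2 := intervalIntegral.integral_mono_on zero_le_one intervalIntegrable_const
      (intervalIntegrable_const.add (hint.const_mul c)) h1
    rw [intervalIntegral.integral_const, sub_zero, one_smul, intervalIntegral.integral_add
      intervalIntegrable_const (hint.const_mul _), intervalIntegral.integral_const_mul,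
      intervalIntegral.integral_const, sub_zero, one_smul] at h2
    nlinarith
  have hz' : ∀ t, ‖z t‖ ≤ 1 + c * R + C₁ + C₁ := fun t => by
    rw [hzt]
    exact (norm_sub_le _ _).trans (add_le_add hy (hf2 t))
  have hC0 : 0 ≤ 1 + c * R + C₁ + C₁ := (norm_nonneg _).trans (hz' 0)
  refine (ContinuousMap.norm_le _ (by positivity)).2 fun t => ?_
  rw [hxA]
  exact (norm_add_le _ _).trans (add_le_add (hAt t) (hz' t))

end Compactness

/-! ### Completeness -/

section Completeness

variable {E : Type u} [NormedAddCommGroup E] [NormedSpace ℝ E] [FiniteDimensional ℝ E]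
  [CompleteSpace E]
variable {G : Type v} [TopologicalSpace G] [ChartedSpace E G] [Group G] [LieGroup 𝓘(ℝ, E) ∞ G]
  [T2Space G]
variable {B : LinearMap.BilinForm ℝ E} {k : ℕ∞}

theorem Solution.continuous_sliceZero (hB : IsInvariantInner G B) (X : Solution E G k) :
    Continuous (X.sliceZero hB) :=
  continuousOn_univ.1 (SmoothInto.contDiffOn
    (X.smoothInto_sliceZero hB (j := 0) (U := univ) (by simp))).continuousOn

theorem Solution.quadVolterra_slice (hB : IsInvariantInner G B) (hk : 1 ≤ k) (X : Solution E G k)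
    {p : Fin 8 → E} (hp : p ∈ X.sliceDom hB) :
    quadVolterra (nahmB E G) (X.slice hB p).1.1 = nahmDatum (X.sliceZero hB p) p := by
  rw [(X.slice_spec hB hk hp).1]
  exact quadVolterra_quadSolve _ hp

theorem Solution.sliceZero_congr (hB : IsInvariantInner G B) (X : Solution E G k) {p q : Fin 8 → E}
    (h : p 0 = q 0) : X.sliceZero hB p = X.sliceZero hB q := by
  rw [sliceZero, sliceZero, h]

variable [CompactSpace G]

/-- Sublevel sets of the energy are compact. -/
theorem Moduli.exists_le_nhds_of_energy_le (hB : IsInvariantInner G B) (hk : 1 ≤ k)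
    (𝒰 : Ultrafilter (Moduli E G k)) {R : ℝ} 
    (hR : ∀ᶠ q in (𝒰 : Filter (Moduli E G k)), energy B q ≤ R) :
    ∃ q, (𝒰 : Filter (Moduli E G k)) ≤ 𝓝 q := by
  have : IsTopologicalGroup G := topologicalGroup_of_lieGroup 𝓘(ℝ, E) ∞
  have : ProperSpace E := FiniteDimensional.proper_real E
  obtain ⟨L, hL⟩ := exists_isLog (E := E) hB
  obtain ⟨g, -, hg⟩ := isCompact_univ.ultrafilter_le_nhds
    (𝒰.map (hol : Moduli E G k → G)) (by simp)
  have hg : Tendsto hol (𝒰 : Filter (Moduli E G k)) (𝓝 g) := hg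
  -- The limit `g` is not known to be the holonomy of a solution, so the centre of the slice is
  -- taken among points whose holonomy is close to `g`.
  obtain ⟨q₀, hq₀⟩ : ∃ q₀ : Moduli E G k, q₀.hol⁻¹ * g ∈ L.source := by
    have h1 : Tendsto (fun q : Moduli E G k => q.hol⁻¹ * g) 𝒰 (𝓝 (g⁻¹ * g)) :=
      hg.inv.mul tendsto_const_nhds
    rw [inv_mul_cancel] at h1
    exact (h1.eventually (L.open_source.mem_nhds hL.one_mem)).exists
  let X : Solution E G k := Quot.out q₀
  have hξ : Tendsto (fun q : Moduli E G k => L (X.hol⁻¹ * q.hol)) 𝒰 (𝓝 (L (X.hol⁻¹ * g))) :=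
    (L.continuousAt hq₀).tendsto.comp (tendsto_const_nhds.mul hg)
  have hsource : ∀ᶠ q : Moduli E G k in 𝒰, q ∈ (chart hB hk hL X).source :=
    (tendsto_const_nhds.mul hg).eventually (L.open_source.mem_nhds hq₀)
  have hzero : ∀ q, X.sliceZero hB (chart hB hk hL X q) =
      X.sliceZero hB (inj0 E (L (X.hol⁻¹ * q.hol))) := fun q =>
    X.sliceZero_congr hB ((chart_zero _ q).trans (inj0_zero _).symm)
  have hbound : ∃ S, ∀ᶠ q : Moduli E G k in 𝒰, ‖X.sliceZero hB (chart hB hk hL X q)‖ ≤ S := by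
    have h1 : Tendsto (fun q => ‖X.sliceZero hB (chart hB hk hL X q)‖) 𝒰
        (𝓝 ‖X.sliceZero hB (inj0 E (L (X.hol⁻¹ * g)))‖) := by
      simp only [hzero]
      exact (((X.continuous_sliceZero hB).comp (inj0 E).continuous).norm.tendsto _).comp hξ
    exact ⟨_, h1.eventually (Iic_mem_nhds (lt_add_one _))⟩
  obtain ⟨S, hS⟩ := hbound
  -- An energy of at most `R` means `1 + l2Kill ≤ R ^ 2`.
  obtain ⟨C, hC⟩ := exists_norm_le_of_l2Kill_le hB (R ^ 2) S
  have hY : ∀ᶠ q : Moduli E G k in 𝒰, ‖(X.slice hB (chart hB hk hL X q)).1.1‖ ≤ C := by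
    filter_upwards [hsource, hS, hR] with q hq hqS hqR
    refine hC _ _ _ (X.quadVolterra_slice hB hk ((chart hB hk hL X).map_source hq).2) hqS ?_
    have h1 : proj (X.slice hB (chart hB hk hL X q)) = q := (chart hB hk hL X).left_inv hq
    rw [← h1, energy_proj hB hk, energyPath, Real.sqrt_le_iff] at hqR
    linarith [hqR.2]
  have hinit : ∀ᶠ q : Moduli E G k in 𝒰, q.init ∈ Metric.closedBall 0 (‖kill0 E‖ * C) := by
    filter_upwards [hsource, hY] with q hq hqY
    have h1 : proj (X.slice hB (chart hB hk hL X q)) = q := (chart hB hk hL X).left_inv hq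
    rw [mem_closedBall_zero_iff, ← h1, init_proj hB hk]
    refine (ContinuousLinearMap.le_opNorm _ _).trans (mul_le_mul_of_nonneg_left ?_ (norm_nonneg _))
    exact ((X.slice hB (chart hB hk hL X q)).1.1.norm_coe_le_norm 0).trans hqY
  obtain ⟨y, -, hy⟩ := (isCompact_closedBall (0 : Fin 8 → E) (‖kill0 E‖ * C)).ultrafilter_le_nhds
    (𝒰.map (init : Moduli E G k → Fin 8 → E)) (le_principal_iff.2 hinit)
  have hy : Tendsto init (𝒰 : Filter (Moduli E G k)) (𝓝 y) := hy
  have hy0 : kill0 E y = y := tendsto_nhds_unique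
    ((((kill0 E).continuous.tendsto y).comp hy).congr fun q => kill0_init q) hy
  set p : Fin 8 → E := inj0 E (L (X.hol⁻¹ * g)) + y with hp
  have hP : Tendsto (chart hB hk hL X) 𝒰 (𝓝 p) :=
    (((inj0 E).continuous.tendsto _).comp hξ).add hy
  have hdom : p ∈ X.sliceDom hB := by
    have h1 : Continuous (fun p => nahmDatum (X.sliceZero hB p) p) :=
      ((pmap (inj0 E)).continuous.comp (X.continuous_sliceZero hB)).add
        ((constPath (F := Fin 8 → E)).continuous.comp (kill0 E).continuous)
    -- The data along the ultrafilter come from solutions in a fixed ball, so their limit lies in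
    -- the closed image of this ball.
    refine image_subset_range _ _ ((isClosed_quadVolterra_image (nahmB E G) C).mem_of_tendsto
      ((h1.tendsto p).comp hP) ?_)
    filter_upwards [hsource, hY] with q hq hqY
    exact ⟨_, mem_closedBall_zero_iff.2 hqY,
      X.quadVolterra_slice hB hk ((chart hB hk hL X).map_source hq).2⟩
  have htarget : p ∈ (chart hB hk hL X).target := by
    refine ⟨?_, hdom⟩
    rw [mem_ofPred_eq, hp, ← hy0, Pi.add_apply, inj0_zero, kill0_zero, add_zero]
    exact L.map_source hq₀
  refine ⟨(chart hB hk hL X).symm p, ?_⟩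
  have h1 := ((chart hB hk hL X).continuousAt_symm htarget).tendsto.comp hP
  refine Tendsto.congr' ?_ h1
  filter_upwards [hsource] with q hq
  exact (chart hB hk hL X).left_inv hq

variable {m : ℕ} [ChartedSpace (EuclideanSpace ℝ (Fin m)) (Moduli E G k)]
  [IsManifold (𝓡 m) ∞ (Moduli E G k)]

/-- A Cauchy sequence eventually stays within distance `1` of one of its points, so its energy is
bounded and it has a cluster point; a Cauchy sequence converges to any cluster point. -/
theorem isCompleteMetric (hB : IsInvariantInner G B) (hk : 1 ≤ k)
    (hQ : IsQuotientManifold E G k m) (g : ContMDiffRiemannianMetric (𝓡 m) ∞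
      (EuclideanSpace ℝ (Fin m)) (fun p : Moduli E G k => TangentSpace (𝓡 m) p))
    (hg : IsL2Metric E G hk B g) : IsCompleteMetric g := by
  let _ : RiemannianBundle (fun p : Moduli E G k => TangentSpace (𝓡 m) p) := ⟨g.toRiemannianMetric⟩
  intro x hx
  have : IsContinuousRiemannianBundle (EuclideanSpace ℝ (Fin m))
      (fun p : Moduli E G k => TangentSpace (𝓡 m) p) :=
    ⟨⟨g.inner, g.contMDiff.continuous, fun _ _ _ => rfl⟩⟩
  have : IsManifold (𝓡 m) 1 (Moduli E G k) := IsManifold.of_le (n := ∞) (by simp)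
  obtain ⟨N, hN⟩ := hx 1 one_pos
  have henergy : ∀ n ≥ N, Moduli.energy B (x n) ≤ Moduli.energy B (x N) + 1 := fun n hn => by
    have h1 := (Moduli.edist_energy_le hB hk hQ g hg (x n) (x N)).trans_lt (hN n hn N le_rfl)
    rw [edist_dist, ENNReal.ofReal_lt_one, Real.dist_eq] at h1
    linarith [(abs_lt.1 h1).2]
  -- An ultrafilter finer than `atTop` takes the place of a convergent subsequence.
  obtain ⟨y, hy⟩ := Moduli.exists_le_nhds_of_energy_le hB hk ((Ultrafilter.of atTop).map x)
    (R := Moduli.energy B (x N) + 1) (Ultrafilter.of_le atTop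
      ((eventually_ge_atTop N).mono henergy))
  refine ⟨y, ENNReal.tendsto_nhds_zero.2 fun ε hε => ?_⟩
  have hε2 : 0 < ε / 2 := ENNReal.half_pos hε.ne'
  obtain ⟨N', hN'⟩ := hx (ε / 2) hε2
  have h1 : ∀ᶠ n in (Ultrafilter.of (atTop : Filter ℕ) : Filter ℕ),
      riemannianEDist (𝓡 m) y (x n) < ε / 2 := hy (eventually_riemannianEDist_lt (𝓡 m) y hε2)
  obtain ⟨n₀, hn₀, hn₀'⟩ :=
    (h1.and (Ultrafilter.of_le atTop (eventually_ge_atTop N'))).exists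
  filter_upwards [eventually_ge_atTop N'] with n hn
  refine (riemannianEDist_triangle (y := x n₀)).trans ?_
  rw [← ENNReal.add_halves ε, riemannianEDist_comm (x := x n₀)]
  exact add_le_add (hN' n hn n₀ hn₀').le hn₀.le

end Completeness

end OctNahm

end

/-! ### The main theorem. -/

theorem mainTheorem1 {E : Type*} [NormedAddCommGroup E] [NormedSpace ℝ E] [FiniteDimensional ℝ E]
    {G : Type*} [TopologicalSpace G] [ChartedSpace E G] [Group G] [LieGroup 𝓘(ℝ, E) ∞ G]
    [CompactSpace G] [T2Space G]
    (B : LinearMap.BilinForm ℝ E)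
    (hB_symm : ∀ x y : E, B x y = B y x)
    (hB_pos : ∀ x : E, x ≠ 0 → 0 < B x x)
    (hB_inv : ∀ x y z : E,
      B (OctNahm.lie G x y) z = B x (OctNahm.lie G y z))
    (k : ℕ∞) (hk : 1 ≤ k) :
    ∃ (_ : ChartedSpace (EuclideanSpace ℝ (Fin (8 * Module.finrank ℝ E))) (OctNahm.Moduli E G k))
      (_ : IsManifold (𝓡 (8 * Module.finrank ℝ E)) ∞ (OctNahm.Moduli E G k)),
      T2Space (OctNahm.Moduli E G k) ∧
      SecondCountableTopology (OctNahm.Moduli E G k) ∧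
      OctNahm.IsQuotientManifold E G k (8 * Module.finrank ℝ E) ∧
      ∃ g : ContMDiffRiemannianMetric (𝓡 (8 * Module.finrank ℝ E)) ∞
          (EuclideanSpace ℝ (Fin (8 * Module.finrank ℝ E)))
          (fun p : OctNahm.Moduli E G k => TangentSpace (𝓡 (8 * Module.finrank ℝ E)) p),
        OctNahm.IsL2Metric E G hk B g ∧ OctNahm.IsCompleteMetric g := by
  have : CompleteSpace E := FiniteDimensional.complete ℝ E
  have hB : OctNahm.IsInvariantInner G B := ⟨hB_symm, hB_pos, hB_inv⟩
  obtain ⟨L, hL⟩ := OctNahm.exists_isLog (E := E) hB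
  have Q : (Fin 8 → E) ≃L[ℝ] EuclideanSpace ℝ (Fin (8 * Module.finrank ℝ E)) :=
    ContinuousLinearEquiv.ofFinrankEq (by
      rw [finrank_euclideanSpace_fin, Module.finrank_pi_fintype]; simp)
  have hQ := OctNahm.Moduli.isQuotientManifold (k := k) Q hB hk hL
  have hg := OctNahm.isL2Metric (k := k) Q hB hk hL
  let _ := OctNahm.Moduli.chartedSpace (k := k) Q hB hk hL
  have := OctNahm.Moduli.isManifold (k := k) Q hB hk hL
  exact ⟨inferInstance, inferInstance, OctNahm.Moduli.t2Space hB hk,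
    OctNahm.Moduli.secondCountableTopology hB hk, hQ, OctNahm.Moduli.metric Q hB hk hL, hg,
    OctNahm.isCompleteMetric hB hk hQ _ hg⟩
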